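/- For $n\ge 2$ let $\Omega\subset S^{n-1}\subset\mathbb R^n$ be a closed spherical domain with cone $D=\{x: x=0 \text{ or } x/|x|\in\Omega\}$, and let $\nabla_S^2$ be the Laplace–Beltrami operator of the sphere, i.e. $r^2\nabla^2$ acting on functions on $D$ that are positively homogeneous of degree $0$. Consider the eigenvalue problem $\nabla_S^2h=-\lambda h$ for real functions $h$ on $\Omega$ that are continuous on $\Omega$ and $C^2$ in its interior, under the Dirichlet condition ($h=0$ on $\partial\Omega$) or the Neumann condition ($h$ is $C^1$ up to the boundary and its normal derivative vanishes on $\partial\Omega$). Write the eigenvalues as $\lambda=\nu(\nu+n-2)$ with $\nu\ge 0$, let $m_\nu$ be the multiplicity of $\nu(\nu+n-2)$, let $\nu_1$ be the smallest $\nu$ that occurs, and define the spectral function $M(z)=\sum_\nu m_\nu z^\nu$ for $0<z<1$. In each case below all eigenvalues are nonnegative, all multiplicities are finite, and the series for $M(z)$ converges to the stated value for every $0<z<1$. (1) Whole sphere $\Omega=S^{n-1}$, $n\ge 2$ (no boundary): $$M(z)=(1-z^2)(1-z)^{-n}=1+nz+\sum_{k\ge 2}\left[\binom{n+k-1}{k}-\binom{n+k-3}{k-2}\right]z^k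 .$$ The values of $\nu$ are exactly $0,1,2,\dots$; and $m_k$ is the dimension of the space of harmonic homogeneous polynomials of degree $k$ in $n$ variables, with $m_0=1$, $m_1=n$ and $m_k=\binom{n+k-1}{k}-\binom{n+k-3}{k-2}$ for $k\ge 2$. (2) Orthant simplex $T^{n-1}=\{x\in S^{n-1}: x_i\ge 0 \text{ for all } i\}$, $n\ge 2$: under Dirichlet conditions $$M(z)=z^n(1-z^2)^{1-n}=\sum_{k\ge 1}\binom{n+k-3}{k-1}z^{n+2k-2},$$ so that $\nu_1=n$; under Neumann conditions $M(z)=(1-z^2)^{1-n}$. (3) For $p,q\ge 1$ let $S^{p-1}*T^{q-1}\subset S^{p+q-1}$ be the join, i.e. the set of unit vectors of the product $\mathbb R^p\times\mathbb R_{\ge 0}^q$ of the cones of $S^{p-1}$ and $T^{q-1}$. Under Dirichlet conditions $M(z)=z^q(1-z)^{-p}(1-z^2)^{1-q}$; under Neumann conditions $M(z)=(1-z)^{-p}(1-z^2)^{1-q}$. -/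

import Mathlib

namespace SphericalSpectrum

open InnerProductSpace

/-- The unit sphere `S^{n-1}` in Euclidean space `ℝⁿ`, `n = card ι`. -/
def unitSphere (ι : Type*) [Fintype ι] : Set (EuclideanSpace ℝ ι) :=
  {x | ‖x‖ = 1}

/-- The orthant simplex `T^{n-1}`: the part of the unit sphere in the closed orthant. -/
def orthantSimplex (ι : Type*) [Fintype ι] : Set (EuclideanSpace ℝ ι) :=
  {x | ‖x‖ = 1 ∧ ∀ i, 0 ≤ x i}

/-- The unbounded cone through `Ω`: all vectors whose unit radial vector lies in `Ω`,
together with the origin. -/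
def cone {ι : Type*} [Fintype ι] (Ω : Set (EuclideanSpace ℝ ι)) : Set (EuclideanSpace ℝ ι) :=
  {x | x = 0 ∨ ‖x‖⁻¹ • x ∈ Ω}

/-- The join `Ω₁ * Ω₂` of two spherical domains: the unit vectors of the Cartesian product of
the two cones. -/
def join {ι κ : Type*} [Fintype ι] [Fintype κ] (Ω₁ : Set (EuclideanSpace ℝ ι))
    (Ω₂ : Set (EuclideanSpace ℝ κ)) : Set (EuclideanSpace ℝ (ι ⊕ κ)) :=
  {x | ‖x‖ = 1 ∧ WithLp.toLp 2 (fun i => x (Sum.inl i)) ∈ cone Ω₁ ∧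
    WithLp.toLp 2 (fun j => x (Sum.inr j)) ∈ cone Ω₂}

section Eigen

variable {ι : Type*} [Fintype ι] {Ω : Set (EuclideanSpace ℝ ι)}

open Classical in
/-- The extension of a function on a spherical domain to its cone as a function that is
homogeneous of degree zero (value `0` off the cone and at the origin). -/
noncomputable def radialExt (h : Ω → ℝ) (x : EuclideanSpace ℝ ι) : ℝ :=
  if hx : ‖x‖⁻¹ • x ∈ Ω then h ⟨‖x‖⁻¹ • x, hx⟩ else 0

/-- The Laplace–Beltrami operator of the sphere: `r² ∇²` applied to the extension which is
homogeneous of degree zero, evaluated at points with `r = 1`. -/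
noncomputable def sphericalLaplacian (h : Ω → ℝ) (ω : Ω) : ℝ :=
  Laplacian.laplacian (radialExt h) (ω : EuclideanSpace ℝ ι)

/-- `v` is an outer normal vector (possibly zero) of `D` at `x`: it makes an angle of at least
`90°` with every vector of the tangent cone. At a smooth boundary point these are the nonnegative
multiples of the outer unit normal; at an interior point only `v = 0`. -/
def IsOuterNormal (D : Set (EuclideanSpace ℝ ι)) (x v : EuclideanSpace ℝ ι) : Prop :=
  ∀ w ∈ posTangentConeAt D x, inner ℝ v w ≤ 0

/-- The two boundary conditions. -/
inductive BoundaryCondition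
  | dirichlet
  | neumann

/-- A function on the closed domain `Ω` satisfies the boundary condition:
* Dirichlet: it vanishes on the boundary of `Ω`;
* Neumann: it is continuously differentiable up to the boundary, and its normal derivative
  vanishes on the boundary (at interior points the condition on `v` is void). -/
def SatisfiesBC (b : BoundaryCondition) (h : Ω → ℝ) : Prop :=
  match b with
  | .dirichlet => ∀ ω : Ω, (ω : EuclideanSpace ℝ ι) ∈ frontier (cone Ω) → h ω = 0
  | .neumann => ∃ G : Ω → (EuclideanSpace ℝ ι →L[ℝ] ℝ), Continuous G ∧ ∀ ω : Ω,
      HasFDerivWithinAt (radialExt h) (G ω) (cone Ω) (ω : EuclideanSpace ℝ ι) ∧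
      ∀ v, IsOuterNormal (cone Ω) (ω : EuclideanSpace ℝ ι) v → G ω v = 0

/-- `h` is a (classical) solution of `∇_S² h = -lam h` on `Ω` under the boundary condition `b`:
it is continuous on the closed domain, of class `C²` in its interior, solves the equation there
and satisfies the boundary condition. The function `0` is included. -/
structure IsEigenfunction (b : BoundaryCondition) (lam : ℝ) (h : Ω → ℝ) : Prop where
  continuous : Continuous h
  contDiffAt : ∀ ω : Ω, (ω : EuclideanSpace ℝ ι) ∈ interior (cone Ω) →
    ContDiffAt ℝ 2 (radialExt h) (ω : EuclideanSpace ℝ ι)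
  equation : ∀ ω : Ω, (ω : EuclideanSpace ℝ ι) ∈ interior (cone Ω) →
    sphericalLaplacian h ω = -lam * h ω
  boundary : SatisfiesBC b h

theorem radialExt_zero : radialExt (0 : Ω → ℝ) = 0 := by
  funext x; simp [radialExt]

theorem radialExt_add (h g : Ω → ℝ) : radialExt (h + g) = radialExt h + radialExt g := by
  funext x; by_cases hx : ‖x‖⁻¹ • x ∈ Ω <;> simp [radialExt, hx]

theorem radialExt_smul (c : ℝ) (h : Ω → ℝ) : radialExt (c • h) = c • radialExt h := by
  funext x; by_cases hx : ‖x‖⁻¹ • x ∈ Ω <;> simp [radialExt, hx]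

theorem SatisfiesBC.add {b : BoundaryCondition} {h g : Ω → ℝ} (hh : SatisfiesBC b h)
    (hg : SatisfiesBC b g) : SatisfiesBC b (h + g) := by
  cases b with
  | dirichlet => intro ω hω; simp [hh ω hω, hg ω hω]
  | neumann =>
    obtain ⟨G, hGc, hG⟩ := hh
    obtain ⟨K, hKc, hK⟩ := hg
    refine ⟨G + K, hGc.add hKc, fun ω => ⟨?_, fun v hv => ?_⟩⟩
    · rw [radialExt_add]; exact (hG ω).1.add (hK ω).1
    · simp [(hG ω).2 v hv, (hK ω).2 v hv]

theorem SatisfiesBC.smul {b : BoundaryCondition} (c : ℝ) {h : Ω → ℝ} (hh : SatisfiesBC b h) :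
    SatisfiesBC b (c • h) := by
  cases b with
  | dirichlet => intro ω hω; simp [hh ω hω]
  | neumann =>
    obtain ⟨G, hGc, hG⟩ := hh
    refine ⟨c • G, hGc.const_smul c, fun ω => ⟨?_, fun v hv => ?_⟩⟩
    · rw [radialExt_smul]; exact (hG ω).1.const_smul c
    · simp [(hG ω).2 v hv]

theorem SatisfiesBC.zero {b : BoundaryCondition} : SatisfiesBC b (0 : Ω → ℝ) := by
  cases b with
  | dirichlet => intro ω _; rfl
  | neumann =>
    refine ⟨0, continuous_zero, fun ω => ⟨?_, fun v _ => by simp⟩⟩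
    rw [radialExt_zero]; exact hasFDerivWithinAt_const 0 _ _

end Eigen

section Spectrum

variable {ι : Type*} [Fintype ι]

/-- The real vector space of solutions of `∇_S² h = -lam h` on `Ω` under the boundary
condition `b`. -/
noncomputable def eigenspace (b : BoundaryCondition) (Ω : Set (EuclideanSpace ℝ ι)) (lam : ℝ) :
    Submodule ℝ (Ω → ℝ) where
  carrier := {h | IsEigenfunction b lam h}
  zero_mem' := by
    refine ⟨continuous_zero, fun ω _ => ?_, fun ω _ => ?_, SatisfiesBC.zero⟩
    · rw [radialExt_zero]; exact contDiffAt_const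
    · have h0 := laplacian_smul (f := (0 : EuclideanSpace ℝ ι → ℝ))
        (x := (ω : EuclideanSpace ℝ ι)) (0 : ℝ) contDiffAt_const
      rw [zero_smul, zero_smul] at h0
      rw [sphericalLaplacian, radialExt_zero, h0]; simp
  add_mem' := by
    intro h g hh hg
    refine ⟨hh.continuous.add hg.continuous, fun ω hω => ?_, fun ω hω => ?_,
      hh.boundary.add hg.boundary⟩
    · rw [radialExt_add]; exact (hh.contDiffAt ω hω).add (hg.contDiffAt ω hω)
    · have h1 := hh.equation ω hω
      have h2 := hg.equation ω hω
      rw [sphericalLaplacian] at h1 h2 ⊢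
      rw [radialExt_add, (hh.contDiffAt ω hω).laplacian_add (hg.contDiffAt ω hω), h1, h2,
        Pi.add_apply]
      ring
  smul_mem' := by
    intro c h hh
    refine ⟨hh.continuous.const_smul c, fun ω hω => ?_, fun ω hω => ?_, hh.boundary.smul c⟩
    · rw [radialExt_smul]; exact (hh.contDiffAt ω hω).const_smul c
    · have h1 := hh.equation ω hω
      rw [sphericalLaplacian] at h1 ⊢
      rw [radialExt_smul, laplacian_smul c (hh.contDiffAt ω hω), h1, Pi.smul_apply, smul_eq_mul,
        smul_eq_mul]
      ring

/-- The eigenvalue `ν (ν + n - 2)` belonging to the degree `ν` on a domain of `S^{n-1}`. -/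
noncomputable def eigenvalueOfDegree (ι : Type*) [Fintype ι] (ν : ℝ) : ℝ :=
  ν * (ν + (Fintype.card ι : ℝ) - 2)

/-- The degrees `ν ≥ 0` for which `ν (ν + n - 2)` is an eigenvalue of `-∇_S²` on `Ω`. -/
def degrees (b : BoundaryCondition) (Ω : Set (EuclideanSpace ℝ ι)) : Set ℝ :=
  {ν | 0 ≤ ν ∧ eigenspace b Ω (eigenvalueOfDegree ι ν) ≠ ⊥}

/-- The multiplicity `m_ν` of the eigenvalue `ν (ν + n - 2)`. -/
noncomputable def multiplicity (b : BoundaryCondition) (Ω : Set (EuclideanSpace ℝ ι)) (ν : ℝ) :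
    ℕ :=
  Module.finrank ℝ (eigenspace b Ω (eigenvalueOfDegree ι ν))

/-- `M` is the spectral function of `Ω` under the boundary condition `b`:
`M(z) = ∑_ν m_ν z^ν` for `0 < z < 1`, the sum being over all degrees of `Ω`. That every eigenvalue
is nonnegative (and so is accounted for by a degree `ν ≥ 0`) and that every multiplicity is finite
is part of the assertion. -/
def IsSpectralFunction (b : BoundaryCondition) (Ω : Set (EuclideanSpace ℝ ι)) (M : ℝ → ℝ) :
    Prop :=
  (∀ lam : ℝ, eigenspace b Ω lam ≠ ⊥ → 0 ≤ lam) ∧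
  (∀ lam : ℝ, Module.Finite ℝ (eigenspace b Ω lam)) ∧
  ∀ z ∈ Set.Ioo (0 : ℝ) 1,
    HasSum (fun ν : degrees b Ω => (multiplicity b Ω ν : ℝ) * z ^ (ν : ℝ)) (M z)

end Spectrum

/-- The Laplacian `∑ᵢ ∂²/∂xᵢ²` on polynomials in `n` variables. -/
noncomputable def polyLaplacian (n : ℕ) :
    MvPolynomial (Fin n) ℝ →ₗ[ℝ] MvPolynomial (Fin n) ℝ :=
  ∑ i, (MvPolynomial.pderiv (R := ℝ) i).toLinearMap ∘ₗ (MvPolynomial.pderiv i).toLinearMap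

/-- The space of harmonic homogeneous polynomials of degree `k` in `n` real variables. -/
noncomputable def harmonicHomogeneous (n k : ℕ) : Submodule ℝ (MvPolynomial (Fin n) ℝ) :=
  MvPolynomial.homogeneousSubmodule (Fin n) ℝ k ⊓ LinearMap.ker (polyLaplacian n)

end SphericalSpectrum

/-! All the domains are pieces of the unit sphere cut out by `x i ≥ 0` for `i` in a finite set `S`:
`S` is empty for the sphere, everything for the orthant simplex, and the second block of coordinates
for the join. The function `h` has eigenvalue `ν(ν+n-2)` exactly when `r^ν h` is harmonic in the
cone. The claim behind all the formulas is that such an `r^ν h` is a homogeneous harmonic polynomial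
of degree `ν`, odd (Dirichlet) or even (Neumann) in each variable of `S`; in particular `ν` is a
natural number.

That these polynomials give eigenfunctions is a computation (`isEigenfunction_restrictPoly`). For
the converse, Stone–Weierstrass approximates `h` uniformly by polynomials of the right parity
(`exists_parity_near`). Each is replaced by a harmonic polynomial `H` with the same values on the
sphere (`exists_harmonic_eq_on_sphere`), which exists because `q ↦ ∇²((1-|x|²)q)` is an injective
endomorphism of a finite-dimensional space. A maximum principle on the punctured sector of the ball
(`le_of_subharmonic`) keeps `r^ν h` uniformly close to `H`.

Hence `H(x/2)` is close to `2^(-ν) H(x)`, on the whole ball by parity. Harmonic components of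
different degrees are orthogonal for the weight `(1-|x|²)₊`, and `2^(-k)` stays away from `2^(-ν)`
for `k ≠ ν`, so the components of degree `k ≠ ν` are small in mean square. Thus `r^ν h` is an L²
limit of elements of a finite-dimensional, hence closed, space of polynomials, and belongs to it
(`IsEigenfunction.exists_harmonicOfDegree`). Negative eigenvalues are excluded by comparing `h` with
a small power of `r`.

What remains is counting. The Laplacian maps polynomials of given parity and degree `k+2` onto those
of degree `k`, so the dimensions are differences of numbers of monomials, and their generating
function is `1-z²` times one factor per variable: `1/(1-z)` for a free one, `1/(1-z²)` or `z/(1-z²)`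
for one in `S`. -/

namespace SphericalSpectrum

open InnerProductSpace Filter Topology

/-! ### Partial derivatives, Laplacians of radial functions, and the second derivative test. -/

section Calculus

variable {ι : Type*} [Fintype ι]

/-- The standard basis vectors of `ℝⁿ`. -/
noncomputable abbrev stdVec (i : ι) : EuclideanSpace ℝ ι := EuclideanSpace.basisFun ι ℝ i

theorem stdVec_apply [DecidableEq ι] (i j : ι) :
    stdVec i j = if j = i then (1 : ℝ) else 0 := by
  simp [stdVec]

theorem stdVec_self (i : ι) : stdVec i i = 1 := by
  classical simp

theorem norm_stdVec (i : ι) : ‖stdVec i‖ = 1 := (EuclideanSpace.basisFun ι ℝ).norm_eq_one i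

theorem inner_stdVec (x : EuclideanSpace ℝ ι) (i : ι) : inner ℝ x (stdVec i) = x i := by
  classical
  simp only [stdVec, EuclideanSpace.basisFun_apply]
  simpa using EuclideanSpace.inner_single_right (𝕜 := ℝ) i (1 : ℝ) x

theorem sum_smul_stdVec (x : EuclideanSpace ℝ ι) : ∑ i, x i • stdVec i = x := by
  have := (EuclideanSpace.basisFun ι ℝ).sum_repr x
  simpa using this

/-- The partial derivative in the direction of a coordinate. -/
noncomputable def partialD (i : ι) (f : EuclideanSpace ℝ ι → ℝ) (x : EuclideanSpace ℝ ι) : ℝ :=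
  fderiv ℝ f x (stdVec i)

theorem sum_mul_partialD (f : EuclideanSpace ℝ ι → ℝ) (x : EuclideanSpace ℝ ι) :
    ∑ i, x i * partialD i f x = fderiv ℝ f x x := by
  conv_rhs => rw [← sum_smul_stdVec x]
  rw [map_sum]
  simp [partialD, sum_smul_stdVec]

theorem partialD_congr {f g : EuclideanSpace ℝ ι → ℝ} {x : EuclideanSpace ℝ ι} (i : ι)
    (h : f =ᶠ[𝓝 x] g) : partialD i f x = partialD i g x := by
  rw [partialD, partialD, h.fderiv_eq]

theorem partialD_mul {f g : EuclideanSpace ℝ ι → ℝ} {x : EuclideanSpace ℝ ι} (i : ι)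
    (hf : DifferentiableAt ℝ f x) (hg : DifferentiableAt ℝ g x) :
    partialD i (fun y => f y * g y) x = f x * partialD i g x + g x * partialD i f x := by
  simp [partialD, fderiv_fun_mul hf hg]

theorem partialD_add {f g : EuclideanSpace ℝ ι → ℝ} {x : EuclideanSpace ℝ ι} (i : ι)
    (hf : DifferentiableAt ℝ f x) (hg : DifferentiableAt ℝ g x) :
    partialD i (fun y => f y + g y) x = partialD i f x + partialD i g x := by
  simp [partialD, fderiv_fun_add hf hg]

theorem differentiableAt_partialD {f : EuclideanSpace ℝ ι → ℝ} {x : EuclideanSpace ℝ ι} (i : ι)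
    (hf : ContDiffAt ℝ 2 f x) : DifferentiableAt ℝ (partialD i f) x := by
  have h : ContDiffAt ℝ 1 (fderiv ℝ f) x := hf.fderiv_right (by norm_num)
  exact (h.differentiableAt (by norm_num)).clm_apply (differentiableAt_const _)

theorem ContDiffAt.eventually_differentiableAt {f : EuclideanSpace ℝ ι → ℝ}
    {x : EuclideanSpace ℝ ι} (hf : ContDiffAt ℝ 2 f x) :
    ∀ᶠ y in 𝓝 x, DifferentiableAt ℝ f y :=
  (hf.eventually (by simp)).mono fun _ hy => hy.differentiableAt (by norm_num)

theorem laplacian_eq_sum_partialD {f : EuclideanSpace ℝ ι → ℝ} {x : EuclideanSpace ℝ ι}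
    (hf : ContDiffAt ℝ 2 f x) :
    Laplacian.laplacian f x = ∑ i, partialD i (partialD i f) x := by
  have h1 := congrFun (laplacian_eq_iteratedFDeriv_orthonormalBasis f
    (EuclideanSpace.basisFun ι ℝ)) x
  rw [h1]
  refine Finset.sum_congr rfl fun i _ => ?_
  rw [iteratedFDeriv_two_apply]
  have h : ContDiffAt ℝ 1 (fderiv ℝ f) x := hf.fderiv_right (by norm_num)
  have h2 := h.differentiableAt (by norm_num)
  have : partialD i f = fun y => fderiv ℝ f y (stdVec i) := rfl
  rw [this, partialD, fderiv_clm_apply h2 (differentiableAt_const _)]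
  simp

theorem laplacian_mul {f g : EuclideanSpace ℝ ι → ℝ} {x : EuclideanSpace ℝ ι}
    (hf : ContDiffAt ℝ 2 f x) (hg : ContDiffAt ℝ 2 g x) :
    Laplacian.laplacian (fun y => f y * g y) x = f x * Laplacian.laplacian g x +
      2 * ∑ i, partialD i f x * partialD i g x + g x * Laplacian.laplacian f x := by
  rw [laplacian_eq_sum_partialD (hf.mul hg), laplacian_eq_sum_partialD hf,
    laplacian_eq_sum_partialD hg, Finset.mul_sum, Finset.mul_sum, Finset.mul_sum,
    ← Finset.sum_add_distrib, ← Finset.sum_add_distrib]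
  refine Finset.sum_congr rfl fun i _ => ?_
  have hf1 := hf.differentiableAt (by norm_num)
  have hg1 := hg.differentiableAt (by norm_num)
  have hfp := differentiableAt_partialD i hf
  have hgp := differentiableAt_partialD i hg
  have h : partialD i (fun y => f y * g y) =ᶠ[𝓝 x]
      fun y => f y * partialD i g y + g y * partialD i f y := by
    filter_upwards [ContDiffAt.eventually_differentiableAt hf,
      ContDiffAt.eventually_differentiableAt hg] with y h1 h2
    exact partialD_mul i h1 h2
  rw [partialD_congr i h, partialD_add (f := fun y => f y * partialD i g y)
    (g := fun y => g y * partialD i f y) i (hf1.mul hgp) (hg1.mul hfp), partialD_mul i hf1 hgp,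
    partialD_mul i hg1 hfp]
  ring

theorem hasFDerivAt_normSq (x : EuclideanSpace ℝ ι) :
    HasFDerivAt (fun y : EuclideanSpace ℝ ι => ‖y‖ ^ 2) (2 • innerSL ℝ x) x :=
  (hasStrictFDerivAt_norm_sq x).hasFDerivAt

theorem partialD_radial {φ : ℝ → ℝ} {φ' : ℝ} {x : EuclideanSpace ℝ ι} (i : ι)
    (h : HasDerivAt φ φ' (‖x‖ ^ 2)) :
    partialD i (fun y => φ (‖y‖ ^ 2)) x = 2 * φ' * x i := by
  have h1 := (h.comp_hasFDerivAt x (hasFDerivAt_normSq x)).fderiv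
  have h2 : (φ ∘ fun y : EuclideanSpace ℝ ι => ‖y‖ ^ 2) = fun y => φ (‖y‖ ^ 2) := rfl
  rw [partialD, ← h2, h1]
  simp only [smul_apply, innerSL_apply_apply, inner_stdVec]
  simp; ring

theorem partialD_coord (i : ι) (x : EuclideanSpace ℝ ι) :
    partialD i (fun y => y i) x = 1 := by
  have h : (fun y : EuclideanSpace ℝ ι => y i) = EuclideanSpace.proj (𝕜 := ℝ) i := rfl
  rw [partialD, h, ContinuousLinearMap.fderiv]
  exact stdVec_self i

/-- Radial functions are written in terms of `|x|²`, whose gradient is simply `2x`; the logarithm,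
the powers of `r` and `|x|²` itself are all covered. -/
theorem laplacian_radial {φ φ₁ : ℝ → ℝ} {φ₂ : ℝ} {x : EuclideanSpace ℝ ι}
    (hφ : ContDiffAt ℝ 2 φ (‖x‖ ^ 2)) (h1 : ∀ᶠ t in 𝓝 (‖x‖ ^ 2), HasDerivAt φ (φ₁ t) t)
    (h2 : HasDerivAt φ₁ φ₂ (‖x‖ ^ 2)) :
    Laplacian.laplacian (fun y : EuclideanSpace ℝ ι => φ (‖y‖ ^ 2)) x =
      2 * Fintype.card ι * φ₁ (‖x‖ ^ 2) + 4 * ‖x‖ ^ 2 * φ₂ := by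
  have hc : ContDiffAt ℝ 2 (fun y : EuclideanSpace ℝ ι => φ (‖y‖ ^ 2)) x :=
    ContDiffAt.comp (g := φ) x hφ (contDiff_norm_sq ℝ).contDiffAt
  rw [laplacian_eq_sum_partialD hc]
  have hcont : Tendsto (fun y : EuclideanSpace ℝ ι => ‖y‖ ^ 2) (𝓝 x) (𝓝 (‖x‖ ^ 2)) :=
    ((continuous_norm.pow 2).tendsto x)
  have key : ∀ i, partialD i (partialD i (fun y => φ (‖y‖ ^ 2))) x =
      2 * φ₁ (‖x‖ ^ 2) + 4 * φ₂ * (x i) ^ 2 := by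
    intro i
    have h : partialD i (fun y => φ (‖y‖ ^ 2)) =ᶠ[𝓝 x]
        fun y => (fun y => (fun t => 2 * φ₁ t) (‖y‖ ^ 2)) y * (fun y => y i) y := by
      filter_upwards [hcont.eventually h1] with y hy
      rw [partialD_radial i hy]
    have h2' : HasDerivAt (fun t => 2 * φ₁ t) (2 * φ₂) (‖x‖ ^ 2) := h2.const_mul 2
    have hd : DifferentiableAt ℝ (fun y : EuclideanSpace ℝ ι => (fun t => 2 * φ₁ t) (‖y‖ ^ 2)) x :=
      (HasDerivAt.comp_hasFDerivAt (h₂ := fun t => 2 * φ₁ t) x h2'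
        (hasFDerivAt_normSq x)).differentiableAt
    have hd2 : DifferentiableAt ℝ (fun y : EuclideanSpace ℝ ι => y i) x :=
      (EuclideanSpace.proj (𝕜 := ℝ) i).differentiableAt
    rw [partialD_congr i h, partialD_mul i hd hd2, partialD_radial i h2', partialD_coord]
    ring
  simp_rw [key]
  rw [Finset.sum_add_distrib, ← Finset.mul_sum (a := 4 * φ₂), ← EuclideanSpace.real_norm_sq_eq]
  simp
  ring

theorem norm_rpow_eq (s : ℝ) (x : EuclideanSpace ℝ ι) : ‖x‖ ^ s = (‖x‖ ^ 2) ^ (s / 2) := by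
  rw [← Real.rpow_natCast, ← Real.rpow_mul (norm_nonneg x)]
  congr 1; push_cast; ring

theorem contDiffAt_norm_rpow (s : ℝ) {x : EuclideanSpace ℝ ι} (hx : x ≠ 0) :
    ContDiffAt ℝ 2 (fun y : EuclideanSpace ℝ ι => ‖y‖ ^ s) x :=
  (contDiffAt_norm ℝ hx).rpow_const_of_ne (norm_ne_zero_iff.2 hx)

theorem partialD_norm_rpow (s : ℝ) {x : EuclideanSpace ℝ ι} (hx : x ≠ 0) (i : ι) :
    partialD i (fun y => ‖y‖ ^ s) x = s * ‖x‖ ^ (s - 2) * x i := by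
  have hpos : 0 < ‖x‖ ^ 2 := by positivity
  have h := partialD_radial (x := x) i (Real.hasDerivAt_rpow_const (p := s / 2) (Or.inl hpos.ne'))
  simp_rw [norm_rpow_eq s]
  rw [h, norm_rpow_eq (s - 2), show (s - 2) / 2 = s / 2 - 1 by ring]
  ring

theorem laplacian_norm_rpow (s : ℝ) {x : EuclideanSpace ℝ ι} (hx : x ≠ 0) :
    Laplacian.laplacian (fun y : EuclideanSpace ℝ ι => ‖y‖ ^ s) x =
      s * (s + Fintype.card ι - 2) * ‖x‖ ^ (s - 2) := by
  have hpos : 0 < ‖x‖ ^ 2 := by positivity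
  have h := laplacian_radial (x := x) (φ := fun t => t ^ (s / 2))
    (φ₁ := fun t => s / 2 * t ^ (s / 2 - 1))
    (Real.contDiffAt_rpow_const_of_ne hpos.ne')
    (by filter_upwards [lt_mem_nhds hpos] with t ht
        exact Real.hasDerivAt_rpow_const (Or.inl ht.ne'))
    ((Real.hasDerivAt_rpow_const (p := s / 2 - 1) (Or.inl hpos.ne')).const_mul (s / 2))
  simp_rw [norm_rpow_eq s]
  have e : (‖x‖ ^ 2) ^ (s / 2 - 1) = ‖x‖ ^ 2 * (‖x‖ ^ 2) ^ (s / 2 - 1 - 1) := by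
    rw [Real.rpow_sub_one hpos.ne' (s / 2 - 1)]; field_simp
  rw [h, norm_rpow_eq (s - 2), show (s - 2) / 2 = s / 2 - 1 by ring, e]
  ring

/-- The Laplacian of `r^s f` for a function with radial derivative `d f`. -/
theorem laplacian_norm_rpow_mul (s d : ℝ) {f : EuclideanSpace ℝ ι → ℝ} {x : EuclideanSpace ℝ ι}
    (hx : x ≠ 0) (hf : ContDiffAt ℝ 2 f x) (hd : fderiv ℝ f x x = d * f x) :
    Laplacian.laplacian (fun y : EuclideanSpace ℝ ι => ‖y‖ ^ s * f y) x =
      ‖x‖ ^ s * Laplacian.laplacian f x +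
        (s * (s + Fintype.card ι - 2) + 2 * s * d) * ‖x‖ ^ (s - 2) * f x := by
  rw [laplacian_mul (contDiffAt_norm_rpow s hx) hf, laplacian_norm_rpow s hx]
  have : ∑ i, partialD i (fun y : EuclideanSpace ℝ ι => ‖y‖ ^ s) x * partialD i f x =
      s * ‖x‖ ^ (s - 2) * (d * f x) := by
    rw [← hd, ← sum_mul_partialD, Finset.mul_sum]
    refine Finset.sum_congr rfl fun i _ => ?_
    rw [partialD_norm_rpow s hx]; ring
  rw [this]; ring

/-- Euler's identity for positively homogeneous functions. -/
theorem fderiv_self_of_homogeneous {d : ℝ} {f : EuclideanSpace ℝ ι → ℝ}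
    {x : EuclideanSpace ℝ ι} (hf : DifferentiableAt ℝ f x)
    (hom : ∀ t : ℝ, 0 < t → f (t • x) = t ^ d * f x) : fderiv ℝ f x x = d * f x := by
  have h1 : HasDerivAt (fun t : ℝ => t • x) x 1 := by
    simpa using (hasDerivAt_id (1 : ℝ)).smul_const x
  have hf' : HasFDerivAt f (fderiv ℝ f x) ((1 : ℝ) • x) := by simpa using hf.hasFDerivAt
  have h2 : HasDerivAt (f ∘ fun t : ℝ => t • x) (fderiv ℝ f x x) 1 :=
    hf'.comp_hasDerivAt (1 : ℝ) h1
  have h3 : HasDerivAt (fun t : ℝ => t ^ d * f x) (d * f x) 1 := by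
    simpa using (Real.hasDerivAt_rpow_const (x := 1) (p := d) (Or.inl one_ne_zero)).mul_const (f x)
  refine h2.unique (h3.congr_of_eventuallyEq ?_)
  filter_upwards [lt_mem_nhds (zero_lt_one (α := ℝ))] with t ht
  exact hom t ht

theorem laplacian_comp_smul (c : ℝ) {f : EuclideanSpace ℝ ι → ℝ} {x : EuclideanSpace ℝ ι}
    (hf : ContDiffAt ℝ 2 f (c • x)) :
    Laplacian.laplacian (fun y => f (c • y)) x = c ^ 2 * Laplacian.laplacian f (c • x) := by
  have hc : ContDiffAt ℝ 2 (fun y : EuclideanSpace ℝ ι => f (c • y)) x :=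
    ContDiffAt.comp (g := f) x hf (contDiff_const_smul c).contDiffAt
  have hp : ∀ i (g : EuclideanSpace ℝ ι → ℝ) y,
      partialD i (fun z => g (c • z)) y = c * partialD i g (c • y) := by
    intro i g y
    have := fderiv_comp_smul (𝕜 := ℝ) (f := g) (x := y) c
    rw [partialD, partialD, this]
    simp
  rw [laplacian_eq_sum_partialD hc, laplacian_eq_sum_partialD hf, Finset.mul_sum]
  refine Finset.sum_congr rfl fun i _ => ?_
  have : partialD i (fun y => f (c • y)) = fun y => c * partialD i f (c • y) := by
    funext y; exact hp i f y
  rw [this, partialD_mul i (differentiableAt_const _), hp i (partialD i f)]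
  · have : partialD i (fun _ : EuclideanSpace ℝ ι => c) x = 0 := by simp [partialD]
    rw [this]; ring
  · exact (differentiableAt_partialD i hf).comp x ((differentiable_id.const_smul c) x)

theorem hasDerivAt_line {f : EuclideanSpace ℝ ι → ℝ} {x : EuclideanSpace ℝ ι} {i : ι} {t : ℝ}
    (hf : DifferentiableAt ℝ f (x + t • stdVec i)) :
    HasDerivAt (fun t : ℝ => f (x + t • stdVec i)) (partialD i f (x + t • stdVec i)) t := by
  have h1 : HasDerivAt (fun t : ℝ => x + t • stdVec i) (stdVec i) t := by
    simpa using ((hasDerivAt_id t).smul_const (stdVec i)).const_add x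
  exact hf.hasFDerivAt.comp_hasDerivAt t h1

theorem tendsto_line (x : EuclideanSpace ℝ ι) (i : ι) :
    Tendsto (fun t : ℝ => x + t • stdVec i) (𝓝 0) (𝓝 x) := by
  have : Continuous fun t : ℝ => x + t • stdVec i := by fun_prop
  simpa using this.tendsto 0

/-- The Laplacian is nonpositive at a local maximum. -/
theorem laplacian_nonpos_of_isLocalMax {f : EuclideanSpace ℝ ι → ℝ} {x : EuclideanSpace ℝ ι}
    (hf : ContDiffAt ℝ 2 f x) (hx : IsLocalMax f x) : Laplacian.laplacian f x ≤ 0 := by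
  rw [laplacian_eq_sum_partialD hf]
  refine Finset.sum_nonpos fun i _ => ?_
  by_contra! hpos
  have hl := tendsto_line x i
  set g : ℝ → ℝ := fun t => f (x + t • stdVec i) with hg
  have hmax : IsLocalMax g 0 := by
    have : ∀ᶠ t in 𝓝 (0 : ℝ), f (x + t • stdVec i) ≤ f x := hl.eventually hx
    filter_upwards [this] with t ht
    simpa [hg] using ht
  have hd1 : deriv g =ᶠ[𝓝 0] fun t => partialD i f (x + t • stdVec i) := by
    filter_upwards [hl.eventually (ContDiffAt.eventually_differentiableAt hf)] with t ht
    exact (hasDerivAt_line ht).deriv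
  have hd2 : deriv (deriv g) 0 = partialD i (partialD i f) x := by
    rw [hd1.deriv_eq]
    have : DifferentiableAt ℝ (partialD i f) (x + (0 : ℝ) • stdVec i) := by
      simpa using differentiableAt_partialD i hf
    simpa using (hasDerivAt_line this).deriv
  have hgc : ContinuousAt g 0 := by
    have : DifferentiableAt ℝ f (x + (0 : ℝ) • stdVec i) := by
      simpa using hf.differentiableAt (by norm_num)
    exact (hasDerivAt_line this).continuousAt
  -- A positive second derivative would make the maximum also a minimum; then `g` is locally
  -- constant and its second derivative is zero.
  have hmin := isLocalMin_of_deriv_deriv_pos (by rw [hd2]; exact hpos) hmax.deriv_eq_zero hgc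
  have hconst : g =ᶠ[𝓝 0] fun _ => g 0 := by
    filter_upwards [hmax, hmin] with t h1 h2
    exact le_antisymm h1 h2
  have hz : deriv g =ᶠ[𝓝 0] fun _ => (0 : ℝ) := by
    have := hconst.deriv
    simpa using this
  rw [← hd2, hz.deriv_eq] at hpos
  simp at hpos

end Calculus

end SphericalSpectrum

namespace SphericalSpectrum

open InnerProductSpace Filter Topology

/-! ### Maximum principle on a sector of the punctured ball. -/

section MaximumPrinciple

variable {ι : Type*} [Fintype ι]

/-- The closed cone on which the coordinates indexed by `S` are nonnegative. -/
def partialOrthant (S : Finset ι) : Set (EuclideanSpace ℝ ι) := {x | ∀ i ∈ S, 0 ≤ x i}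

theorem isClosed_partialOrthant (S : Finset ι) : IsClosed (partialOrthant S) := by
  have : partialOrthant S = ⋂ i ∈ S, {x : EuclideanSpace ℝ ι | 0 ≤ x i} := by
    ext x; simp [partialOrthant]
  rw [this]
  exact isClosed_biInter fun i _ => isClosed_le continuous_const (by fun_prop)

theorem add_smul_stdVec_mem {S : Finset ι} {x : EuclideanSpace ℝ ι} (hx : x ∈ partialOrthant S)
    (i : ι) {t : ℝ} (ht : 0 ≤ t) : x + t • stdVec i ∈ partialOrthant S := by
  classical
  intro j hj
  have := hx j hj
  simp only [PiLp.add_apply, PiLp.smul_apply, stdVec_apply, smul_eq_mul]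
  split_ifs <;> simp <;> linarith

theorem smul_mem_partialOrthant {S : Finset ι} {x : EuclideanSpace ℝ ι}
    (hx : x ∈ partialOrthant S) {t : ℝ} (ht : 0 ≤ t) : t • x ∈ partialOrthant S := fun i hi => by
  simpa using mul_nonneg ht (hx i hi)

theorem isOpen_pos_coords (S : Finset ι) : IsOpen {x : EuclideanSpace ℝ ι | ∀ i ∈ S, 0 < x i} := by
  have : {x : EuclideanSpace ℝ ι | ∀ i ∈ S, 0 < x i} =
      ⋂ i ∈ S, {x : EuclideanSpace ℝ ι | 0 < x i} := by
    ext x; simp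
  rw [this]
  exact isOpen_biInter_finset fun i _ => isOpen_lt continuous_const (by fun_prop)

theorem partialOrthant_mem_nhds {S : Finset ι} {x : EuclideanSpace ℝ ι} (hx : ∀ i ∈ S, 0 < x i) :
    partialOrthant S ∈ 𝓝 x :=
  mem_of_superset ((isOpen_pos_coords S).mem_nhds hx) fun _ hy i hi => (hy i hi).le

/-- The function used to perturb subharmonic functions in the maximum principle. -/
noncomputable def barrier (S : Finset ι) (x : EuclideanSpace ℝ ι) : ℝ :=
  Real.log (‖x‖ ^ 2) + ((∑ i ∈ S, x i) + ‖x‖ ^ 2)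

theorem contDiffAt_coordSum (S : Finset ι) (x : EuclideanSpace ℝ ι) :
    ContDiffAt ℝ 2 (fun y : EuclideanSpace ℝ ι => ∑ i ∈ S, y i) x := by
  fun_prop

theorem contDiffAt_barrier (S : Finset ι) {x : EuclideanSpace ℝ ι} (hx : x ≠ 0) :
    ContDiffAt ℝ 2 (barrier S) x := by
  have hpos : ‖x‖ ^ 2 ≠ 0 := by positivity
  exact ((contDiff_norm_sq ℝ).contDiffAt.log hpos).add
    ((contDiffAt_coordSum S x).add (contDiff_norm_sq ℝ).contDiffAt)

theorem partialD_coordSum [DecidableEq ι] (S : Finset ι) (i : ι) (x : EuclideanSpace ℝ ι) :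
    partialD i (fun y : EuclideanSpace ℝ ι => ∑ j ∈ S, y j) x = if i ∈ S then 1 else 0 := by
  have h : (fun y : EuclideanSpace ℝ ι => ∑ j ∈ S, y j) =
      (∑ j ∈ S, EuclideanSpace.proj (𝕜 := ℝ) j : EuclideanSpace ℝ ι →L[ℝ] ℝ) := by
    funext y; simp
  rw [partialD, h, ContinuousLinearMap.fderiv]
  simp [sum_apply]

theorem laplacian_coordSum (S : Finset ι) (x : EuclideanSpace ℝ ι) :
    Laplacian.laplacian (fun y : EuclideanSpace ℝ ι => ∑ j ∈ S, y j) x = 0 := by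
  classical
  rw [laplacian_eq_sum_partialD (contDiffAt_coordSum S x)]
  refine Finset.sum_eq_zero fun i _ => ?_
  have : partialD i (fun y : EuclideanSpace ℝ ι => ∑ j ∈ S, y j) =
      fun _ => if i ∈ S then 1 else 0 := funext fun y => partialD_coordSum S i y
  rw [this, partialD]
  simp

/-- The logarithm contributes `2(n-2)/|x|²`, nonnegative because `n ≥ 2`; the linear term
contributes nothing; `|x|²` contributes `2n` and makes the inequality strict. -/
theorem laplacian_barrier_pos (hn : 2 ≤ Fintype.card ι) (S : Finset ι) {x : EuclideanSpace ℝ ι}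
    (hx : x ≠ 0) : 0 < Laplacian.laplacian (barrier S) x := by
  have hpos : 0 < ‖x‖ ^ 2 := by positivity
  have hn' : (2 : ℝ) ≤ Fintype.card ι := by exact_mod_cast hn
  have h1 : ContDiffAt ℝ 2 (fun y : EuclideanSpace ℝ ι => Real.log (‖y‖ ^ 2)) x :=
    (contDiff_norm_sq ℝ).contDiffAt.log hpos.ne'
  have h2 := contDiffAt_coordSum S x
  have h3 : ContDiffAt ℝ 2 (fun y : EuclideanSpace ℝ ι => ‖y‖ ^ 2) x :=
    (contDiff_norm_sq ℝ).contDiffAt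
  have e : barrier S = (fun y : EuclideanSpace ℝ ι => Real.log (‖y‖ ^ 2)) +
      ((fun y : EuclideanSpace ℝ ι => ∑ j ∈ S, y j) + fun y => ‖y‖ ^ 2) := rfl
  have l1 := laplacian_radial (x := x) (φ := Real.log) (φ₁ := fun t => t⁻¹)
    (Real.contDiffAt_log.2 hpos.ne')
    (by filter_upwards [lt_mem_nhds hpos] with t ht using Real.hasDerivAt_log ht.ne')
    (hasDerivAt_inv hpos.ne')
  have l3 := laplacian_radial (x := x) (φ := fun t => t) (φ₁ := fun _ => 1) (φ₂ := 0)
    contDiffAt_id (Eventually.of_forall fun t => hasDerivAt_id t) (hasDerivAt_const _ _)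
  have h23 : ContDiffAt ℝ 2 ((fun y : EuclideanSpace ℝ ι => ∑ j ∈ S, y j) + fun y => ‖y‖ ^ 2) x :=
    h2.add h3
  rw [e, h1.laplacian_add h23, h2.laplacian_add h3, laplacian_coordSum, l1, l3]
  have : 2 * (Fintype.card ι : ℝ) * (‖x‖ ^ 2)⁻¹ + 4 * ‖x‖ ^ 2 * -((‖x‖ ^ 2) ^ 2)⁻¹ =
      2 * (Fintype.card ι - 2) * (‖x‖ ^ 2)⁻¹ := by
    field_simp; ring
  rw [this]
  have : 0 ≤ 2 * ((Fintype.card ι : ℝ) - 2) * (‖x‖ ^ 2)⁻¹ := by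
    have : 0 ≤ (Fintype.card ι : ℝ) - 2 := by linarith
    positivity
  linarith

/-- On a face the radial terms have no normal derivative, so only the linear term counts. Its
positive inward derivative is what rules out a maximum on a Neumann face. -/
theorem partialD_barrier {S : Finset ι} {i : ι} (hi : i ∈ S) {x : EuclideanSpace ℝ ι}
    (hx : x ≠ 0) (hxi : x i = 0) : partialD i (barrier S) x = 1 := by
  classical
  have hpos : 0 < ‖x‖ ^ 2 := by positivity
  have h1 : ContDiffAt ℝ 2 (fun y : EuclideanSpace ℝ ι => Real.log (‖y‖ ^ 2)) x :=
    (contDiff_norm_sq ℝ).contDiffAt.log hpos.ne'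
  have h2 := contDiffAt_coordSum S x
  have h3 : ContDiffAt ℝ 2 (fun y : EuclideanSpace ℝ ι => ‖y‖ ^ 2) x :=
    (contDiff_norm_sq ℝ).contDiffAt
  have e : barrier S = fun y => (fun y : EuclideanSpace ℝ ι => Real.log (‖y‖ ^ 2)) y +
      (fun y : EuclideanSpace ℝ ι => (∑ j ∈ S, y j) + ‖y‖ ^ 2) y := rfl
  have two : (2 : WithTop ℕ∞) ≠ 0 := by norm_num
  rw [e, partialD_add i (h1.differentiableAt two) ((h2.add h3).differentiableAt two),
    partialD_add (f := fun y : EuclideanSpace ℝ ι => ∑ j ∈ S, y j) i (h2.differentiableAt two)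
      (h3.differentiableAt two),
    partialD_coordSum, partialD_radial (φ := Real.log) i (Real.hasDerivAt_log hpos.ne'),
    partialD_radial (φ := fun t => t) i (hasDerivAt_id _), hxi, if_pos hi]
  simp

/-- A weak maximum principle for the punctured unit ball of a partial orthant, with either a
Dirichlet or a Neumann condition on the faces. -/
theorem le_of_subharmonic (hn : 2 ≤ Fintype.card ι) {S : Finset ι} {w : EuclideanSpace ℝ ι → ℝ}
    {M C : ℝ}
    (hcont : ∀ x ∈ partialOrthant S, x ≠ 0 → ContinuousWithinAt w (partialOrthant S) x)
    (hbdd : ∀ x ∈ partialOrthant S, x ≠ 0 → ‖x‖ ≤ 1 → w x ≤ C)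
    (hsphere : ∀ x ∈ partialOrthant S, ‖x‖ = 1 → w x ≤ M)
    (hint : ∀ x, x ≠ 0 → ‖x‖ < 1 → (∀ i ∈ S, 0 < x i) → M < w x →
      ContDiffAt ℝ 2 w x ∧ 0 ≤ Laplacian.laplacian w x)
    (hface : ∀ x ∈ partialOrthant S, x ≠ 0 → ‖x‖ < 1 → ∀ i ∈ S, x i = 0 → M < w x →
      HasDerivWithinAt (fun t : ℝ => w (x + t • stdVec i)) 0 (Set.Ici 0) 0) :
    ∀ x ∈ partialOrthant S, x ≠ 0 → ‖x‖ ≤ 1 → w x ≤ M := by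
  intro x₀ hx₀ hx₀0 hx₀1
  -- On the unit ball the coordinate sum is at most `S.card` and `|x|²` at most 1, so `barrier S -
  -- A` lies below `log |x|²`, hence below 0.
  set A : ℝ := S.card + 1 with hA
  have hA0 : 0 < A := by positivity
  have hg : ∀ x : EuclideanSpace ℝ ι, ‖x‖ ≤ 1 → barrier S x - A ≤ Real.log (‖x‖ ^ 2) := by
    intro x hx
    have h1 : ∑ i ∈ S, x i ≤ S.card := by
      have : ∑ i ∈ S, x i ≤ ∑ i ∈ S, (1 : ℝ) := Finset.sum_le_sum fun i _ =>
        (le_abs_self _).trans ((PiLp.norm_apply_le x i).trans hx)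
      simpa using this
    have h2 : ‖x‖ ^ 2 ≤ 1 := by nlinarith [norm_nonneg x]
    rw [barrier]; linarith
  have hlog : ∀ x : EuclideanSpace ℝ ι, ‖x‖ ≤ 1 → Real.log (‖x‖ ^ 2) ≤ 0 := fun x hx =>
    Real.log_nonpos (by positivity) (by nlinarith [norm_nonneg x])
  suffices H : ∀ δ > 0, w x₀ + δ * (barrier S x₀ - A) ≤ M by
    have hl : Tendsto (fun δ : ℝ => w x₀ + δ * (barrier S x₀ - A)) (𝓝[>] 0)
        (𝓝 (w x₀ + 0 * (barrier S x₀ - A))) := by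
      apply Tendsto.mono_left _ nhdsWithin_le_nhds
      exact (by fun_prop : Continuous fun δ : ℝ => w x₀ + δ * (barrier S x₀ - A)).tendsto 0
    have := le_of_tendsto hl (eventually_mem_nhdsWithin.mono fun δ hδ => H δ hδ)
    simpa using this
  intro δ hδ
  by_contra! hcon
  set W : EuclideanSpace ℝ ι → ℝ := fun x => w x + δ * (barrier S x - A) with hW
  -- near the origin the perturbed function is small
  obtain ⟨r, hr0, hr⟩ : ∃ r > 0, ∀ x ∈ partialOrthant S, x ≠ 0 → ‖x‖ ≤ 1 → ‖x‖ ≤ r →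
      W x ≤ M := by
    -- The radius solves `2δ log r = M - C`: there the logarithm absorbs the gap between the crude
    -- bound `C` and `M`. This is why boundedness near the origin suffices.
    refine ⟨Real.exp ((M - C) / (2 * δ)), Real.exp_pos _, fun x hx hx0 hx1 hxr => ?_⟩
    have h1 := hbdd x hx hx0 hx1
    have h2 := hg x hx1
    have h3 : Real.log ‖x‖ ≤ (M - C) / (2 * δ) := by
      rw [Real.log_le_iff_le_exp (norm_pos_iff.2 hx0)]; exact hxr
    have h4 : δ * (barrier S x - A) ≤ δ * (2 * ((M - C) / (2 * δ))) := by
      apply mul_le_mul_of_nonneg_left _ hδ.le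
      rw [Real.log_pow] at h2
      push_cast at h2
      linarith
    have h5 : δ * (2 * ((M - C) / (2 * δ))) = M - C := by field_simp
    simp only [hW]; linarith
  set K : Set (EuclideanSpace ℝ ι) := partialOrthant S ∩ {x | r ≤ ‖x‖} ∩ Metric.closedBall 0 1
    with hK
  have hKc : IsCompact K := (isCompact_closedBall _ _).inter_left
    ((isClosed_partialOrthant S).inter (isClosed_le continuous_const continuous_norm))
  have hx₀K : x₀ ∈ K := by
    refine ⟨⟨hx₀, ?_⟩, by simpa using hx₀1⟩
    by_contra! h
    exact absurd (hr x₀ hx₀ hx₀0 hx₀1 (not_le.1 h).le) (not_le.2 hcon)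
  have hne : ∀ x ∈ K, x ≠ 0 := by
    rintro x ⟨⟨-, h⟩, -⟩ rfl
    simp at h; linarith
  have hWc : ContinuousOn W K := by
    intro x hx
    have h1 := (hcont x hx.1.1 (hne x hx)).mono (show K ⊆ partialOrthant S from fun y hy => hy.1.1)
    have h2 := (contDiffAt_barrier S (hne x hx)).continuousAt.continuousWithinAt (s := K)
    exact h1.add (continuousWithinAt_const.mul (h2.sub continuousWithinAt_const))
  obtain ⟨x, hxK, hmax⟩ := hKc.exists_isMaxOn ⟨x₀, hx₀K⟩ hWc
  have hWx : M < W x := hcon.trans_le (hmax hx₀K)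
  have hx0 := hne x hxK
  have hxQ := hxK.1.1
  have hx1 : ‖x‖ ≤ 1 := by simpa using hxK.2
  -- The perturbation is nonpositive, so `w` itself exceeds `M` at the maximum point, and the
  -- hypotheses restricted to `M < w x` become available.
  have hwx : M < w x := by
    have h1 := hg x hx1
    have h2 := hlog x hx1
    have : δ * (barrier S x - A) ≤ 0 := mul_nonpos_of_nonneg_of_nonpos hδ.le (h1.trans h2)
    simp only [hW] at hWx; linarith
  have hx1' : ‖x‖ < 1 := by
    refine lt_of_le_of_ne hx1 fun h => ?_
    exact absurd (hsphere x hxQ h) (not_le.2 hwx)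
  have hxr : r < ‖x‖ := by
    by_contra! h
    exact absurd (hr x hxQ hx0 hx1 h) (not_le.2 hWx)
  have hnorm : ∀ᶠ y in 𝓝 x, r ≤ ‖y‖ ∧ ‖y‖ ≤ 1 := by
    filter_upwards [continuous_norm.continuousAt.eventually (lt_mem_nhds hxr),
      continuous_norm.continuousAt.eventually (gt_mem_nhds hx1')] with y h1 h2
    exact ⟨h1.le, h2.le⟩
  by_cases hin : ∀ i ∈ S, 0 < x i
  · obtain ⟨hw2, hwl⟩ := hint x hx0 hx1' hin hwx
    have hloc : IsLocalMax W x := by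
      filter_upwards [partialOrthant_mem_nhds hin, hnorm] with y h1 h2
      exact hmax ⟨⟨h1, h2.1⟩, by simpa using h2.2⟩
    have hb := contDiffAt_barrier S hx0
    have hb1 : ContDiffAt ℝ 2 (barrier S - fun _ => A) x := hb.sub contDiffAt_const
    have hb2 : ContDiffAt ℝ 2 (δ • (barrier S - fun _ => A)) x := contDiffAt_const.smul hb1
    have e : W = w + δ • (barrier S - fun _ => A) := rfl
    have h := laplacian_nonpos_of_isLocalMax (f := W) (by rw [e]; exact hw2.add hb2) hloc
    rw [e, hw2.laplacian_add hb2, laplacian_smul δ hb1,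
      hb.laplacian_sub contDiffAt_const] at h
    have hpos := laplacian_barrier_pos hn S hx0
    have hc : Laplacian.laplacian (fun _ : EuclideanSpace ℝ ι => A) x = 0 := by
      simp
    rw [hc, sub_zero, smul_eq_mul] at h
    have := mul_pos hδ hpos
    linarith
  · push Not at hin
    obtain ⟨i, hi, hxi'⟩ := hin
    have hxi : x i = 0 := le_antisymm hxi' (hxQ i hi)
    have hd := hface x hxQ hx0 hx1' i hi hxi hwx
    have hb := (contDiffAt_barrier S hx0).differentiableAt (by norm_num)
    have hb' : HasDerivAt (fun t : ℝ => barrier S (x + t • stdVec i)) 1 0 := by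
      have : DifferentiableAt ℝ (barrier S) (x + (0 : ℝ) • stdVec i) := by simpa using hb
      have h := hasDerivAt_line this
      rw [zero_smul, add_zero, partialD_barrier hi hx0 hxi] at h
      exact h
    -- The inward derivative of `W` is `δ > 0`, impossible at a maximum.
    have hWd : HasDerivWithinAt (fun t : ℝ => W (x + t • stdVec i)) (0 + δ * 1) (Set.Ici 0) 0 :=
      hd.add ((hb'.sub_const A).const_mul δ).hasDerivWithinAt
    have hmax' : IsLocalMaxOn (fun t : ℝ => W (x + t • stdVec i)) (Set.Ici 0) 0 := by
      have hl := (tendsto_line x i).eventually hnorm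
      filter_upwards [nhdsWithin_le_nhds hl, self_mem_nhdsWithin] with t ht ht0
      have := hmax (show x + t • stdVec i ∈ K from
        ⟨⟨add_smul_stdVec_mem hxQ i ht0, ht.1⟩, by simpa using ht.2⟩)
      simpa using this
    have := hmax'.hasFDerivWithinAt_nonpos hWd.hasFDerivWithinAt
      (y := 1) (mem_posTangentConeAt_of_segment_subset (by
        rw [segment_eq_Icc (by norm_num)]
        simpa using Set.Icc_subset_Ici_self))
    simp at this
    linarith

end MaximumPrinciple

end SphericalSpectrum

namespace SphericalSpectrum

open InnerProductSpace Filter Topology MvPolynomial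

/-! ### Harmonic polynomials with prescribed parity: the Dirichlet problem and dimensions. -/

section Polynomials

variable {ι : Type*} [Fintype ι]

/-- The polynomial function on Euclidean space. -/
noncomputable def polyEval (p : MvPolynomial ι ℝ) (x : EuclideanSpace ℝ ι) : ℝ :=
  MvPolynomial.eval x.ofLp p

theorem contDiff_polyEval (p : MvPolynomial ι ℝ) : ContDiff ℝ 2 (polyEval p) := by
  induction p using MvPolynomial.induction_on with
  | C a =>
    have : polyEval (C a : MvPolynomial ι ℝ) = fun _ => a := by funext x; simp [polyEval]
    rw [this]; exact contDiff_const
  | add p q hp hq =>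
    have : polyEval (p + q) = fun x => polyEval p x + polyEval q x := by
      funext x; simp [polyEval]
    rw [this]; exact hp.add hq
  | mul_X p i hp =>
    have : polyEval (p * X i) = fun x => polyEval p x * x i := by
      funext x; simp [polyEval]
    rw [this]; exact hp.mul (by fun_prop)

theorem differentiable_polyEval (p : MvPolynomial ι ℝ) : Differentiable ℝ (polyEval p) :=
  (contDiff_polyEval p).differentiable (by norm_num)

theorem continuous_polyEval (p : MvPolynomial ι ℝ) : Continuous (polyEval p) :=
  (contDiff_polyEval p).continuous

theorem partialD_polyEval (i : ι) (p : MvPolynomial ι ℝ) :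
    partialD i (polyEval p) = polyEval (pderiv i p) := by
  classical
  funext x
  induction p using MvPolynomial.induction_on with
  | C a =>
    have : polyEval (C a : MvPolynomial ι ℝ) = fun _ => a := by funext x; simp [polyEval]
    rw [partialD, this]; simp [polyEval]
  | add p q hp hq =>
    have : polyEval (p + q) = fun x => polyEval p x + polyEval q x := by
      funext x; simp [polyEval]
    rw [this, partialD_add i (differentiable_polyEval p x) (differentiable_polyEval q x), hp, hq]
    simp [polyEval]
  | mul_X p j hp =>
    have : polyEval (p * X j) = fun x => polyEval p x * (fun y : EuclideanSpace ℝ ι => y j) x := by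
      funext x; simp [polyEval]
    have hj : (fun y : EuclideanSpace ℝ ι => y j) = EuclideanSpace.proj (𝕜 := ℝ) j := rfl
    have hd : DifferentiableAt ℝ (fun y : EuclideanSpace ℝ ι => y j) x := by fun_prop
    have hv : partialD i (fun y : EuclideanSpace ℝ ι => y j) x = if j = i then 1 else 0 := by
      rw [partialD, hj, ContinuousLinearMap.fderiv]; exact stdVec_apply i j
    rw [this, partialD_mul i (differentiable_polyEval p x) hd, hp, hv]
    simp only [polyEval, pderiv_mul, pderiv_X, map_add, map_mul, eval_X, Pi.single_apply]
    split_ifs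
    · simp [mul_comm]
      ring
    · simp [mul_comm]

/-- The Laplacian on polynomials in variables indexed by `ι`. -/
noncomputable def laplacianPoly : MvPolynomial ι ℝ →ₗ[ℝ] MvPolynomial ι ℝ :=
  ∑ i, (MvPolynomial.pderiv (R := ℝ) i).toLinearMap ∘ₗ (MvPolynomial.pderiv i).toLinearMap

theorem laplacianPoly_apply (p : MvPolynomial ι ℝ) :
    laplacianPoly p = ∑ i, pderiv i (pderiv i p) := by
  simp [laplacianPoly]

theorem laplacian_polyEval (p : MvPolynomial ι ℝ) (x : EuclideanSpace ℝ ι) :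
    Laplacian.laplacian (polyEval p) x = polyEval (laplacianPoly p) x := by
  rw [laplacian_eq_sum_partialD (contDiff_polyEval p).contDiffAt]
  simp [partialD_polyEval, laplacianPoly_apply, polyEval]

/-- `∑ xᵢ²` as a polynomial. -/
noncomputable def normSqPoly (ι : Type*) [Fintype ι] : MvPolynomial ι ℝ := ∑ i, X i ^ 2

theorem polyEval_normSqPoly (x : EuclideanSpace ℝ ι) : polyEval (normSqPoly ι) x = ‖x‖ ^ 2 := by
  rw [EuclideanSpace.real_norm_sq_eq]; simp [polyEval, normSqPoly]

theorem coeff_laplacianPoly (p : MvPolynomial ι ℝ) (m : ι →₀ ℕ) :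
    coeff m (laplacianPoly p) =
      ∑ i, coeff (m + Finsupp.single i 2) p * ((m i + 2) * (m i + 1)) := by
  rw [laplacianPoly_apply, coeff_sum]
  refine Finset.sum_congr rfl fun i _ => ?_
  rw [coeff_pderiv, coeff_pderiv, add_assoc, ← Finsupp.single_add]
  simp
  ring

/-- The coefficient of the Laplacian at `m` involves only the exponents `m + 2eᵢ`. Bookkeeping by
supports treats parity and degree together. -/
theorem laplacianPoly_mem {A B : Set (ι →₀ ℕ)}
    (h : ∀ i m, m + Finsupp.single i 2 ∈ A → m ∈ B) {p : MvPolynomial ι ℝ}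
    (hp : p ∈ restrictSupport ℝ A) : laplacianPoly p ∈ restrictSupport ℝ B := by
  rw [mem_restrictSupport_iff] at hp ⊢
  intro m hm
  rw [Finset.mem_coe, mem_support_iff, coeff_laplacianPoly] at hm
  obtain ⟨i, -, hi⟩ := Finset.exists_ne_zero_of_sum_ne_zero hm
  exact h i m (hp (by simpa [mem_support_iff] using left_ne_zero_of_mul hi))

theorem normSqPoly_mul_mem {A B : Set (ι →₀ ℕ)}
    (h : ∀ i, ∀ m ∈ A, m + Finsupp.single i 2 ∈ B) {p : MvPolynomial ι ℝ}
    (hp : p ∈ restrictSupport ℝ A) : normSqPoly ι * p ∈ restrictSupport ℝ B := by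
  rw [normSqPoly, Finset.sum_mul]
  refine Submodule.sum_mem _ fun i _ => ?_
  rw [mem_restrictSupport_iff] at hp ⊢
  intro m hm
  rw [Finset.mem_coe, X_pow_eq_monomial, mem_support_iff, mul_comm, coeff_mul_monomial'] at hm
  split_ifs at hm with hle
  · have := h i _ (hp (show m - Finsupp.single i 2 ∈ _ by
      simpa [mem_support_iff] using left_ne_zero_of_mul hm))
    rwa [tsub_add_cancel_of_le hle] at this
  · exact absurd rfl hm

theorem finite_restrictSupport {A : Set (ι →₀ ℕ)} (hA : A.Finite) :
    Module.Finite ℝ (restrictSupport ℝ A) :=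
  haveI := hA.to_subtype
  Module.Finite.of_basis (basisRestrictSupport ℝ A)

theorem finrank_restrictSupport (A : Set (ι →₀ ℕ)) :
    Module.finrank ℝ (restrictSupport ℝ A) = Nat.card A :=
  Module.finrank_eq_nat_card_basis (basisRestrictSupport ℝ A)

/-- The parity of the exponents of the coordinates on the faces. -/
def BoundaryCondition.bit : BoundaryCondition → ℕ
  | .dirichlet => 1
  | .neumann => 0

theorem BoundaryCondition.bit_lt (b : BoundaryCondition) : b.bit < 2 := by
  cases b <;> simp [BoundaryCondition.bit]

/-- The exponents which are odd (Dirichlet) or even (Neumann) in the variables indexed by `S`. -/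
def parityExponents (b : BoundaryCondition) (S : Finset ι) : Set (ι →₀ ℕ) :=
  {m | ∀ i ∈ S, m i % 2 = b.bit}

theorem add_single_two_mem_parityExponents (b : BoundaryCondition) (S : Finset ι) (i : ι)
    (m : ι →₀ ℕ) :
    m + Finsupp.single i 2 ∈ parityExponents b S ↔ m ∈ parityExponents b S := by
  classical
  have : ∀ j, (m + Finsupp.single i 2 : ι →₀ ℕ) j % 2 = m j % 2 := by
    intro j
    simp only [Finsupp.add_apply, Finsupp.single_apply]
    split_ifs <;> simp
  simp only [parityExponents, Set.mem_ofPred_eq, this]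

theorem degree_add_single_two (m : ι →₀ ℕ) (i : ι) :
    (m + Finsupp.single i 2).degree = m.degree + 2 := by
  rw [map_add, Finsupp.degree_single]

/-- Parity exponents of total degree at most `N`. -/
def parityExponentsLE (b : BoundaryCondition) (S : Finset ι) (N : ℕ) : Set (ι →₀ ℕ) :=
  {m | m ∈ parityExponents b S ∧ m.degree ≤ N}

/-- Parity exponents of total degree `k`. -/
def parityExponentsEq (b : BoundaryCondition) (S : Finset ι) (k : ℕ) : Set (ι →₀ ℕ) :=
  {m | m ∈ parityExponents b S ∧ m.degree = k}

theorem finite_parityExponentsLE (b : BoundaryCondition) (S : Finset ι) (N : ℕ) :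
    (parityExponentsLE b S N).Finite :=
  (Finsupp.finite_of_degree_le N).subset fun _ hm => hm.2

theorem finite_parityExponentsEq (b : BoundaryCondition) (S : Finset ι) (k : ℕ) :
    (parityExponentsEq b S k).Finite :=
  (Finsupp.finite_of_degree_eq k).subset fun _ hm => hm.2

theorem eq_zero_of_polyEval_eq_zero (hn : 2 ≤ Fintype.card ι) {p : MvPolynomial ι ℝ}
    (h : ∀ x : EuclideanSpace ℝ ι, x ≠ 0 → ‖x‖ < 1 → (∀ i, 0 < x i) → polyEval p x = 0) :
    p = 0 := by
  have hc : (0 : ℝ) < 1 / (Fintype.card ι + 1) := by positivity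
  -- A box with sides `1/(n+1)` lies in the open unit ball, since `n/(n+1) < 1`; a polynomial
  -- vanishing on a product of infinite sets is zero.
  refine MvPolynomial.funext_set (fun _ : ι => Set.Ioo (0 : ℝ) (1 / (Fintype.card ι + 1)))
    (fun _ => Set.Ioo_infinite hc) fun y hy => ?_
  have hy' : ∀ i, 0 < y i ∧ y i < 1 / (Fintype.card ι + 1) := fun i => hy i (Set.mem_univ i)
  have h1 : ‖(WithLp.toLp 2 y : EuclideanSpace ℝ ι)‖ < 1 := by
    calc ‖(WithLp.toLp 2 y : EuclideanSpace ℝ ι)‖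
        = ‖∑ i, y i • (stdVec i : EuclideanSpace ℝ ι)‖ := by
          rw [← sum_smul_stdVec (WithLp.toLp 2 y)]
      _ ≤ ∑ i, ‖y i • (stdVec i : EuclideanSpace ℝ ι)‖ := norm_sum_le _ _
      _ ≤ ∑ _i : ι, 1 / ((Fintype.card ι : ℝ) + 1) := by
          refine Finset.sum_le_sum fun i _ => ?_
          rw [norm_smul, norm_stdVec, mul_one, Real.norm_of_nonneg (hy' i).1.le]
          exact (hy' i).2.le
      _ < 1 := by
          rw [Finset.sum_const, Finset.card_univ, nsmul_eq_mul, mul_one_div,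
            div_lt_one (by positivity)]
          linarith
  have h0 : (WithLp.toLp 2 y : EuclideanSpace ℝ ι) ≠ 0 := by
    intro h
    have : Nonempty ι := Fintype.card_pos_iff.1 (by omega)
    have i : ι := Classical.arbitrary ι
    have h2 := congrArg (fun z : EuclideanSpace ℝ ι => z i) h
    simp at h2
    exact (hy' i).1.ne' h2
  have := h _ h0 h1 fun i => (hy' i).1
  simpa [polyEval] using this

/-- The case `S = ∅` of `le_of_subharmonic`, where the face condition is void. -/
theorem polyEval_le_of_harmonic (hn : 2 ≤ Fintype.card ι) {p : MvPolynomial ι ℝ}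
    (hp : laplacianPoly p = 0) {M : ℝ}
    (hM : ∀ x : EuclideanSpace ℝ ι, ‖x‖ = 1 → polyEval p x ≤ M) :
    ∀ x : EuclideanSpace ℝ ι, x ≠ 0 → ‖x‖ ≤ 1 → polyEval p x ≤ M := by
  obtain ⟨C, hC⟩ := (isCompact_closedBall (0 : EuclideanSpace ℝ ι) 1).exists_bound_of_continuousOn
    (continuous_polyEval p).continuousOn
  have := le_of_subharmonic hn (S := ∅) (w := polyEval p) (M := M) (C := C)
    (fun x _ _ => (continuous_polyEval p).continuousWithinAt)
    (fun x _ _ hx => (le_abs_self _).trans (hC x (by simpa using hx)))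
    (fun x _ => hM x)
    (fun x _ _ _ _ => ⟨(contDiff_polyEval p).contDiffAt, by simp [laplacian_polyEval, hp, polyEval]⟩)
    (by simp)
  intro x
  exact this x (by simp [partialOrthant])

/-- The product is harmonic and vanishes on the unit sphere, so it vanishes in the ball, where `1 -
|x|²` can be divided out. -/
theorem eq_zero_of_harmonic_mul (hn : 2 ≤ Fintype.card ι) {q : MvPolynomial ι ℝ}
    (hq : laplacianPoly ((1 - normSqPoly ι) * q) = 0) : q = 0 := by
  have hev : ∀ x : EuclideanSpace ℝ ι,
      polyEval ((1 - normSqPoly ι) * q) x = (1 - ‖x‖ ^ 2) * polyEval q x := by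
    intro x
    rw [← polyEval_normSqPoly]
    simp [polyEval]
  refine eq_zero_of_polyEval_eq_zero hn fun x hx0 hx1 _ => ?_
  have h1 := polyEval_le_of_harmonic hn hq (M := 0)
    (fun y hy => by rw [hev, hy]; simp) x hx0 hx1.le
  have h2 := polyEval_le_of_harmonic hn (p := -((1 - normSqPoly ι) * q)) (by rw [map_neg, hq, neg_zero])
    (M := 0) (fun y hy => by
      have : polyEval (-((1 - normSqPoly ι) * q)) y = -polyEval ((1 - normSqPoly ι) * q) y := by
        simp [polyEval]
      rw [this, hev, hy]; simp) x hx0 hx1.le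
  have h3 : polyEval (-((1 - normSqPoly ι) * q)) x = -polyEval ((1 - normSqPoly ι) * q) x := by
    simp [polyEval]
  rw [h3] at h2
  have h4 : (1 - ‖x‖ ^ 2) * polyEval q x = 0 := by rw [← hev]; linarith
  have h5 : 1 - ‖x‖ ^ 2 ≠ 0 := by nlinarith [norm_nonneg x]
  exact (mul_eq_zero.1 h4).resolve_left h5

/-- Multiplication by `1 - |x|²` raises the degree bound by 2, the Laplacian lowers it by 2, and
both preserve parity: the map is an endomorphism. -/
theorem laplacianPoly_normSq_mul_mem {b : BoundaryCondition} {S : Finset ι} {N : ℕ}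
    {q : MvPolynomial ι ℝ} (hq : q ∈ restrictSupport ℝ (parityExponentsLE b S N)) :
    laplacianPoly ((1 - normSqPoly ι) * q) ∈ restrictSupport ℝ (parityExponentsLE b S N) := by
  have h1 : (1 - normSqPoly ι) * q ∈ restrictSupport ℝ (parityExponentsLE b S (N + 2)) := by
    rw [sub_mul, one_mul]
    refine Submodule.sub_mem _ (restrictSupport_mono ℝ ?_ hq) (normSqPoly_mul_mem ?_ hq)
    · exact fun m hm => ⟨hm.1, hm.2.trans (by omega)⟩
    · intro i m hm
      exact ⟨(add_single_two_mem_parityExponents b S i m).2 hm.1, by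
        rw [degree_add_single_two]; have := hm.2; omega⟩
  refine laplacianPoly_mem ?_ h1
  intro i m hm
  refine ⟨(add_single_two_mem_parityExponents b S i m).1 hm.1, ?_⟩
  have := hm.2
  rw [degree_add_single_two] at this
  omega

/-- `q ↦ ∇²((1 - |x|²) q)` is onto on polynomials of given parity and bounded degree. -/
theorem exists_laplacianPoly_normSq_mul (hn : 2 ≤ Fintype.card ι) {b : BoundaryCondition}
    {S : Finset ι} {N : ℕ} {g : MvPolynomial ι ℝ}
    (hg : g ∈ restrictSupport ℝ (parityExponentsLE b S N)) :
    ∃ q ∈ restrictSupport ℝ (parityExponentsLE b S N),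
      laplacianPoly ((1 - normSqPoly ι) * q) = g := by
  have := finite_restrictSupport (finite_parityExponentsLE b S N)
  let T₀ : MvPolynomial ι ℝ →ₗ[ℝ] MvPolynomial ι ℝ :=
    laplacianPoly ∘ₗ LinearMap.mulLeft ℝ (1 - normSqPoly ι)
  let T : restrictSupport ℝ (parityExponentsLE b S N) →ₗ[ℝ]
      restrictSupport ℝ (parityExponentsLE b S N) :=
    T₀.restrict fun q hq => laplacianPoly_normSq_mul_mem hq
  have hinj : Function.Injective T := by
    rw [← LinearMap.ker_eq_bot, LinearMap.ker_eq_bot']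
    intro q hq
    have : laplacianPoly ((1 - normSqPoly ι) * (q : MvPolynomial ι ℝ)) = 0 :=
      congrArg Subtype.val hq
    exact Subtype.ext (eq_zero_of_harmonic_mul hn this)
  obtain ⟨q, hq⟩ := (LinearMap.injective_iff_surjective.1 hinj) ⟨g, hg⟩
  exact ⟨q, q.2, congrArg Subtype.val hq⟩

theorem mem_parityExponentsLE_totalDegree {b : BoundaryCondition} {S : Finset ι}
    {p : MvPolynomial ι ℝ} (hp : p ∈ restrictSupport ℝ (parityExponents b S)) :
    p ∈ restrictSupport ℝ (parityExponentsLE b S p.totalDegree) := by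
  rw [mem_restrictSupport_iff] at hp ⊢
  intro m hm
  exact ⟨hp hm, by
    have := le_totalDegree (Finset.mem_coe.1 hm)
    rwa [Finsupp.sum_fintype _ _ (by simp), ← Finsupp.degree_eq_sum] at this⟩

/-- The Dirichlet problem on the unit ball with polynomial boundary values. -/
theorem exists_harmonic_eq_on_sphere (hn : 2 ≤ Fintype.card ι) {b : BoundaryCondition}
    {S : Finset ι} {p : MvPolynomial ι ℝ} (hp : p ∈ restrictSupport ℝ (parityExponents b S)) :
    ∃ H ∈ restrictSupport ℝ (parityExponents b S), laplacianPoly H = 0 ∧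
      ∀ x : EuclideanSpace ℝ ι, ‖x‖ = 1 → polyEval H x = polyEval p x := by
  have hp' := mem_parityExponentsLE_totalDegree hp
  have hl : laplacianPoly p ∈ restrictSupport ℝ (parityExponentsLE b S p.totalDegree) := by
    refine laplacianPoly_mem ?_ hp'
    intro i m hm
    refine ⟨(add_single_two_mem_parityExponents b S i m).1 hm.1, ?_⟩
    have := hm.2
    rw [degree_add_single_two] at this
    omega
  -- Subtracting `(1 - |x|²) q` cancels the Laplacian of `p` and changes nothing on the sphere.
  obtain ⟨q, hq, hqe⟩ := exists_laplacianPoly_normSq_mul hn hl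
  have hqp : q ∈ restrictSupport ℝ (parityExponents b S) :=
    restrictSupport_mono ℝ (fun m hm => hm.1) hq
  refine ⟨p - (1 - normSqPoly ι) * q, ?_, by rw [map_sub, hqe, sub_self], fun x hx => ?_⟩
  · refine Submodule.sub_mem _ hp ?_
    rw [sub_mul, one_mul]
    exact Submodule.sub_mem _ hqp (normSqPoly_mul_mem
      (fun i m hm => (add_single_two_mem_parityExponents b S i m).2 hm) hqp)
  · have : polyEval (p - (1 - normSqPoly ι) * q) x =
        polyEval p x - (1 - polyEval (normSqPoly ι) x) * polyEval q x := by
      simp [polyEval]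
    rw [this, polyEval_normSqPoly, hx]; simp

theorem laplacianPoly_homogeneousComponent (p : MvPolynomial ι ℝ) (k : ℕ) :
    laplacianPoly (homogeneousComponent (k + 2) p) = homogeneousComponent k (laplacianPoly p) := by
  ext m
  rw [coeff_laplacianPoly, coeff_homogeneousComponent, coeff_laplacianPoly]
  simp only [coeff_homogeneousComponent, degree_add_single_two, add_left_inj]
  split_ifs <;> simp

theorem laplacianPoly_eq_zero_of_degree_lt {p : MvPolynomial ι ℝ}
    (hp : p ∈ restrictSupport ℝ {m : ι →₀ ℕ | m.degree < 2}) : laplacianPoly p = 0 := by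
  have h := laplacianPoly_mem (B := ∅) (fun i m hm => by
    have : (m + Finsupp.single i 2).degree < 2 := hm
    rw [degree_add_single_two] at this
    omega) hp
  rw [mem_restrictSupport_iff, Set.subset_empty_iff, Finset.coe_eq_empty] at h
  exact MvPolynomial.support_eq_empty.1 h

theorem homogeneousComponent_mem_restrictSupport {A : Set (ι →₀ ℕ)} {p : MvPolynomial ι ℝ}
    (hp : p ∈ restrictSupport ℝ A) (k : ℕ) :
    homogeneousComponent k p ∈ restrictSupport ℝ {m | m ∈ A ∧ m.degree = k} := by
  rw [mem_restrictSupport_iff] at hp ⊢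
  intro m hm
  rw [Finset.mem_coe, support_homogeneousComponent, Finset.mem_filter] at hm
  exact ⟨hp hm.1, hm.2⟩

theorem laplacianPoly_homogeneousComponent_eq_zero {p : MvPolynomial ι ℝ}
    (hp : laplacianPoly p = 0) (k : ℕ) : laplacianPoly (homogeneousComponent k p) = 0 := by
  rcases lt_or_ge k 2 with hk | hk
  · refine laplacianPoly_eq_zero_of_degree_lt (restrictSupport_mono ℝ ?_
      (homogeneousComponent_mem_restrictSupport (A := Set.univ) (p := p) (by simp) k))
    rintro m ⟨-, hm⟩
    exact hm.trans_lt hk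
  · obtain ⟨j, rfl⟩ := Nat.exists_eq_add_of_le' hk
    rw [laplacianPoly_homogeneousComponent, hp, map_zero]

/-- Harmonic homogeneous polynomials of degree `k` with the parity given by `b` in the variables
indexed by `S`. -/
noncomputable def harmonicParity (b : BoundaryCondition) (S : Finset ι) (k : ℕ) :
    Submodule ℝ (MvPolynomial ι ℝ) :=
  restrictSupport ℝ (parityExponentsEq b S k) ⊓ LinearMap.ker laplacianPoly

instance finite_harmonicParity (b : BoundaryCondition) (S : Finset ι) (k : ℕ) :
    Module.Finite ℝ (harmonicParity b S k) :=
  have := finite_restrictSupport (finite_parityExponentsEq b S k)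
  Submodule.finiteDimensional_of_le inf_le_left

theorem finrank_harmonicParity_of_lt (b : BoundaryCondition) (S : Finset ι) {k : ℕ} (hk : k < 2) :
    Module.finrank ℝ (harmonicParity b S k) = Nat.card (parityExponentsEq b S k) := by
  have : harmonicParity b S k = restrictSupport ℝ (parityExponentsEq b S k) := by
    refine inf_eq_left.2 fun p hp => ?_
    exact laplacianPoly_eq_zero_of_degree_lt
      (restrictSupport_mono ℝ (fun m hm => hm.2.trans_lt hk) hp)
  rw [this, finrank_restrictSupport]

/-- Rank–nullity for the Laplacian from degree `k + 2` to degree `k`. It is onto: if `∇²((1-|x|²)q)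
= g` with `g` of degree `k`, the component of degree `k + 2` of `(1-|x|²)q` is a preimage of `g`. -/
theorem finrank_harmonicParity_add (hn : 2 ≤ Fintype.card ι) (b : BoundaryCondition)
    (S : Finset ι) (k : ℕ) :
    Module.finrank ℝ (harmonicParity b S (k + 2)) + Nat.card (parityExponentsEq b S k) =
      Nat.card (parityExponentsEq b S (k + 2)) := by
  have := finite_restrictSupport (finite_parityExponentsEq b S (k + 2))
  have hmaps : ∀ p ∈ restrictSupport ℝ (parityExponentsEq b S (k + 2)),
      laplacianPoly p ∈ restrictSupport ℝ (parityExponentsEq b S k) := by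
    intro p hp
    refine laplacianPoly_mem ?_ hp
    intro i m hm
    refine ⟨(add_single_two_mem_parityExponents b S i m).1 hm.1, ?_⟩
    have := hm.2
    rw [degree_add_single_two] at this
    omega
  let L : restrictSupport ℝ (parityExponentsEq b S (k + 2)) →ₗ[ℝ]
      restrictSupport ℝ (parityExponentsEq b S k) := laplacianPoly.restrict hmaps
  have hsurj : Function.Surjective L := by
    rintro ⟨g, hg⟩
    obtain ⟨q, hq, hqe⟩ := exists_laplacianPoly_normSq_mul hn (b := b) (S := S) (N := k)
      (restrictSupport_mono ℝ (show parityExponentsEq b S k ⊆ parityExponentsLE b S k from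
        fun m hm => ⟨hm.1, hm.2.le⟩) hg)
    have hq' : (1 - normSqPoly ι) * q ∈ restrictSupport ℝ (parityExponents b S) := by
      have hqp : q ∈ restrictSupport ℝ (parityExponents b S) :=
        restrictSupport_mono ℝ (fun m hm => hm.1) hq
      rw [sub_mul, one_mul]
      exact Submodule.sub_mem _ hqp (normSqPoly_mul_mem
        (fun i m hm => (add_single_two_mem_parityExponents b S i m).2 hm) hqp)
    refine ⟨⟨homogeneousComponent (k + 2) ((1 - normSqPoly ι) * q),
      homogeneousComponent_mem_restrictSupport hq' (k + 2)⟩, Subtype.ext ?_⟩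
    change laplacianPoly (homogeneousComponent (k + 2) ((1 - normSqPoly ι) * q)) = g
    rw [laplacianPoly_homogeneousComponent, hqe]
    refine homogeneousComponent_eq_self ?_
    rw [← mem_homogeneousSubmodule, homogeneousSubmodule_eq_finsupp_supported]
    exact restrictSupport_mono ℝ (fun m hm => hm.2) hg
  have hker : Module.finrank ℝ (LinearMap.ker L) =
      Module.finrank ℝ (harmonicParity b S (k + 2)) := by
    have e : harmonicParity b S (k + 2) = (LinearMap.ker L).map (Submodule.subtype _) := by
      ext p
      simp only [harmonicParity, Submodule.mem_inf, LinearMap.mem_ker, Submodule.mem_map,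
        Submodule.subtype_apply, Subtype.exists, exists_and_right, exists_eq_right]
      constructor
      · rintro ⟨h1, h2⟩
        exact ⟨h1, Subtype.ext h2⟩
      · rintro ⟨h1, h2⟩
        exact ⟨h1, congrArg Subtype.val h2⟩
    rw [e]
    exact ((LinearMap.ker L).equivMapOfInjective _ (Submodule.subtype_injective _)).finrank_eq
  have := LinearMap.finrank_range_add_finrank_ker L
  rw [LinearMap.range_eq_top.2 hsurj, finrank_top, finrank_restrictSupport,
    finrank_restrictSupport, hker] at this
  omega

end Polynomials

end SphericalSpectrum

namespace SphericalSpectrum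

open InnerProductSpace Filter Topology MvPolynomial

/-! ### Boundary behaviour and reflection of polynomials with prescribed parity. -/

section Parity

variable {ι : Type*} [Fintype ι]

theorem polyEval_eq_zero_of_coord {p : MvPolynomial ι ℝ} {i : ι}
    (hp : ∀ m ∈ p.support, m i ≠ 0) {x : EuclideanSpace ℝ ι} (hx : x i = 0) :
    polyEval p x = 0 := by
  rw [polyEval, eval_eq']
  refine Finset.sum_eq_zero fun m hm => ?_
  rw [Finset.prod_eq_zero (Finset.mem_univ i) (by rw [hx, zero_pow (hp m hm)]), mul_zero]

theorem polyEval_eq_zero_of_dirichlet {S : Finset ι} {p : MvPolynomial ι ℝ}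
    (hp : p ∈ restrictSupport ℝ (parityExponents .dirichlet S)) {i : ι} (hi : i ∈ S)
    {x : EuclideanSpace ℝ ι} (hx : x i = 0) : polyEval p x = 0 := by
  refine polyEval_eq_zero_of_coord (fun m hm => ?_) hx
  have : m i % 2 = 1 := ((mem_restrictSupport_iff ℝ).1 hp) hm i hi
  omega

theorem partialD_polyEval_eq_zero_of_neumann {S : Finset ι} {p : MvPolynomial ι ℝ}
    (hp : p ∈ restrictSupport ℝ (parityExponents .neumann S)) {i : ι} (hi : i ∈ S)
    {x : EuclideanSpace ℝ ι} (hx : x i = 0) : partialD i (polyEval p) x = 0 := by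
  rw [partialD_polyEval]
  refine polyEval_eq_zero_of_coord (fun m hm => ?_) hx
  rw [mem_support_iff, coeff_pderiv] at hm
  have : (m + Finsupp.single i 1 : ι →₀ ℕ) i % 2 = 0 :=
    ((mem_restrictSupport_iff ℝ).1 hp) (mem_support_iff.2 (left_ne_zero_of_mul hm)) i hi
  simp at this
  omega

theorem polyEval_smul_of_degree {k : ℕ} {p : MvPolynomial ι ℝ}
    (hp : p ∈ restrictSupport ℝ {m : ι →₀ ℕ | m.degree = k}) (t : ℝ) (x : EuclideanSpace ℝ ι) :
    polyEval p (t • x) = t ^ k * polyEval p x := by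
  rw [polyEval, polyEval, eval_eq', eval_eq', Finset.mul_sum]
  refine Finset.sum_congr rfl fun m hm => ?_
  have hk : ∑ i, m i = k := by
    rw [← Finsupp.degree_eq_sum]; exact ((mem_restrictSupport_iff ℝ).1 hp) hm
  have : ∏ i, (t • x) i ^ m i = t ^ k * ∏ i, x i ^ m i := by
    rw [← hk, ← Finset.prod_pow_eq_pow_sum, ← Finset.prod_mul_distrib]
    exact Finset.prod_congr rfl fun i _ => by simp [mul_pow]
  rw [this]; ring

open Classical in
/-- The reflection of a point into the partial orthant. -/
noncomputable def foldPt (S : Finset ι) (x : EuclideanSpace ℝ ι) : EuclideanSpace ℝ ι :=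
  WithLp.toLp 2 fun i => if i ∈ S then |x i| else x i

theorem foldPt_mem (S : Finset ι) (x : EuclideanSpace ℝ ι) : foldPt S x ∈ partialOrthant S :=
  fun i hi => by simp [foldPt, hi]

theorem norm_foldPt (S : Finset ι) (x : EuclideanSpace ℝ ι) : ‖foldPt S x‖ = ‖x‖ := by
  rw [EuclideanSpace.norm_eq, EuclideanSpace.norm_eq]
  congr 1
  refine Finset.sum_congr rfl fun i _ => ?_
  simp only [foldPt]
  split_ifs <;> simp

/-- Up to a common sign, polynomials of given parity are invariant under reflection. -/
theorem exists_sign_polyEval_foldPt (b : BoundaryCondition) (S : Finset ι)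
    (x : EuclideanSpace ℝ ι) : ∃ σ : ℝ, |σ| = 1 ∧ ∀ p ∈ restrictSupport ℝ (parityExponents b S),
      ∀ t : ℝ, polyEval p (t • foldPt S x) = σ * polyEval p (t • x) := by
  classical
  set ε : ι → ℝ := fun i => if i ∈ S ∧ x i < 0 then -1 else 1 with hε
  have hε2 : ∀ i, ε i = 1 ∨ ε i = -1 := by
    intro i; simp only [hε]; split_ifs <;> simp
  have hfold : ∀ i, foldPt S x i = ε i * x i := by
    intro i
    simp only [foldPt, hε]
    by_cases hi : i ∈ S
    · by_cases hx : x i < 0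
      · simp [hi, hx, abs_of_neg]
      · simp [hi, hx, abs_of_nonneg (not_lt.1 hx)]
    · simp [hi]
  -- In the Dirichlet case each reflected coordinate contributes a factor `-1`; in the Neumann case
  -- the sign is 1. It depends on `x` only, not on the polynomial or on `t`.
  refine ⟨∏ i, ε i ^ b.bit, ?_, fun p hp t => ?_⟩
  · rw [Finset.abs_prod]
    refine Finset.prod_eq_one fun i _ => ?_
    rw [abs_pow]
    rcases hε2 i with h | h <;> simp [h]
  · rw [polyEval, polyEval, eval_eq', eval_eq', Finset.mul_sum]
    refine Finset.sum_congr rfl fun m hm => ?_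
    have : ∏ i, (t • foldPt S x) i ^ m i = (∏ i, ε i ^ b.bit) * ∏ i, (t • x) i ^ m i := by
      rw [← Finset.prod_mul_distrib]
      refine Finset.prod_congr rfl fun i _ => ?_
      have h1 : ε i ^ m i = ε i ^ b.bit := by
        by_cases hi : i ∈ S
        · have h2 : m i % 2 = b.bit := ((mem_restrictSupport_iff ℝ).1 hp) hm i hi
          rw [← h2]
          rcases hε2 i with h | h
          · simp [h]
          · rw [h]; exact neg_one_pow_eq_pow_mod_two (m i)
        · simp [hε, hi]
      simp only [PiLp.smul_apply, smul_eq_mul, hfold]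
      rw [← h1, ← mul_pow]
      congr 1; ring
    rw [this]; ring

end Parity

/-! ### Uniform approximation by polynomials with prescribed parity. -/

section Approximation

variable {ι : Type*} [Fintype ι]

/-- The spherical domain on which the coordinates indexed by `S` are nonnegative. -/
def partialSimplex (S : Finset ι) : Set (EuclideanSpace ℝ ι) := {x | ‖x‖ = 1 ∧ ∀ i ∈ S, 0 ≤ x i}

theorem isCompact_partialSimplex (S : Finset ι) : IsCompact (partialSimplex S) := by
  have : partialSimplex S = Metric.sphere 0 1 ∩ partialOrthant S := by
    ext x; simp [partialSimplex, partialOrthant]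
  rw [this]
  exact (isCompact_sphere _ _).inter_right (isClosed_partialOrthant S)

instance compactSpace_partialSimplex (S : Finset ι) : CompactSpace (partialSimplex S) :=
  isCompact_iff_compactSpace.1 (isCompact_partialSimplex S)

/-- Polynomials which are even in the variables indexed by `S`. -/
noncomputable def evenSubalgebra (S : Finset ι) : Subalgebra ℝ (MvPolynomial ι ℝ) :=
  (restrictSupport ℝ (parityExponents .neumann S)).toSubalgebra
    (by
      rw [mem_restrictSupport_iff]
      intro m hm
      classical
      have : m = 0 := by
        by_contra h
        rw [Finset.mem_coe, mem_support_iff, coeff_one, if_neg (Ne.symm h)] at hm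
        exact hm rfl
      rw [this]
      intro i _
      rfl)
    (by
      classical
      intro p q hp hq
      rw [mem_restrictSupport_iff] at hp hq ⊢
      intro m hm
      obtain ⟨a, ha, c, hc, rfl⟩ := Finset.mem_add.1 (support_mul p q hm)
      intro i hi
      have h1 : a i % 2 = 0 := hp ha i hi
      have h2 : c i % 2 = 0 := hq hc i hi
      change (a i + c i) % 2 = 0
      omega)

/-- Polynomials as continuous functions on the spherical domain. -/
noncomputable def polyOn (S : Finset ι) : MvPolynomial ι ℝ →ₐ[ℝ] C(partialSimplex S, ℝ) :=
  MvPolynomial.aeval fun i => ⟨fun ω => (ω : EuclideanSpace ℝ ι) i, by fun_prop⟩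

theorem polyOn_apply (S : Finset ι) (p : MvPolynomial ι ℝ) (ω : partialSimplex S) :
    polyOn S p ω = polyEval p ω := by
  induction p using MvPolynomial.induction_on with
  | C a => simp [polyOn, polyEval]
  | add p q hp hq => simp [hp, hq, polyEval]
  | mul_X p i hp =>
    rw [map_mul, ContinuousMap.mul_apply, hp]
    simp [polyOn, polyEval]

/-- Stone–Weierstrass. The even polynomials still separate points, because the coordinates in `S`
are nonnegative on the domain and so are determined by their squares. -/
theorem exists_even_near (S : Finset ι) {h : partialSimplex S → ℝ} (hc : Continuous h) {ε : ℝ}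
    (hε : 0 < ε) : ∃ p ∈ restrictSupport ℝ (parityExponents .neumann S),
      ∀ ω : partialSimplex S, |h ω - polyEval p ω| < ε := by
  have hsep : ((evenSubalgebra S).map (polyOn S)).SeparatesPoints := by
    classical
    intro ω ω' hne
    obtain ⟨i, hi⟩ : ∃ i, (ω : EuclideanSpace ℝ ι) i ≠ (ω' : EuclideanSpace ℝ ι) i := by
      by_contra! hcon
      exact hne (Subtype.ext (PiLp.ext hcon))
    by_cases hS : i ∈ S
    · refine ⟨_, ⟨_, ⟨X i ^ 2, ?_, rfl⟩, rfl⟩, ?_⟩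
      · change X i ^ 2 ∈ restrictSupport ℝ _
        rw [X_pow_eq_monomial, monomial_mem_restrictSupport]
        left
        intro j _
        simp only [Finsupp.single_apply]
        split_ifs <;> rfl
      · change polyOn S (X i ^ 2) ω ≠ polyOn S (X i ^ 2) ω'
        rw [polyOn_apply, polyOn_apply]
        simp only [polyEval, map_pow, eval_X]
        intro h
        exact hi ((pow_left_inj₀ (ω.2.2 i hS) (ω'.2.2 i hS) (by norm_num)).1 h)
    · refine ⟨_, ⟨_, ⟨X i, ?_, rfl⟩, rfl⟩, ?_⟩
      · change X i ∈ restrictSupport ℝ _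
        rw [← pow_one (X i), X_pow_eq_monomial, monomial_mem_restrictSupport]
        left
        intro j hj
        have : i ≠ j := fun h => hS (h ▸ hj)
        simp [this, BoundaryCondition.bit]
      · change polyOn S (X i) ω ≠ polyOn S (X i) ω'
        rw [polyOn_apply, polyOn_apply]
        simpa [polyEval] using hi
  obtain ⟨⟨g, p, hp, rfl⟩, hg⟩ :=
    ContinuousMap.exists_mem_subalgebra_near_continuous_of_separatesPoints _ hsep h hc ε hε
  refine ⟨p, hp, fun ω => ?_⟩
  have := hg ω
  rw [abs_sub_comm, ← polyOn_apply]
  simpa using this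

open Classical in
/-- The exponent of the product of the coordinates indexed by `S`. -/
noncomputable def faceExponent (S : Finset ι) : ι →₀ ℕ :=
  Finsupp.equivFunOnFinite.symm fun i => if i ∈ S then 1 else 0

theorem polyEval_faceExponent (S : Finset ι) (x : EuclideanSpace ℝ ι) :
    polyEval (monomial (faceExponent S) 1) x = ∏ i ∈ S, x i := by
  classical
  rw [polyEval, eval_monomial, Finsupp.prod_fintype _ _ (by simp), one_mul]
  simp [faceExponent, Finset.prod_ite_mem, pow_ite]

theorem faceExponent_mul_mem {S : Finset ι} {q : MvPolynomial ι ℝ}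
    (hq : q ∈ restrictSupport ℝ (parityExponents .neumann S)) :
    monomial (faceExponent S) 1 * q ∈ restrictSupport ℝ (parityExponents .dirichlet S) := by
  classical
  rw [mem_restrictSupport_iff] at hq ⊢
  intro m hm
  obtain ⟨a, ha, c, hc, rfl⟩ := Finset.mem_add.1 (support_mul _ q hm)
  have ha' : a = faceExponent S := Finset.mem_singleton.1 (support_monomial_subset ha)
  intro i hi
  have h2 : c i % 2 = 0 := hq hc i hi
  change (a i + c i) % 2 = 1
  rw [ha']
  simp only [faceExponent, Finsupp.equivFunOnFinite_symm_apply_apply, hi, if_true]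
  omega

/-- A continuous function vanishing where `e ≥ 0` vanishes is nearly a multiple of `e`. -/
theorem exists_near_mul {X : Type*} [TopologicalSpace X] [CompactSpace X] {h e : X → ℝ}
    (hh : Continuous h) (he : Continuous e) (he0 : ∀ x, 0 ≤ e x) (hz : ∀ x, e x = 0 → h x = 0)
    {ε : ℝ} (hε : 0 < ε) : ∃ g : X → ℝ, Continuous g ∧ ∀ x, |h x - e x * g x| < ε := by
  obtain ⟨C, hC⟩ := isCompact_univ.exists_bound_of_continuousOn hh.continuousOn
  have hK : IsCompact {x | ε ≤ |h x|} := (isClosed_le continuous_const hh.abs).isCompact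
  obtain ⟨η, hη, hKη⟩ : ∃ η > 0, ∀ x, ε ≤ |h x| → η ≤ e x := by
    rcases Set.eq_empty_or_nonempty {x | ε ≤ |h x|} with hemp | hne
    · refine ⟨1, one_pos, fun x hx => ?_⟩
      have : x ∈ {x | ε ≤ |h x|} := hx
      rw [hemp] at this
      exact this.elim
    · obtain ⟨x₀, hx₀, hmin⟩ := hK.exists_isMinOn hne he.continuousOn
      refine ⟨e x₀, lt_of_le_of_ne (he0 x₀) fun h0 => ?_, fun x hx => hmin hx⟩
      have : h x₀ = 0 := hz x₀ h0.symm
      have h2 : ε ≤ |h x₀| := hx₀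
      rw [this, abs_zero] at h2
      linarith
  -- With `g = h/(e+δ)` the error is `h·δ/(e+δ)`. It is below `ε` where `|h| < ε`; elsewhere `e ≥
  -- η`, and this `δ` makes it at most `ε/2`.
  set δ : ℝ := η * ε / (2 * (|C| + 1)) with hδ
  have hδ0 : 0 < δ := by positivity
  have hpos : ∀ x, 0 < e x + δ := fun x => by linarith [he0 x]
  refine ⟨fun x => h x / (e x + δ), hh.div (he.add continuous_const) fun x => (hpos x).ne',
    fun x => ?_⟩
  have e1 : h x - e x * (h x / (e x + δ)) = h x * (δ / (e x + δ)) := by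
    have := (hpos x).ne'
    field_simp
    ring
  rw [e1, abs_mul, abs_of_nonneg (div_nonneg hδ0.le (hpos x).le)]
  rcases lt_or_ge (|h x|) ε with hlt | hge
  · have : δ / (e x + δ) ≤ 1 := by
      rw [div_le_one (hpos x)]; linarith [he0 x]
    calc |h x| * (δ / (e x + δ)) ≤ |h x| * 1 := mul_le_mul_of_nonneg_left this (abs_nonneg _)
      _ < ε := by rwa [mul_one]
  · have h1 : |h x| ≤ |C| + 1 := by
      have := hC x (Set.mem_univ x)
      rw [Real.norm_eq_abs] at this
      linarith [le_abs_self C]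
    have h2 : δ / (e x + δ) ≤ δ / η := by
      apply div_le_div_of_nonneg_left hδ0.le hη
      linarith [hKη x hge]
    calc |h x| * (δ / (e x + δ)) ≤ (|C| + 1) * (δ / η) :=
          mul_le_mul h1 h2 (div_nonneg hδ0.le (hpos x).le) (by positivity)
      _ = ε / 2 := by rw [hδ]; field_simp
      _ < ε := by linarith

/-- Polynomials of the parity given by the boundary condition are dense. -/
theorem exists_parity_near (b : BoundaryCondition) (S : Finset ι) {h : partialSimplex S → ℝ}
    (hc : Continuous h)
    (hb : b = .dirichlet → ∀ ω : partialSimplex S, ∀ i ∈ S,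
      (ω : EuclideanSpace ℝ ι) i = 0 → h ω = 0) {ε : ℝ} (hε : 0 < ε) :
    ∃ p ∈ restrictSupport ℝ (parityExponents b S),
      ∀ ω : partialSimplex S, |h ω - polyEval p ω| < ε := by
  cases b with
  | neumann => exact exists_even_near S hc hε
  | dirichlet =>
    -- The product of the coordinates in `S` vanishes exactly on the faces and turns even
    -- polynomials into odd ones, so it is enough to approximate a quotient by even polynomials.
    set e : partialSimplex S → ℝ := fun ω => polyEval (monomial (faceExponent S) 1) ω with he
    have hec : Continuous e := (continuous_polyEval _).comp continuous_subtype_val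
    have he0 : ∀ ω, 0 ≤ e ω := fun ω => by
      simp only [he, polyEval_faceExponent]
      exact Finset.prod_nonneg fun i hi => ω.2.2 i hi
    have he1 : ∀ ω, e ω ≤ 1 := fun ω => by
      simp only [he, polyEval_faceExponent]
      refine Finset.prod_le_one (fun i hi => ω.2.2 i hi) fun i _ => ?_
      exact (le_abs_self _).trans ((PiLp.norm_apply_le _ i).trans ω.2.1.le)
    obtain ⟨g, hg, hhg⟩ := exists_near_mul hc hec he0 (fun ω h0 => by
      simp only [he, polyEval_faceExponent] at h0
      obtain ⟨i, hi, hi0⟩ := Finset.prod_eq_zero_iff.1 h0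
      exact hb rfl ω i hi hi0) (half_pos hε)
    obtain ⟨q, hq, hgq⟩ := exists_even_near S hg (half_pos hε)
    refine ⟨_, faceExponent_mul_mem hq, fun ω => ?_⟩
    have h1 : polyEval (monomial (faceExponent S) 1 * q) ω = e ω * polyEval q ω := by
      simp [he, polyEval]
    have h2 : h ω - e ω * polyEval q ω =
        (h ω - e ω * g ω) + e ω * (g ω - polyEval q ω) := by ring
    rw [h1, h2]
    calc |(h ω - e ω * g ω) + e ω * (g ω - polyEval q ω)|
        ≤ |h ω - e ω * g ω| + |e ω * (g ω - polyEval q ω)| := abs_add_le _ _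
      _ ≤ |h ω - e ω * g ω| + 1 * |g ω - polyEval q ω| := by
          rw [abs_mul, abs_of_nonneg (he0 ω)]
          gcongr
          exact he1 ω
      _ < ε := by linarith [hhg ω, hgq ω]

end Approximation

end SphericalSpectrum

namespace SphericalSpectrum

open InnerProductSpace Filter Topology MvPolynomial MeasureTheory

/-! ### Orthogonality of harmonic polynomials on the ball. -/

section Orthogonality

variable {ι : Type*} [Fintype ι]

/-- Squaring removes the corner at 0. The squared weight is therefore differentiable everywhere with
compact support, and integration by parts over the whole space has no boundary term. -/
theorem hasDerivAt_max_zero_sq (t : ℝ) :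
    HasDerivAt (fun t : ℝ => (max 0 t) ^ 2) (2 * max 0 t) t := by
  rcases lt_trichotomy t 0 with h | rfl | h
  · rw [max_eq_left h.le, mul_zero]
    refine (hasDerivAt_const t (0 : ℝ)).congr_of_eventuallyEq ?_
    filter_upwards [gt_mem_nhds h] with s hs
    rw [max_eq_left hs.le]; norm_num
  · rw [max_self, mul_zero]
    rw [hasDerivAt_iff_isLittleO_nhds_zero]
    have h1 : (fun h : ℝ => h ^ 2) =o[𝓝 0] fun h => h := by
      simpa using Asymptotics.isLittleO_pow_id (𝕜 := ℝ) (n := 2) (by norm_num)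
    refine (Asymptotics.IsBigO.of_bound 1 (Eventually.of_forall fun h => ?_)).trans_isLittleO h1
    rcases le_total 0 h with hh | hh <;> simp [hh, sq_nonneg]
  · rw [max_eq_right h.le]
    refine HasDerivAt.congr_of_eventuallyEq (f := fun s : ℝ => s ^ 2) ?_ ?_
    · simpa using hasDerivAt_pow 2 t
    · filter_upwards [lt_mem_nhds h] with s hs
      rw [max_eq_right hs.le]

/-- The weight `(1 - |x|²)₊`. -/
noncomputable def ballWeight (x : EuclideanSpace ℝ ι) : ℝ := max 0 (1 - ‖x‖ ^ 2)

theorem continuous_ballWeight : Continuous (ballWeight (ι := ι)) := by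
  unfold ballWeight; fun_prop

theorem ballWeight_nonneg (x : EuclideanSpace ℝ ι) : 0 ≤ ballWeight x := le_max_left _ _

theorem ballWeight_eq_zero {x : EuclideanSpace ℝ ι} (hx : 1 ≤ ‖x‖) : ballWeight x = 0 :=
  max_eq_left (by nlinarith)

theorem hasCompactSupport_ballWeight : HasCompactSupport (ballWeight (ι := ι)) :=
  HasCompactSupport.intro (isCompact_closedBall 0 1) fun _ hx =>
    ballWeight_eq_zero (by simpa using (not_le.1 (fun h => hx (by simpa using h))).le)

theorem integrable_mul_ballWeight {f : EuclideanSpace ℝ ι → ℝ} (hf : Continuous f) :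
    Integrable (fun x => f x * ballWeight x) :=
  (hf.mul continuous_ballWeight).integrable_of_hasCompactSupport
    hasCompactSupport_ballWeight.mul_left

theorem hasFDerivAt_ballWeight_sq (x : EuclideanSpace ℝ ι) :
    DifferentiableAt ℝ (fun y : EuclideanSpace ℝ ι => ballWeight y ^ 2) x ∧
      ∀ i, partialD i (fun y => ballWeight y ^ 2) x = -4 * ballWeight x * x i := by
  have h1 : HasDerivAt (fun t : ℝ => (max 0 (1 - t)) ^ 2) (-(2 * max 0 (1 - ‖x‖ ^ 2)))
      (‖x‖ ^ 2) := by
    have := (hasDerivAt_max_zero_sq (1 - ‖x‖ ^ 2)).comp (‖x‖ ^ 2)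
      ((hasDerivAt_id (‖x‖ ^ 2)).const_sub 1)
    simpa [Function.comp_def] using this
  refine ⟨(HasDerivAt.comp_hasFDerivAt (h₂ := fun t : ℝ => (max 0 (1 - t)) ^ 2) x h1
    (hasFDerivAt_normSq x)).differentiableAt, fun i => ?_⟩
  have := partialD_radial i h1
  simp only [ballWeight]
  rw [this]; ring

/-- Integration by parts against the square of the weight. -/
theorem integral_partialD_ballWeight_sq (i : ι) (p : MvPolynomial ι ℝ) :
    ∫ x : EuclideanSpace ℝ ι, (ballWeight x ^ 2 * polyEval (pderiv i p) x +
      -4 * ballWeight x * x i * polyEval p x) = 0 := by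
  have hc1 : HasCompactSupport fun x : EuclideanSpace ℝ ι => ballWeight x ^ 2 :=
    hasCompactSupport_ballWeight.comp_left (g := fun t : ℝ => t ^ 2) (by norm_num)
  have e1 : (fun x => fderiv ℝ (polyEval p) x (stdVec i)) = polyEval (pderiv i p) :=
    partialD_polyEval i p
  have e2 : (fun x => fderiv ℝ (fun y : EuclideanSpace ℝ ι => ballWeight y ^ 2) x (stdVec i)) =
      fun x => -4 * ballWeight x * x i := funext fun x => (hasFDerivAt_ballWeight_sq x).2 i
  have i1 : Integrable fun x : EuclideanSpace ℝ ι => ballWeight x ^ 2 * polyEval (pderiv i p) x :=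
    ((continuous_ballWeight.pow 2).mul (continuous_polyEval _)).integrable_of_hasCompactSupport
      hc1.mul_right
  have i2 : Integrable fun x : EuclideanSpace ℝ ι => -4 * ballWeight x * x i * polyEval p x := by
    have := integrable_mul_ballWeight (f := fun x : EuclideanSpace ℝ ι =>
      -4 * x i * polyEval p x) (by have := continuous_polyEval p; fun_prop)
    refine this.congr (Eventually.of_forall fun x => ?_)
    simp only; ring
  have i3 : Integrable fun x : EuclideanSpace ℝ ι => ballWeight x ^ 2 * polyEval p x :=
    ((continuous_ballWeight.pow 2).mul (continuous_polyEval _)).integrable_of_hasCompactSupport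
      hc1.mul_right
  have := integral_mul_fderiv_eq_neg_fderiv_mul_of_integrable (μ := volume)
    (f := fun x : EuclideanSpace ℝ ι => ballWeight x ^ 2) (g := polyEval p) (v := stdVec i)
    (by simp_rw [congrFun e2]; exact i2) (by simp_rw [congrFun e1]; exact i1) i3
    (fun x _ => (hasFDerivAt_ballWeight_sq x).1) (fun x _ => differentiable_polyEval p x)
  simp_rw [congrFun e1, congrFun e2] at this
  rw [integral_add i1 i2, this]
  ring

theorem sum_mul_polyEval_pderiv {k : ℕ} {p : MvPolynomial ι ℝ} (hp : p.IsHomogeneous k)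
    (x : EuclideanSpace ℝ ι) : ∑ i, x i * polyEval (pderiv i p) x = k * polyEval p x := by
  have := congrArg (fun q => polyEval q x) hp.sum_X_mul_pderiv
  simpa [polyEval] using this

/-- Harmonic homogeneous polynomials of different degrees are orthogonal. -/
theorem integral_mul_eq_zero_of_degree_ne {k l : ℕ} (hkl : k ≠ l) {p q : MvPolynomial ι ℝ}
    (hp : p.IsHomogeneous k) (hq : q.IsHomogeneous l) (hp0 : laplacianPoly p = 0)
    (hq0 : laplacianPoly q = 0) :
    ∫ x : EuclideanSpace ℝ ι, polyEval p x * polyEval q x * ballWeight x = 0 := by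
  -- Green's identity: the integral of the divergence of `w²(p∇q - q∇p)` is zero, `w` being the
  -- weight. Harmonicity removes the second derivatives, and Euler's identity turns the rest into
  -- `-4(l-k) w p q`.
  have hsum : ∫ x : EuclideanSpace ℝ ι, ∑ i, (ballWeight x ^ 2 *
      polyEval (pderiv i (p * pderiv i q - q * pderiv i p)) x +
      -4 * ballWeight x * x i * polyEval (p * pderiv i q - q * pderiv i p) x) = 0 := by
    rw [integral_finsetSum]
    · exact Finset.sum_eq_zero fun i _ => integral_partialD_ballWeight_sq i _
    · intro i _
      have := integrable_mul_ballWeight (f := fun x : EuclideanSpace ℝ ι => ballWeight x *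
        polyEval (pderiv i (p * pderiv i q - q * pderiv i p)) x +
        -4 * x i * polyEval (p * pderiv i q - q * pderiv i p) x) (by
          have h1 := continuous_polyEval (pderiv i (p * pderiv i q - q * pderiv i p))
          have h2 := continuous_polyEval (p * pderiv i q - q * pderiv i p)
          have h3 := continuous_ballWeight (ι := ι)
          fun_prop)
      refine this.congr (Eventually.of_forall fun x => ?_)
      simp only; ring
  have hpt : ∀ x : EuclideanSpace ℝ ι, ∑ i, (ballWeight x ^ 2 *
      polyEval (pderiv i (p * pderiv i q - q * pderiv i p)) x +
      -4 * ballWeight x * x i * polyEval (p * pderiv i q - q * pderiv i p) x) =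
      (-4 * ((l : ℝ) - k)) * (polyEval p x * polyEval q x * ballWeight x) := by
    intro x
    have h1 : ∑ i, polyEval (pderiv i (pderiv i p)) x = 0 := by
      have := congrArg (fun r => polyEval r x) (laplacianPoly_apply p)
      simpa [polyEval, hp0] using this.symm
    have h2 : ∑ i, polyEval (pderiv i (pderiv i q)) x = 0 := by
      have := congrArg (fun r => polyEval r x) (laplacianPoly_apply q)
      simpa [polyEval, hq0] using this.symm
    have h3 := sum_mul_polyEval_pderiv hp x
    have h4 := sum_mul_polyEval_pderiv hq x
    have e : ∀ i, (ballWeight x ^ 2 *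
        polyEval (pderiv i (p * pderiv i q - q * pderiv i p)) x +
        -4 * ballWeight x * x i * polyEval (p * pderiv i q - q * pderiv i p) x) =
        ballWeight x ^ 2 * polyEval p x * polyEval (pderiv i (pderiv i q)) x -
        ballWeight x ^ 2 * polyEval q x * polyEval (pderiv i (pderiv i p)) x +
        (-4 * ballWeight x * polyEval p x) * (x i * polyEval (pderiv i q) x) -
        (-4 * ballWeight x * polyEval q x) * (x i * polyEval (pderiv i p) x) := by
      intro i
      simp only [polyEval, map_sub, pderiv_mul, map_add, map_mul]
      ring
    simp_rw [e]
    rw [Finset.sum_sub_distrib, Finset.sum_add_distrib, Finset.sum_sub_distrib,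
      ← Finset.mul_sum, ← Finset.mul_sum, ← Finset.mul_sum, ← Finset.mul_sum, h1, h2, h3, h4]
    ring
  simp_rw [hpt] at hsum
  rw [integral_const_mul] at hsum
  refine (mul_eq_zero.1 hsum).resolve_left ?_
  have : (l : ℝ) - k ≠ 0 := by
    rw [sub_ne_zero]; exact_mod_cast hkl.symm
  simpa using this

end Orthogonality

end SphericalSpectrum

namespace SphericalSpectrum

open InnerProductSpace Filter Topology MvPolynomial MeasureTheory

/-! ### The cone of a partial simplex and degree-zero extensions. -/

section Domain

variable {ι : Type*} [Fintype ι]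

theorem normalize_mem_iff {S : Finset ι} {x : EuclideanSpace ℝ ι} (hx : x ≠ 0) :
    ‖x‖⁻¹ • x ∈ partialSimplex S ↔ x ∈ partialOrthant S := by
  have hpos : 0 < ‖x‖ := norm_pos_iff.2 hx
  constructor
  · rintro ⟨-, h⟩ i hi
    have := h i hi
    simp only [PiLp.smul_apply, smul_eq_mul] at this
    exact nonneg_of_mul_nonneg_right this (inv_pos.2 hpos)
  · intro h
    refine ⟨by rw [norm_smul, norm_inv, norm_norm, inv_mul_cancel₀ hpos.ne'], ?_⟩
    exact smul_mem_partialOrthant h (inv_nonneg.2 hpos.le)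

theorem cone_partialSimplex (S : Finset ι) : cone (partialSimplex S) = partialOrthant S := by
  ext x
  by_cases hx : x = 0
  · subst hx; simp [cone, partialOrthant]
  · simp [cone, hx, normalize_mem_iff hx]

theorem mem_interior_partialOrthant {S : Finset ι} {x : EuclideanSpace ℝ ι} :
    x ∈ interior (partialOrthant S) ↔ ∀ i ∈ S, 0 < x i := by
  constructor
  · intro h i hi
    have h1 := (tendsto_line x i).eventually (mem_interior_iff_mem_nhds.1 h)
    have h2 : ∀ᶠ t in 𝓝[<] (0 : ℝ), x + t • stdVec i ∈ partialOrthant S :=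
      nhdsWithin_le_nhds h1
    obtain ⟨t, ht, ht0⟩ := (h2.and self_mem_nhdsWithin).exists
    have h3 := ht i hi
    have ht0' : t < 0 := ht0
    simp only [PiLp.add_apply, PiLp.smul_apply, stdVec_self, smul_eq_mul, mul_one] at h3
    linarith
  · intro h
    exact mem_interior_iff_mem_nhds.2 (partialOrthant_mem_nhds h)

theorem mem_frontier_partialOrthant {S : Finset ι} {x : EuclideanSpace ℝ ι}
    (hx : x ∈ partialOrthant S) : x ∈ frontier (partialOrthant S) ↔ ∃ i ∈ S, x i = 0 := by
  rw [(isClosed_partialOrthant S).frontier_eq, Set.mem_sdiff, mem_interior_partialOrthant]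
  constructor
  · rintro ⟨-, h⟩
    push Not at h
    obtain ⟨i, hi, h0⟩ := h
    exact ⟨i, hi, le_antisymm h0 (hx i hi)⟩
  · rintro ⟨i, hi, h0⟩
    exact ⟨hx, fun h => (h i hi).ne' h0⟩

theorem radialExt_of_mem {S : Finset ι} (h : partialSimplex S → ℝ) (ω : partialSimplex S) :
    radialExt h (ω : EuclideanSpace ℝ ι) = h ω := by
  have h1 : ‖(ω : EuclideanSpace ℝ ι)‖⁻¹ • (ω : EuclideanSpace ℝ ι) = ω := by
    rw [ω.2.1]; simp
  have h2 : ‖(ω : EuclideanSpace ℝ ι)‖⁻¹ • (ω : EuclideanSpace ℝ ι) ∈ partialSimplex S := by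
    rw [h1]; exact ω.2
  rw [radialExt, dif_pos h2]
  congr 1
  exact Subtype.ext h1

theorem radialExt_smul_pos {Ω : Set (EuclideanSpace ℝ ι)} (h : Ω → ℝ) {t : ℝ} (ht : 0 < t)
    (x : EuclideanSpace ℝ ι) : radialExt h (t • x) = radialExt h x := by
  have : ‖t • x‖⁻¹ • t • x = ‖x‖⁻¹ • x := by
    rw [norm_smul, Real.norm_of_nonneg ht.le, mul_inv, smul_smul]
    congr 1
    field_simp
  classical
  exact congrArg (fun y => if hy : y ∈ Ω then h ⟨y, hy⟩ else 0) this

theorem continuousWithinAt_radialExt {S : Finset ι} {h : partialSimplex S → ℝ}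
    (hc : Continuous h) {x : EuclideanSpace ℝ ι} (hx : x ∈ partialOrthant S) (hx0 : x ≠ 0) :
    ContinuousWithinAt (radialExt h) (partialOrthant S) x := by
  have h1 : ContinuousOn (radialExt h) (partialOrthant S ∩ {0}ᶜ) := by
    rw [continuousOn_iff_continuous_domRestrict]
    have hm : ∀ y : ↥(partialOrthant S ∩ {0}ᶜ),
        ‖(y : EuclideanSpace ℝ ι)‖⁻¹ • (y : EuclideanSpace ℝ ι) ∈ partialSimplex S :=
      fun y => (normalize_mem_iff y.2.2).2 y.2.1
    have e : (partialOrthant S ∩ {0}ᶜ).domRestrict (radialExt h) = fun y => h ⟨_, hm y⟩ := by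
      funext y
      rw [Set.domRestrict_apply, radialExt, dif_pos (hm y)]
    rw [e]
    refine hc.comp (Continuous.subtype_mk ?_ _)
    refine Continuous.smul (Continuous.inv₀ (continuous_subtype_val.norm) fun y => ?_) continuous_subtype_val
    exact norm_ne_zero_iff.2 y.2.2
  have h2 := h1 x ⟨hx, hx0⟩
  exact h2.mono_of_mem_nhdsWithin
    (inter_mem self_mem_nhdsWithin (nhdsWithin_le_nhds (isOpen_compl_singleton.mem_nhds hx0)))

end Domain

/-! ### Comparing eigenfunctions with harmonic polynomials, and excluding negative eigenvalues. -/

section Eigenfunctions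

variable {ι : Type*} [Fintype ι] {S : Finset ι} {b : BoundaryCondition} {lam : ℝ}
  {h : partialSimplex S → ℝ}

/-- The equation is given only at `r = 1`. Homogeneity of degree zero carries it along rays, the
Laplacian scaling by `r⁻²`. -/
theorem IsEigenfunction.contDiffAt_radialExt (hh : IsEigenfunction b lam h)
    {x : EuclideanSpace ℝ ι} (hx0 : x ≠ 0) (hx : ∀ i ∈ S, 0 < x i) :
    ContDiffAt ℝ 2 (radialExt h) x ∧
      Laplacian.laplacian (radialExt h) x = -lam * ‖x‖ ^ (-2 : ℝ) * radialExt h x := by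
  have hpos : 0 < ‖x‖ := norm_pos_iff.2 hx0
  have hinv : 0 < ‖x‖⁻¹ := inv_pos.2 hpos
  set ω : partialSimplex S :=
    ⟨‖x‖⁻¹ • x, (normalize_mem_iff hx0).2 fun i hi => (hx i hi).le⟩ with hω
  have hint : (ω : EuclideanSpace ℝ ι) ∈ interior (cone (partialSimplex S)) := by
    rw [cone_partialSimplex, mem_interior_partialOrthant]
    intro i hi
    simpa [hω] using mul_pos hinv (hx i hi)
  have e : radialExt h = fun y => radialExt h (‖x‖⁻¹ • y) := by
    funext y; rw [radialExt_smul_pos h hinv]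
  have hc := hh.contDiffAt ω hint
  have heq := hh.equation ω hint
  rw [sphericalLaplacian] at heq
  constructor
  · rw [e]
    exact ContDiffAt.comp (g := radialExt h) x hc (contDiff_const_smul _).contDiffAt
  · conv_lhs => rw [e]
    rw [laplacian_comp_smul _ hc]
    change ‖x‖⁻¹ ^ 2 * Laplacian.laplacian (radialExt h) (ω : EuclideanSpace ℝ ι) = _
    rw [heq, ← radialExt_of_mem h ω]
    change _ * (-lam * radialExt h (‖x‖⁻¹ • x)) = _
    rw [radialExt_smul_pos h hinv, Real.rpow_neg hpos.le, Real.rpow_two, inv_pow]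
    ring

/-- On the cone `-yᵢ` is maximal at a point of the face, so its derivative along tangent vectors is
nonpositive. Consequently `-eᵢ` is an outer normal there. -/
theorem coord_nonneg_of_mem_posTangentCone {x w : EuclideanSpace ℝ ι} {i : ι} (hi : i ∈ S)
    (hx : x i = 0) (hw : w ∈ posTangentConeAt (partialOrthant S) x) : 0 ≤ w i := by
  have hmax : IsLocalMaxOn (fun y : EuclideanSpace ℝ ι => -(y i)) (partialOrthant S) x := by
    filter_upwards [self_mem_nhdsWithin] with y hy
    have := hy i hi
    rw [hx]; linarith
  have hd : HasFDerivWithinAt (fun y : EuclideanSpace ℝ ι => -(y i))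
      (-(EuclideanSpace.proj (𝕜 := ℝ) i : EuclideanSpace ℝ ι →L[ℝ] ℝ)) (partialOrthant S) x :=
    (EuclideanSpace.proj (𝕜 := ℝ) i : EuclideanSpace ℝ ι →L[ℝ] ℝ).hasFDerivWithinAt.neg
  have := hmax.hasFDerivWithinAt_nonpos hd hw
  simpa using this

theorem IsEigenfunction.hasDerivWithinAt_face (hh : IsEigenfunction .neumann lam h)
    {x : EuclideanSpace ℝ ι} (hx : x ∈ partialOrthant S) (hx0 : x ≠ 0) {i : ι} (hi : i ∈ S)
    (hxi : x i = 0) :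
    HasDerivWithinAt (fun t : ℝ => radialExt h (x + t • stdVec i)) 0 (Set.Ici 0) 0 := by
  have hpos : 0 < ‖x‖ := norm_pos_iff.2 hx0
  have hinv : 0 < ‖x‖⁻¹ := inv_pos.2 hpos
  obtain ⟨G, -, hG⟩ := hh.boundary
  set ω : partialSimplex S := ⟨‖x‖⁻¹ • x, (normalize_mem_iff hx0).2 hx⟩ with hω
  have hωi : (ω : EuclideanSpace ℝ ι) i = 0 := by simp [hω, hxi]
  obtain ⟨hd, hn⟩ := hG ω
  rw [cone_partialSimplex] at hd hn
  have hG0 : G ω (stdVec i) = 0 := by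
    have := hn (-stdVec i) fun w hw => by
      rw [inner_neg_left, real_inner_comm, inner_stdVec]
      linarith [coord_nonneg_of_mem_posTangentCone hi hωi hw]
    simpa using this
  have hline : HasDerivWithinAt (fun t : ℝ => ‖x‖⁻¹ • (x + t • stdVec i)) (‖x‖⁻¹ • stdVec i)
      (Set.Ici 0) 0 := by
    have h1 : HasDerivAt (fun t : ℝ => x + t • stdVec i) (stdVec i) 0 := by
      simpa using ((hasDerivAt_id (0 : ℝ)).smul_const (stdVec i)).const_add x
    exact (h1.const_smul ‖x‖⁻¹).hasDerivWithinAt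
  have hd' : HasFDerivWithinAt (radialExt h) (G ω) (partialOrthant S)
      (‖x‖⁻¹ • (x + (0 : ℝ) • stdVec i)) := by simpa using hd
  have := hd'.comp_hasDerivWithinAt (0 : ℝ) hline fun t ht =>
    smul_mem_partialOrthant (add_smul_stdVec_mem hx i ht) hinv.le
  rw [map_smul, hG0, smul_zero] at this
  refine this.congr (fun t _ => ?_) ?_
  · simp only [Function.comp_apply]
    rw [radialExt_smul_pos h hinv]
  · simp only [Function.comp_apply]
    rw [radialExt_smul_pos h hinv]

theorem IsEigenfunction.eq_zero_face (hh : IsEigenfunction .dirichlet lam h)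
    {x : EuclideanSpace ℝ ι} (hx : x ∈ partialOrthant S) (hx0 : x ≠ 0) {i : ι} (hi : i ∈ S)
    (hxi : x i = 0) : radialExt h x = 0 := by
  have hm := (normalize_mem_iff hx0).2 hx
  rw [radialExt, dif_pos hm]
  refine hh.boundary ⟨_, hm⟩ ?_
  rw [cone_partialSimplex, mem_frontier_partialOrthant]
  · exact ⟨i, hi, by simp [hxi]⟩
  · exact hm.2

/-- Comparison of `r^s h` with a function satisfying the boundary condition. -/
theorem IsEigenfunction.rpow_mul_sub_le (hn : 2 ≤ Fintype.card ι) (hh : IsEigenfunction b lam h)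
    {s M C : ℝ} (hs : 0 ≤ s) {g : EuclideanSpace ℝ ι → ℝ}
    (hg : ∀ x, x ≠ 0 → ContDiffAt ℝ 2 g x) (hgC : ∀ x, ‖x‖ ≤ 1 → C ≤ g x)
    (hsphere : ∀ ω : partialSimplex S, h ω - g ω ≤ M)
    (hlap : ∀ x, x ≠ 0 → ‖x‖ < 1 → (∀ i ∈ S, 0 < x i) → M < ‖x‖ ^ s * radialExt h x - g x →
      Laplacian.laplacian g x ≤
        (s * (s + Fintype.card ι - 2) - lam) * ‖x‖ ^ (s - 2) * radialExt h x)
    (hdir : b = .dirichlet → ∀ x ∈ partialOrthant S, ∀ i ∈ S, x i = 0 → -M ≤ g x)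
    (hneu : b = .neumann → ∀ x ∈ partialOrthant S, x ≠ 0 → ∀ i ∈ S, x i = 0 → partialD i g x = 0) :
    ∀ x ∈ partialOrthant S, x ≠ 0 → ‖x‖ ≤ 1 → ‖x‖ ^ s * radialExt h x - g x ≤ M := by
  obtain ⟨B, hB⟩ := isCompact_univ.exists_bound_of_continuousOn hh.continuous.continuousOn
  have hu : ∀ x ∈ partialOrthant S, x ≠ 0 → radialExt h x ≤ |B| := by
    intro x hx hx0
    rw [radialExt, dif_pos ((normalize_mem_iff hx0).2 hx)]
    exact (le_abs_self _).trans ((hB _ (Set.mem_univ _)).trans (le_abs_self B))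
  refine le_of_subharmonic hn (S := S) (w := fun x => ‖x‖ ^ s * radialExt h x - g x)
    (C := |B| - C) ?_ ?_ ?_ ?_ ?_
  · intro x hx hx0
    exact ((contDiffAt_norm_rpow s hx0).continuousAt.continuousWithinAt.mul
      (continuousWithinAt_radialExt hh.continuous hx hx0)).sub
      (hg x hx0).continuousAt.continuousWithinAt
  · intro x hx hx0 hx1
    have h1 : ‖x‖ ^ s * radialExt h x ≤ 1 * |B| :=
      mul_le_mul_of_nonneg (Real.rpow_le_one (norm_nonneg x) hx1 hs) (hu x hx hx0)
        (Real.rpow_nonneg (norm_nonneg x) s) (abs_nonneg B)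
    have h2 := hgC x hx1
    linarith
  · intro x hx hx1
    have := hsphere ⟨x, hx1, hx⟩
    rw [← radialExt_of_mem h] at this
    simpa [hx1] using this
  · intro x hx0 hx1 hpos hM
    obtain ⟨hc, hl⟩ := hh.contDiffAt_radialExt hx0 hpos
    have hnx : 0 < ‖x‖ := norm_pos_iff.2 hx0
    have hc1 : ContDiffAt ℝ 2 (fun y => ‖y‖ ^ s * radialExt h y) x :=
      (contDiffAt_norm_rpow s hx0).mul hc
    -- A function homogeneous of degree zero has no radial derivative, so the cross term in the
    -- Laplacian of `r^s h` disappears.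
    have hd : fderiv ℝ (radialExt h) x x = 0 * radialExt h x :=
      fderiv_self_of_homogeneous (hc.differentiableAt (by norm_num)) fun t ht => by
        rw [radialExt_smul_pos h ht, Real.rpow_zero, one_mul]
    refine ⟨hc1.sub (hg x hx0), ?_⟩
    have e : (fun y => ‖y‖ ^ s * radialExt h y - g y) =
      (fun y => ‖y‖ ^ s * radialExt h y) - g := rfl
    rw [e, hc1.laplacian_sub (hg x hx0), laplacian_norm_rpow_mul s 0 hx0 hc hd, hl]
    have h1 : ‖x‖ ^ s * (-lam * ‖x‖ ^ (-2 : ℝ) * radialExt h x) =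
        -lam * ‖x‖ ^ (s - 2) * radialExt h x := by
      rw [show s - 2 = s + (-2) by ring, Real.rpow_add hnx]; ring
    rw [h1]
    have := hlap x hx0 hx1 hpos hM
    linarith
  · intro x hx hx0 hx1 i hi hxi hM
    cases b with
    | dirichlet =>
      -- On a Dirichlet face the compared function is `-g ≤ M`, so the face condition, required only
      -- above `M`, is vacuous.
      have h1 := hh.eq_zero_face hx hx0 hi hxi
      have h2 := hdir rfl x hx i hi hxi
      simp only [h1, mul_zero] at hM
      linarith
    | neumann =>
      have h1 := hh.hasDerivWithinAt_face hx hx0 hi hxi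
      have hda : DifferentiableAt ℝ (fun y : EuclideanSpace ℝ ι => ‖y‖ ^ s)
          (x + (0 : ℝ) • stdVec i) := by
        simpa using (contDiffAt_norm_rpow s hx0).differentiableAt (by norm_num)
      have h2 := hasDerivAt_line hda
      have hdb : DifferentiableAt ℝ g (x + (0 : ℝ) • stdVec i) := by
        simpa using (hg x hx0).differentiableAt (by norm_num)
      have h3 := hasDerivAt_line hdb
      rw [zero_smul, add_zero, partialD_norm_rpow s hx0, hxi, mul_zero] at h2
      rw [zero_smul, add_zero, hneu rfl x hx hx0 i hi hxi] at h3
      have := (h2.hasDerivWithinAt.mul h1).sub h3.hasDerivWithinAt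
      exact this.congr_deriv (by simp)

theorem IsEigenfunction.neg (hh : IsEigenfunction b lam h) :
    IsEigenfunction b lam (fun ω => -h ω) :=
  (eigenspace b (partialSimplex S) lam).neg_mem hh

theorem radialExt_neg (h : partialSimplex S → ℝ) (x : EuclideanSpace ℝ ι) :
    radialExt (fun ω => -h ω) x = -radialExt h x := by
  simp only [radialExt]; split_ifs <;> simp

/-- With `m` a bound for `h`, comparison on the ball gives `h ≤ m r^s` for some `s > 0`. The
extension of `h` is constant along rays while the right side tends to 0 at the origin. -/
theorem IsEigenfunction.le_zero_of_neg (hn : 2 ≤ Fintype.card ι) (hlam : lam < 0)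
    (hh : IsEigenfunction b lam h) (ω : partialSimplex S) : h ω ≤ 0 := by
  obtain ⟨B, hB⟩ := isCompact_univ.exists_bound_of_continuousOn hh.continuous.continuousOn
  set m : ℝ := |B| with hm
  have hn' : (2 : ℝ) ≤ Fintype.card ι := by exact_mod_cast hn
  -- Since `s ≤ 1`, `s(s+n-2) ≤ sn ≤ -lam`; this makes `h - m r^s` subharmonic wherever it is
  -- positive.
  set s : ℝ := min 1 (-lam / Fintype.card ι) with hs
  have hs0 : 0 < s := lt_min one_pos (div_pos (by linarith) (by linarith))
  have hs1 : s ≤ 1 := min_le_left _ _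
  have hs2 : s * Fintype.card ι ≤ -lam := by
    rw [← le_div_iff₀ (by linarith)]; exact min_le_right _ _
  have hss : s * (s + Fintype.card ι - 2) ≤ -lam := by nlinarith
  have key := hh.rpow_mul_sub_le hn (s := 0) (M := 0) (C := 0) le_rfl
    (g := fun x => m * ‖x‖ ^ s)
    (fun x hx => contDiffAt_const.mul (contDiffAt_norm_rpow s hx))
    (fun x _ => mul_nonneg (abs_nonneg B) (Real.rpow_nonneg (norm_nonneg x) s))
    (fun ω => by
      rw [ω.2.1, Real.one_rpow, mul_one, sub_nonpos]
      exact (le_abs_self _).trans ((hB ω (Set.mem_univ ω)).trans (le_abs_self B)))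
    (fun x hx0 hx1 _ hM => by
      have hnx : 0 < ‖x‖ := norm_pos_iff.2 hx0
      have e : (fun x : EuclideanSpace ℝ ι => m * ‖x‖ ^ s) =
        m • (fun x : EuclideanSpace ℝ ι => ‖x‖ ^ s) := rfl
      rw [e, laplacian_smul m (contDiffAt_norm_rpow s hx0), laplacian_norm_rpow s hx0, smul_eq_mul]
      simp only [Real.rpow_zero, one_mul] at hM
      have h1 : ‖x‖ ^ (s - 2) = ‖x‖ ^ ((0 : ℝ) - 2) * ‖x‖ ^ s := by
        rw [← Real.rpow_add hnx]; congr 1; ring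
      have h2 : 0 < ‖x‖ ^ ((0 : ℝ) - 2) := Real.rpow_pos_of_pos hnx _
      have h3 : m * ‖x‖ ^ s ≤ radialExt h x := by linarith
      have h4 : 0 ≤ m * ‖x‖ ^ s := mul_nonneg (abs_nonneg B) (Real.rpow_nonneg (norm_nonneg x) s)
      rw [h1]
      calc m * (s * (s + Fintype.card ι - 2) * (‖x‖ ^ ((0 : ℝ) - 2) * ‖x‖ ^ s))
          = ‖x‖ ^ ((0 : ℝ) - 2) * (s * (s + Fintype.card ι - 2) * (m * ‖x‖ ^ s)) := by ring
        _ ≤ ‖x‖ ^ ((0 : ℝ) - 2) * (-lam * radialExt h x) := by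
            refine mul_le_mul_of_nonneg_left ?_ h2.le
            exact mul_le_mul hss h3 h4 (by linarith)
        _ = _ := by ring)
    (fun _ x _ i _ _ => by
      simpa using mul_nonneg (abs_nonneg B) (Real.rpow_nonneg (norm_nonneg x) s))
    (fun _ x _ hx0 i _ hxi => by
      rw [partialD_mul i (differentiableAt_const _)
        ((contDiffAt_norm_rpow s hx0).differentiableAt (by norm_num)), partialD_norm_rpow s hx0, hxi]
      simp [partialD])
  have hω0 : (ω : EuclideanSpace ℝ ι) ≠ 0 := by
    intro h0; have := ω.2.1; rw [h0] at this; simp at this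
  have hbound : ∀ t ∈ Set.Ioc (0 : ℝ) 1, h ω ≤ m * t ^ s := by
    intro t ht
    have hnt : ‖t • (ω : EuclideanSpace ℝ ι)‖ = t := by
      rw [norm_smul, ω.2.1, mul_one, Real.norm_of_nonneg ht.1.le]
    have := key (t • (ω : EuclideanSpace ℝ ι)) (smul_mem_partialOrthant ω.2.2 ht.1.le)
      (smul_ne_zero ht.1.ne' hω0) (by rw [hnt]; exact ht.2)
    rw [radialExt_smul_pos h ht.1, radialExt_of_mem, hnt] at this
    simpa using this
  have hlim : Tendsto (fun t : ℝ => m * t ^ s) (𝓝[>] 0) (𝓝 (m * 0 ^ s)) :=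
    (((Real.continuous_rpow_const hs0.le).tendsto 0).const_mul m).mono_left nhdsWithin_le_nhds
  rw [Real.zero_rpow hs0.ne', mul_zero] at hlim
  refine ge_of_tendsto hlim ?_
  filter_upwards [Ioc_mem_nhdsGT (zero_lt_one (α := ℝ))] with t ht using hbound t ht

theorem eigenspace_eq_bot_of_neg (hn : 2 ≤ Fintype.card ι) (hlam : lam < 0) :
    eigenspace b (partialSimplex S) lam = ⊥ := by
  rw [eq_bot_iff]
  intro h hh
  rw [Submodule.mem_bot]
  funext ω
  have h1 := IsEigenfunction.le_zero_of_neg hn hlam hh ω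
  have h2 := IsEigenfunction.le_zero_of_neg hn hlam (IsEigenfunction.neg hh) ω
  exact le_antisymm h1 (by simpa using h2)

/-- For `s = ν` the factor `s(s+n-2) - lam` vanishes: `r^ν h` is harmonic, and the parity of `H`
supplies the condition on the faces. Applied to `-h` and `-H` it yields the lower bound. -/
theorem IsEigenfunction.rpow_mul_sub_polyEval_le (hn : 2 ≤ Fintype.card ι) {ν : ℝ} (hν : 0 ≤ ν)
    (hh : IsEigenfunction b (eigenvalueOfDegree ι ν) h) {H : MvPolynomial ι ℝ}
    (hH : H ∈ restrictSupport ℝ (parityExponents b S)) (hH0 : laplacianPoly H = 0) {ε : ℝ}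
    (hε : ∀ ω : partialSimplex S, |h ω - polyEval H ω| ≤ ε) :
    ∀ x ∈ partialOrthant S, x ≠ 0 → ‖x‖ ≤ 1 →
      ‖x‖ ^ ν * radialExt h x - polyEval H x ≤ ε := by
  rcases isEmpty_or_nonempty (partialSimplex S) with hemp | ⟨⟨ω₀⟩⟩
  · intro x hx hx0
    exact (hemp.false ⟨_, (normalize_mem_iff hx0).2 hx⟩).elim
  have hε0 : 0 ≤ ε := (abs_nonneg _).trans (hε ω₀)
  obtain ⟨C, hC⟩ := (isCompact_closedBall (0 : EuclideanSpace ℝ ι) 1).exists_bound_of_continuousOn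
    (continuous_polyEval H).continuousOn
  refine hh.rpow_mul_sub_le hn hν (C := -C) (fun x _ => (contDiff_polyEval H).contDiffAt)
    (fun x hx => neg_le_of_abs_le (hC x (by simpa using hx)))
    (fun ω => (le_abs_self _).trans (hε ω)) ?_ ?_ ?_
  · intro x _ _ _ _
    rw [laplacian_polyEval, hH0, eigenvalueOfDegree]
    simp [polyEval]
  · rintro rfl x _ i hi hxi
    rw [polyEval_eq_zero_of_dirichlet hH hi hxi]
    linarith
  · rintro rfl x _ _ i hi hxi
    exact partialD_polyEval_eq_zero_of_neumann hH hi hxi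

theorem IsEigenfunction.abs_rpow_mul_sub_polyEval_le (hn : 2 ≤ Fintype.card ι) {ν : ℝ}
    (hν : 0 ≤ ν) (hh : IsEigenfunction b (eigenvalueOfDegree ι ν) h) {H : MvPolynomial ι ℝ}
    (hH : H ∈ restrictSupport ℝ (parityExponents b S)) (hH0 : laplacianPoly H = 0) {ε : ℝ}
    (hε : ∀ ω : partialSimplex S, |h ω - polyEval H ω| ≤ ε) {x : EuclideanSpace ℝ ι}
    (hx : x ∈ partialOrthant S) (hx0 : x ≠ 0) (hx1 : ‖x‖ ≤ 1) :
    |‖x‖ ^ ν * radialExt h x - polyEval H x| ≤ ε := by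
  have hneg : ∀ y : EuclideanSpace ℝ ι, polyEval (-H) y = -polyEval H y := fun y => by
    simp [polyEval]
  have h1 := hh.rpow_mul_sub_polyEval_le hn hν hH hH0 hε x hx hx0 hx1
  have h2 := hh.neg.rpow_mul_sub_polyEval_le hn hν (Submodule.neg_mem _ hH)
    (by rw [map_neg, hH0, neg_zero]) (ε := ε) (fun ω => by
      rw [hneg, neg_sub_neg, abs_sub_comm]; exact hε ω) x hx hx0 hx1
  rw [radialExt_neg, hneg] at h2
  exact abs_le.2 ⟨by linarith, h1⟩

/-- An eigenfunction times `r^ν` is a uniform limit of harmonic polynomials on the ball. -/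
theorem IsEigenfunction.exists_harmonic_near (hn : 2 ≤ Fintype.card ι) {ν : ℝ} (hν : 0 ≤ ν)
    (hh : IsEigenfunction b (eigenvalueOfDegree ι ν) h) {ε : ℝ} (hε : 0 < ε) :
    ∃ H ∈ restrictSupport ℝ (parityExponents b S), laplacianPoly H = 0 ∧
      ∀ x ∈ partialOrthant S, x ≠ 0 → ‖x‖ ≤ 1 →
        |‖x‖ ^ ν * radialExt h x - polyEval H x| ≤ ε := by
  obtain ⟨p, hp, hpε⟩ := exists_parity_near b S hh.continuous (by
    rintro rfl ω i hi hωi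
    have hω0 : (ω : EuclideanSpace ℝ ι) ≠ 0 := by
      intro h0; have := ω.2.1; rw [h0] at this; simp at this
    rw [← radialExt_of_mem h]
    exact hh.eq_zero_face ω.2.2 hω0 hi hωi) hε
  obtain ⟨H, hH, hH0, hHp⟩ := exists_harmonic_eq_on_sphere hn hp
  refine ⟨H, hH, hH0, fun x hx hx0 hx1 => ?_⟩
  exact hh.abs_rpow_mul_sub_polyEval_le hn hν hH hH0
    (fun ω => by rw [hHp ω ω.2.1]; exact (hpε ω).le) hx hx0 hx1

end Eigenfunctions

end SphericalSpectrum

namespace SphericalSpectrum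

open InnerProductSpace Filter Topology MvPolynomial MeasureTheory

/-! ### Closedness in L² and isolating the part of degree `ν`. -/

section LeastSquares

variable {ι : Type*} [Fintype ι]

/-- The image of `W` in L² is finite-dimensional, hence closed, so mean-square approximability by
`W` means membership up to null sets. -/
theorem exists_ae_eq_polyEval {μ : Measure (EuclideanSpace ℝ ι)}
    {W : Submodule ℝ (MvPolynomial ι ℝ)} [Module.Finite ℝ W] {F : EuclideanSpace ℝ ι → ℝ}
    (hF : MemLp F 2 μ) (hp : ∀ p : MvPolynomial ι ℝ, MemLp (polyEval p) 2 μ)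
    (happ : ∀ ε > 0, ∃ p ∈ W, ∫ x, (F x - polyEval p x) ^ 2 ∂μ ≤ ε) :
    ∃ p ∈ W, F =ᵐ[μ] polyEval p := by
  let Λ : MvPolynomial ι ℝ →ₗ[ℝ] Lp ℝ 2 μ :=
    { toFun := fun p => (hp p).toLp
      map_add' := fun p q => by
        rw [← MemLp.toLp_add]
        exact MemLp.toLp_congr _ _ (Eventually.of_forall fun x => by simp [polyEval])
      map_smul' := fun c p => by
        rw [RingHom.id_apply, ← MemLp.toLp_const_smul]
        exact MemLp.toLp_congr _ _ (Eventually.of_forall fun x => by simp [polyEval]) }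
  have hclosed : IsClosed ((W.map Λ : Submodule ℝ (Lp ℝ 2 μ)) : Set (Lp ℝ 2 μ)) :=
    (W.map Λ).closed_of_finiteDimensional
  have hmem : hF.toLp ∈ closure ((W.map Λ : Submodule ℝ (Lp ℝ 2 μ)) : Set (Lp ℝ 2 μ)) := by
    rw [Metric.mem_closure_iff]
    intro ε hε
    obtain ⟨p, hpW, hpε⟩ := happ ((ε / 2) ^ 2) (by positivity)
    refine ⟨Λ p, ⟨p, hpW, rfl⟩, ?_⟩
    have h1 : hF.toLp - Λ p = (hF.sub (hp p)).toLp := (MemLp.toLp_sub hF (hp p)).symm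
    have h2 : ‖(hF.sub (hp p)).toLp‖ ^ 2 = ∫ x, (F x - polyEval p x) ^ 2 ∂μ := by
      rw [← real_inner_self_eq_norm_sq, L2.inner_def]
      refine integral_congr_ae ?_
      filter_upwards [(hF.sub (hp p)).coeFn_toLp] with x hx
      rw [hx]
      simp [sq]
    rw [dist_eq_norm, h1]
    have h3 : ‖(hF.sub (hp p)).toLp‖ ^ 2 ≤ (ε / 2) ^ 2 := h2 ▸ hpε
    have h4 := abs_le_of_sq_le_sq h3 (by positivity)
    rw [abs_of_nonneg (norm_nonneg _)] at h4
    linarith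
  rw [hclosed.closure_eq] at hmem
  obtain ⟨p, hpW, hpe⟩ := hmem
  exact ⟨p, hpW, (MemLp.toLp_eq_toLp_iff hF (hp p)).1 hpe.symm⟩

/-- The Pythagorean theorem for harmonic homogeneous polynomials of different degrees. -/
theorem integral_sum_sq {P : ℕ → MvPolynomial ι ℝ} (hP : ∀ k, (P k).IsHomogeneous k)
    (hP0 : ∀ k, laplacianPoly (P k) = 0) (c : ℕ → ℝ) (T : Finset ℕ) :
    ∫ x : EuclideanSpace ℝ ι, (∑ k ∈ T, c k * polyEval (P k) x) ^ 2 * ballWeight x =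
      ∑ k ∈ T, c k ^ 2 * ∫ x : EuclideanSpace ℝ ι, polyEval (P k) x ^ 2 * ballWeight x := by
  have hint : ∀ k l, Integrable fun x : EuclideanSpace ℝ ι =>
      (c k * c l) * (polyEval (P k) x * polyEval (P l) x * ballWeight x) := fun k l =>
    (integrable_mul_ballWeight ((continuous_polyEval _).mul (continuous_polyEval _))).const_mul _
  have e : ∀ x : EuclideanSpace ℝ ι, (∑ k ∈ T, c k * polyEval (P k) x) ^ 2 * ballWeight x =
      ∑ k ∈ T, ∑ l ∈ T, (c k * c l) * (polyEval (P k) x * polyEval (P l) x * ballWeight x) := by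
    intro x
    rw [sq, Finset.sum_mul_sum, Finset.sum_mul]
    refine Finset.sum_congr rfl fun k _ => ?_
    rw [Finset.sum_mul]
    exact Finset.sum_congr rfl fun l _ => by ring
  simp_rw [e]
  rw [integral_finsetSum _ fun k _ => integrable_finsetSum _ fun l _ => hint k l]
  refine Finset.sum_congr rfl fun k hk => ?_
  rw [integral_finsetSum _ fun l _ => hint k l, Finset.sum_eq_single k]
  · rw [integral_const_mul]
    simp_rw [← sq]
  · intro l _ hl
    rw [integral_const_mul, integral_mul_eq_zero_of_degree_ne hl.symm (hP k) (hP l) (hP0 k) (hP0 l),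
      mul_zero]
  · intro h; exact absurd hk h

/-- As `k` grows the difference tends to `-2^(-ν) ≠ 0`; the finitely many remaining `k` are handled
by injectivity of the exponential. -/
theorem exists_gap (ν : ℝ) : ∃ c > 0, ∀ k : ℕ, (k : ℝ) ≠ ν →
    c ≤ ((1 / 2 : ℝ) ^ k - (1 / 2 : ℝ) ^ ν) ^ 2 := by
  set a : ℝ := (1 / 2 : ℝ) ^ ν with ha
  have ha0 : 0 < a := Real.rpow_pos_of_pos (by norm_num) _
  have hfin : ∀ K : ℕ, ∃ c > 0, ∀ k < K, (k : ℝ) ≠ ν → c ≤ ((1 / 2 : ℝ) ^ k - a) ^ 2 := by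
    intro K
    induction K with
    | zero => exact ⟨1, one_pos, by simp⟩
    | succ K ih =>
      obtain ⟨c, hc, h⟩ := ih
      by_cases hK : (K : ℝ) = ν
      · refine ⟨c, hc, fun k hk hne => h k ?_ hne⟩
        rcases Nat.lt_succ_iff_lt_or_eq.1 hk with h1 | rfl
        · exact h1
        · exact absurd hK hne
      · have hne : (1 / 2 : ℝ) ^ K - a ≠ 0 := by
          rw [sub_ne_zero, ha, ← Real.rpow_natCast]
          intro heq
          exact hK ((Real.strictAnti_rpow_of_base_lt_one (by norm_num) (by norm_num)).injective heq)
        refine ⟨min c (((1 / 2 : ℝ) ^ K - a) ^ 2), lt_min hc (by positivity), fun k hk hkν => ?_⟩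
        rcases Nat.lt_succ_iff_lt_or_eq.1 hk with h1 | rfl
        · exact (min_le_left _ _).trans (h k h1 hkν)
        · exact min_le_right _ _
  have hlim : Tendsto (fun k : ℕ => ((1 / 2 : ℝ) ^ k - a) ^ 2) atTop (𝓝 ((0 - a) ^ 2)) :=
    ((tendsto_pow_atTop_nhds_zero_of_lt_one (by norm_num) (by norm_num)).sub_const a).pow 2
  have hlt : a ^ 2 / 2 < (0 - a) ^ 2 := by nlinarith [pow_pos ha0 2]
  obtain ⟨K, hK⟩ := eventually_atTop.1 (hlim.eventually (lt_mem_nhds hlt))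
  obtain ⟨c, hc, h⟩ := hfin K
  refine ⟨min c (a ^ 2 / 2), lt_min hc (by positivity), fun k hk => ?_⟩
  rcases lt_or_ge k K with hlt' | hge
  · exact (min_le_left _ _).trans (h k hlt' hk)
  · exact (min_le_right _ _).trans (hK k hge).le

/-- The part of degree `ν` of a polynomial, for a real number `ν`. -/
noncomputable def degreePart (ν : ℝ) (H : MvPolynomial ι ℝ) : MvPolynomial ι ℝ :=
  ∑ k ∈ Finset.range (H.totalDegree + 1), if (k : ℝ) = ν then homogeneousComponent k H else 0

theorem polyEval_sum_homogeneousComponent (H : MvPolynomial ι ℝ) (x : EuclideanSpace ℝ ι) :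
    polyEval H x =
      ∑ k ∈ Finset.range (H.totalDegree + 1), polyEval (homogeneousComponent k H) x := by
  conv_lhs => rw [← sum_homogeneousComponent H]
  simp [polyEval]

theorem homogeneousComponent_mem_degree (H : MvPolynomial ι ℝ) (k : ℕ) :
    homogeneousComponent k H ∈ restrictSupport ℝ {m : ι →₀ ℕ | m.degree = k} := by
  have := homogeneousComponent_mem (φ := H) (n := k)
  rwa [homogeneousSubmodule_eq_finsupp_supported] at this

/-- A harmonic polynomial that is nearly homogeneous of degree `ν` is near to its part of
degree `ν`. -/
theorem integral_sub_degreePart_sq_le [Nontrivial (EuclideanSpace ℝ ι)] {ν c δ : ℝ} (hc : 0 < c)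
    (hgap : ∀ k : ℕ, (k : ℝ) ≠ ν → c ≤ ((1 / 2 : ℝ) ^ k - (1 / 2 : ℝ) ^ ν) ^ 2)
    {H : MvPolynomial ι ℝ} (hH0 : laplacianPoly H = 0)
    (hδ : ∀ x : EuclideanSpace ℝ ι, x ≠ 0 → ‖x‖ ≤ 1 →
      |polyEval H ((1 / 2 : ℝ) • x) - (1 / 2 : ℝ) ^ ν * polyEval H x| ≤ δ) :
    ∫ x : EuclideanSpace ℝ ι, (polyEval H x - polyEval (degreePart ν H) x) ^ 2 * ballWeight x ≤
      δ ^ 2 / c * ∫ x : EuclideanSpace ℝ ι, ballWeight x := by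
  set T := Finset.range (H.totalDegree + 1)
  have hhom : ∀ k, (homogeneousComponent k H).IsHomogeneous k :=
    fun k => homogeneousComponent_isHomogeneous k H
  have hharm := laplacianPoly_homogeneousComponent_eq_zero hH0
  have e1 : ∀ x : EuclideanSpace ℝ ι, polyEval H x - polyEval (degreePart ν H) x =
      ∑ k ∈ T, (if (k : ℝ) = ν then (0 : ℝ) else 1) * polyEval (homogeneousComponent k H) x := by
    intro x
    have : polyEval (degreePart ν H) x =
        ∑ k ∈ T, if (k : ℝ) = ν then polyEval (homogeneousComponent k H) x else 0 := by
      simp only [degreePart, polyEval, map_sum]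
      refine Finset.sum_congr rfl fun k _ => ?_
      split_ifs <;> simp
    rw [this, polyEval_sum_homogeneousComponent, ← Finset.sum_sub_distrib]
    refine Finset.sum_congr rfl fun k _ => ?_
    split_ifs <;> simp
  -- Halving the argument multiplies the component of degree `k` by `2^(-k)`, so the homogeneity
  -- defect is a combination of the same orthogonal components.
  have e2 : ∀ x : EuclideanSpace ℝ ι,
      polyEval H ((1 / 2 : ℝ) • x) - (1 / 2 : ℝ) ^ ν * polyEval H x =
      ∑ k ∈ T, ((1 / 2 : ℝ) ^ k - (1 / 2 : ℝ) ^ ν) * polyEval (homogeneousComponent k H) x := by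
    intro x
    rw [polyEval_sum_homogeneousComponent, polyEval_sum_homogeneousComponent H x, Finset.mul_sum,
      ← Finset.sum_sub_distrib]
    refine Finset.sum_congr rfl fun k _ => ?_
    rw [polyEval_smul_of_degree (homogeneousComponent_mem_degree H k)]
    ring
  have h1 : ∫ x : EuclideanSpace ℝ ι,
      (polyEval H ((1 / 2 : ℝ) • x) - (1 / 2 : ℝ) ^ ν * polyEval H x) ^ 2 * ballWeight x ≤
      ∫ x : EuclideanSpace ℝ ι, δ ^ 2 * ballWeight x := by
    refine integral_mono_ae ?_ ?_ ?_
    · refine integrable_mul_ballWeight ?_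
      have := continuous_polyEval H
      fun_prop
    · exact integrable_mul_ballWeight continuous_const
    · filter_upwards [compl_mem_ae_iff.2 (measure_singleton (0 : EuclideanSpace ℝ ι))] with x hx
      rcases le_total ‖x‖ 1 with hx1 | hx1
      · refine mul_le_mul_of_nonneg_right ?_ (ballWeight_nonneg x)
        exact sq_le_sq' (neg_le_of_abs_le (hδ x hx hx1)) (le_of_abs_le (hδ x hx hx1))
      · simp [ballWeight_eq_zero hx1]
  rw [integral_const_mul] at h1
  simp_rw [e2] at h1
  rw [integral_sum_sq hhom hharm] at h1
  simp_rw [e1]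
  -- By Pythagoras both sides are sums over the degrees, compared term by term using the gap `c`.
  rw [integral_sum_sq hhom hharm, div_mul_eq_mul_div, le_div_iff₀ hc, Finset.sum_mul]
  refine le_trans (Finset.sum_le_sum fun k _ => ?_) h1
  have hnn : 0 ≤ ∫ x : EuclideanSpace ℝ ι, polyEval (homogeneousComponent k H) x ^ 2 *
      ballWeight x := integral_nonneg fun x => mul_nonneg (sq_nonneg _) (ballWeight_nonneg x)
  split_ifs with hk
  · have := mul_nonneg (sq_nonneg ((1 / 2 : ℝ) ^ k - (1 / 2 : ℝ) ^ ν)) hnn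
    simpa using this
  · have := mul_le_mul_of_nonneg_right (hgap k hk) hnn
    linarith

end LeastSquares

/-! ### Eigenfunctions are restrictions of harmonic polynomials. -/

section Spectrum

variable {ι : Type*} [Fintype ι]

/-- Harmonic polynomials of given parity and of degree `ν`; trivial if `ν` is not a natural
number. -/
noncomputable def harmonicOfDegree (b : BoundaryCondition) (S : Finset ι) (ν : ℝ) :
    Submodule ℝ (MvPolynomial ι ℝ) :=
  restrictSupport ℝ {m | m ∈ parityExponents b S ∧ (m.degree : ℝ) = ν} ⊓ LinearMap.ker laplacianPoly

theorem harmonicOfDegree_natCast (b : BoundaryCondition) (S : Finset ι) (k : ℕ) :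
    harmonicOfDegree b S k = harmonicParity b S k := by
  simp only [harmonicOfDegree, harmonicParity, parityExponentsEq, Nat.cast_inj]

theorem harmonicOfDegree_eq_bot (b : BoundaryCondition) (S : Finset ι) {ν : ℝ}
    (hν : ∀ k : ℕ, (k : ℝ) ≠ ν) : harmonicOfDegree b S ν = ⊥ := by
  rw [eq_bot_iff]
  rintro p ⟨hp, -⟩
  have hp' := (mem_restrictSupport_iff ℝ).1 hp
  rw [Submodule.mem_bot, ← MvPolynomial.support_eq_empty, Finset.eq_empty_iff_forall_notMem]
  exact fun m hm => hν _ (hp' hm).2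

instance finite_harmonicOfDegree (b : BoundaryCondition) (S : Finset ι) (ν : ℝ) :
    Module.Finite ℝ (harmonicOfDegree b S ν) := by
  by_cases h : ∃ k : ℕ, (k : ℝ) = ν
  · obtain ⟨k, rfl⟩ := h
    rw [harmonicOfDegree_natCast]
    infer_instance
  · push Not at h
    rw [harmonicOfDegree_eq_bot b S h]
    infer_instance

theorem polyEval_smul_of_mem_harmonicOfDegree {b : BoundaryCondition} {S : Finset ι} {ν : ℝ}
    {p : MvPolynomial ι ℝ} (hp : p ∈ harmonicOfDegree b S ν) (t : ℝ) (x : EuclideanSpace ℝ ι) : polyEval p (t • x) = t ^ ν * polyEval p x := by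
  by_cases h : ∃ k : ℕ, (k : ℝ) = ν
  · obtain ⟨k, rfl⟩ := h
    rw [harmonicOfDegree_natCast] at hp
    rw [Real.rpow_natCast]
    exact polyEval_smul_of_degree (restrictSupport_mono ℝ (fun m hm => hm.2) hp.1) t x
  · push Not at h
    rw [harmonicOfDegree_eq_bot b S h, Submodule.mem_bot] at hp
    simp [hp, polyEval]

theorem degreePart_mem {b : BoundaryCondition} {S : Finset ι} (ν : ℝ) {H : MvPolynomial ι ℝ}
    (hH : H ∈ restrictSupport ℝ (parityExponents b S)) (hH0 : laplacianPoly H = 0) :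
    degreePart ν H ∈ harmonicOfDegree b S ν := by
  refine Submodule.sum_mem _ fun k _ => ?_
  split_ifs with hk
  · subst hk
    rw [harmonicOfDegree_natCast]
    exact ⟨homogeneousComponent_mem_restrictSupport hH k,
      laplacianPoly_homogeneousComponent_eq_zero hH0 k⟩
  · exact Submodule.zero_mem _

/-- The open part of the ball used to compare functions in mean square. -/
def halfBallInterior (S : Finset ι) : Set (EuclideanSpace ℝ ι) :=
  {x | ∀ i ∈ S, 0 < x i} ∩ (Metric.ball 0 (1 / 2) ∩ {0}ᶜ)

theorem isOpen_halfBallInterior (S : Finset ι) : IsOpen (halfBallInterior S) :=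
  (isOpen_pos_coords S).inter (Metric.isOpen_ball.inter isOpen_compl_singleton)

variable {S : Finset ι} {b : BoundaryCondition} {h : partialSimplex S → ℝ}

/-- The approximant is the degree-`ν` part of a harmonic polynomial `H` uniformly close to `r^ν h`:
because `r^ν h` is homogeneous, `H` nearly is, and its other components are small. -/
theorem IsEigenfunction.exists_integral_sub_sq_le (hn : 2 ≤ Fintype.card ι) {ν : ℝ} (hν : 0 ≤ ν)
    (hh : IsEigenfunction b (eigenvalueOfDegree ι ν) h) {ε : ℝ} (hε : 0 < ε) :
    ∃ P ∈ harmonicOfDegree b S ν, ∫ x in halfBallInterior S,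
      (‖x‖ ^ ν * radialExt h x - polyEval P x) ^ 2 ≤ ε := by
  have : Nontrivial (EuclideanSpace ℝ ι) := by
    have : Nonempty ι := Fintype.card_pos_iff.1 (by omega)
    infer_instance
  obtain ⟨c, hc, hgap⟩ := exists_gap ν
  set I : ℝ := ∫ x : EuclideanSpace ℝ ι, ballWeight x with hI
  have hI0 : 0 ≤ I := integral_nonneg fun x => ballWeight_nonneg x
  -- a constant bounding all errors
  set A : ℝ := (volume (halfBallInterior S)).toReal with hA
  have hA0 : 0 ≤ A := ENNReal.toReal_nonneg
  have hUfin : volume (halfBallInterior S) ≠ ⊤ :=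
    ((measure_mono (fun x hx => hx.2.1)).trans_lt measure_ball_lt_top).ne
  set K : ℝ := 2 * A + 4 * (4 / c * I) + 1 with hK
  have hK0 : 0 < K := by positivity
  -- The total error found below is at most `K η²`; the summand 1 in `K` only ensures positivity.
  set η : ℝ := Real.sqrt (ε / K) with hη
  have hη0 : 0 < η := Real.sqrt_pos.2 (by positivity)
  have hη2 : η ^ 2 = ε / K := Real.sq_sqrt (by positivity)
  obtain ⟨H, hH, hH0, hHε⟩ := hh.exists_harmonic_near hn hν hη0
  refine ⟨degreePart ν H, degreePart_mem ν hH hH0, ?_⟩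
  have hν1 : (1 / 2 : ℝ) ^ ν ≤ 1 := Real.rpow_le_one (by norm_num) (by norm_num) hν
  have hν0 : 0 ≤ (1 / 2 : ℝ) ^ ν := Real.rpow_nonneg (by norm_num) ν
  have hδQ : ∀ x ∈ partialOrthant S, x ≠ 0 → ‖x‖ ≤ 1 →
      |polyEval H ((1 / 2 : ℝ) • x) - (1 / 2 : ℝ) ^ ν * polyEval H x| ≤ 2 * η := by
    intro x hx hx0 hx1
    have h1 := hHε x hx hx0 hx1
    have hhalf : ‖(1 / 2 : ℝ) • x‖ = 1 / 2 * ‖x‖ := by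
      rw [norm_smul]; norm_num
    have h2 := hHε ((1 / 2 : ℝ) • x) (smul_mem_partialOrthant hx (by norm_num))
      (smul_ne_zero (by norm_num) hx0) (by rw [hhalf]; linarith)
    rw [hhalf, radialExt_smul_pos h (by norm_num), Real.mul_rpow (by norm_num) (norm_nonneg x)] at h2
    have e : polyEval H ((1 / 2 : ℝ) • x) - (1 / 2 : ℝ) ^ ν * polyEval H x =
        (1 / 2 : ℝ) ^ ν * (‖x‖ ^ ν * radialExt h x - polyEval H x) -
        ((1 / 2 : ℝ) ^ ν * ‖x‖ ^ ν * radialExt h x - polyEval H ((1 / 2 : ℝ) • x)) := by ring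
    rw [e]
    refine (abs_sub _ _).trans ?_
    rw [abs_mul, abs_of_nonneg hν0]
    have := mul_le_mul hν1 h1 (abs_nonneg _) zero_le_one
    linarith
  -- Orthogonality is available on the full ball, not on the sector; reflection changes `H(x)` and
  -- `H(x/2)` by the same sign, so the estimate extends.
  have hδ : ∀ x : EuclideanSpace ℝ ι, x ≠ 0 → ‖x‖ ≤ 1 →
      |polyEval H ((1 / 2 : ℝ) • x) - (1 / 2 : ℝ) ^ ν * polyEval H x| ≤ 2 * η := by
    intro x hx0 hx1
    obtain ⟨σ, hσ, hfold⟩ := exists_sign_polyEval_foldPt b S x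
    have h1 := hδQ (foldPt S x) (foldPt_mem S x)
      (by rw [← norm_ne_zero_iff, norm_foldPt, norm_ne_zero_iff]; exact hx0)
      (by rw [norm_foldPt]; exact hx1)
    have h2 := hfold H hH (1 / 2)
    have h3 := hfold H hH 1
    rw [one_smul, one_smul] at h3
    have e : σ * polyEval H ((1 / 2 : ℝ) • x) - (1 / 2 : ℝ) ^ ν * (σ * polyEval H x) =
      σ * (polyEval H ((1 / 2 : ℝ) • x) - (1 / 2 : ℝ) ^ ν * polyEval H x) := by ring
    rwa [h2, h3, e, abs_mul, hσ, one_mul] at h1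
  have hmain := integral_sub_degreePart_sq_le hc hgap hH0 hδ
  set D : EuclideanSpace ℝ ι → ℝ := fun x => polyEval H x - polyEval (degreePart ν H) x with hD
  have hDc : Continuous D := (continuous_polyEval _).sub (continuous_polyEval _)
  have hDint : Integrable fun x : EuclideanSpace ℝ ι => D x ^ 2 * ballWeight x :=
    integrable_mul_ballWeight (hDc.pow 2)
  have hm := (isOpen_halfBallInterior S).measurableSet
  -- From `(a+D)² ≤ 2a² + 2D²`; on the half ball the weight is at least 1/2, so `2D²` is at most
  -- four times the weighted square.
  have hbound : ∀ x ∈ halfBallInterior S,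
      (‖x‖ ^ ν * radialExt h x - polyEval (degreePart ν H) x) ^ 2 ≤
        2 * η ^ 2 + 4 * (D x ^ 2 * ballWeight x) := by
    rintro x ⟨hx, hx1, hx0⟩
    have hx1' : ‖x‖ < 1 / 2 := by simpa using hx1
    have h1 := hHε x (fun i hi => (hx i hi).le) hx0 (by linarith)
    have h2 : (‖x‖ ^ ν * radialExt h x - polyEval H x) ^ 2 ≤ η ^ 2 :=
      sq_le_sq' (neg_le_of_abs_le h1) (le_of_abs_le h1)
    have h3 : (1 / 2 : ℝ) ≤ ballWeight x := by
      refine le_trans ?_ (le_max_right _ _)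
      nlinarith [norm_nonneg x]
    have h4 : D x ^ 2 * (1 / 2) ≤ D x ^ 2 * ballWeight x :=
      mul_le_mul_of_nonneg_left h3 (sq_nonneg _)
    have e : ‖x‖ ^ ν * radialExt h x - polyEval (degreePart ν H) x =
      (‖x‖ ^ ν * radialExt h x - polyEval H x) + D x := by simp only [hD]; ring
    rw [e]
    nlinarith [sq_nonneg ((‖x‖ ^ ν * radialExt h x - polyEval H x) - D x)]
  have hint1 : IntegrableOn (fun _ : EuclideanSpace ℝ ι => 2 * η ^ 2) (halfBallInterior S) :=
    integrableOn_const hUfin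
  have hint2 : IntegrableOn (fun x => 4 * (D x ^ 2 * ballWeight x)) (halfBallInterior S) :=
    (hDint.const_mul 4).integrableOn
  calc ∫ x in halfBallInterior S, (‖x‖ ^ ν * radialExt h x - polyEval (degreePart ν H) x) ^ 2
      ≤ ∫ x in halfBallInterior S, (2 * η ^ 2 + 4 * (D x ^ 2 * ballWeight x)) := by
        refine integral_mono_of_nonneg (Eventually.of_forall fun x => sq_nonneg _)
          (hint1.add hint2) ?_
        exact (ae_restrict_iff' hm).2 (Eventually.of_forall hbound)
    _ = 2 * η ^ 2 * A + 4 * ∫ x in halfBallInterior S, D x ^ 2 * ballWeight x := by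
        rw [integral_add hint1 hint2, setIntegral_const, integral_const_mul]
        simp only [smul_eq_mul, Measure.real, hA]
        ring
    _ ≤ 2 * η ^ 2 * A + 4 * ((2 * η) ^ 2 / c * I) := by
        have : ∫ x in halfBallInterior S, D x ^ 2 * ballWeight x ≤
            ∫ x, D x ^ 2 * ballWeight x :=
          setIntegral_le_integral hDint (Eventually.of_forall fun x =>
            mul_nonneg (sq_nonneg _) (ballWeight_nonneg x))
        linarith
    _ = η ^ 2 * (2 * A + 4 * (4 / c * I)) := by ring
    _ ≤ η ^ 2 * K := by
        refine mul_le_mul_of_nonneg_left ?_ (sq_nonneg η)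
        rw [hK]; linarith
    _ = ε := by rw [hη2]; field_simp

/-- Every eigenfunction is the restriction of a harmonic homogeneous polynomial. -/
theorem IsEigenfunction.exists_harmonicOfDegree (hn : 2 ≤ Fintype.card ι) {ν : ℝ} (hν : 0 ≤ ν)
    (hh : IsEigenfunction b (eigenvalueOfDegree ι ν) h) :
    ∃ P ∈ harmonicOfDegree b S ν, ∀ ω : partialSimplex S, h ω = polyEval P ω := by
  set U := halfBallInterior S with hU
  have hUo : IsOpen U := isOpen_halfBallInterior S
  have hUfin : volume U < ⊤ := (measure_mono (fun x hx => hx.2.1)).trans_lt measure_ball_lt_top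
  have : IsFiniteMeasure (volume.restrict U) := ⟨by simpa using hUfin⟩
  set F : EuclideanSpace ℝ ι → ℝ := fun x => ‖x‖ ^ ν * radialExt h x with hF
  have hFc : ∀ x ∈ partialOrthant S, x ≠ 0 → ContinuousWithinAt F (partialOrthant S) x :=
    fun x hx hx0 => (contDiffAt_norm_rpow ν hx0).continuousAt.continuousWithinAt.mul
      (continuousWithinAt_radialExt hh.continuous hx hx0)
  have hUQ : U ⊆ partialOrthant S := fun x hx i hi => (hx.1 i hi).le
  have hFU : ContinuousOn F U := fun x hx => (hFc x (hUQ hx) hx.2.2).mono hUQ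
  obtain ⟨B, hB⟩ := isCompact_univ.exists_bound_of_continuousOn hh.continuous.continuousOn
  have hFmem : MemLp F 2 (volume.restrict U) := by
    refine MemLp.of_bound (hFU.aestronglyMeasurable hUo.measurableSet) |B| ?_
    refine (ae_restrict_iff' hUo.measurableSet).2 (Eventually.of_forall fun x hx => ?_)
    have hx1 : ‖x‖ < 1 / 2 := by simpa using hx.2.1
    have h1 : ‖radialExt h x‖ ≤ |B| := by
      rw [radialExt, dif_pos ((normalize_mem_iff hx.2.2).2 (hUQ hx))]
      exact (hB _ (Set.mem_univ _)).trans (le_abs_self B)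
    have h2 : ‖x‖ ^ ν ≤ 1 := Real.rpow_le_one (norm_nonneg x) (by linarith) hν
    have h3 : 0 ≤ ‖x‖ ^ ν := Real.rpow_nonneg (norm_nonneg x) ν
    simp only [hF]
    rw [norm_mul, Real.norm_of_nonneg h3]
    calc ‖x‖ ^ ν * ‖radialExt h x‖ ≤ 1 * |B| := mul_le_mul h2 h1 (norm_nonneg _) zero_le_one
      _ = |B| := one_mul _
  have hpmem : ∀ p : MvPolynomial ι ℝ, MemLp (polyEval p) 2 (volume.restrict U) := by
    intro p
    obtain ⟨C, hC⟩ := (isCompact_closedBall (0 : EuclideanSpace ℝ ι) 1).exists_bound_of_continuousOn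
      (continuous_polyEval p).continuousOn
    refine MemLp.of_bound (continuous_polyEval p).aestronglyMeasurable C ?_
    refine (ae_restrict_iff' hUo.measurableSet).2 (Eventually.of_forall fun x hx => hC x ?_)
    have hx1 : ‖x‖ < 1 / 2 := by simpa using hx.2.1
    simp; linarith
  obtain ⟨P, hP, hPe⟩ := exists_ae_eq_polyEval hFmem hpmem fun ε hε =>
    hh.exists_integral_sub_sq_le hn hν hε
  have hEq : Set.EqOn F (polyEval P) U :=
    Measure.eqOn_open_of_ae_eq hPe hUo hFU (continuous_polyEval P).continuousOn
  -- equality on the interior of the cone, by homogeneity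
  have hEq2 : Set.EqOn F (polyEval P) {x | (∀ i ∈ S, 0 < x i) ∧ x ≠ 0} := by
    rintro x ⟨hx, hx0⟩
    have hpos : 0 < ‖x‖ := norm_pos_iff.2 hx0
    -- Rescales `x` to norm 1/4, inside the half ball; both sides are homogeneous of degree `ν`.
    set t : ℝ := (4 * ‖x‖)⁻¹ with ht
    have ht0 : 0 < t := by positivity
    have hnt : ‖t • x‖ = 1 / 4 := by
      rw [norm_smul, Real.norm_of_nonneg ht0.le, ht]; field_simp
    have hmem : t • x ∈ U := by
      refine ⟨fun i hi => by simpa using mul_pos ht0 (hx i hi), ?_, smul_ne_zero ht0.ne' hx0⟩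
      rw [mem_ball_zero_iff, hnt]; norm_num
    have := hEq hmem
    simp only [hF] at this ⊢
    rw [radialExt_smul_pos h ht0, polyEval_smul_of_mem_harmonicOfDegree hP t, norm_smul,
      Real.norm_of_nonneg ht0.le, Real.mul_rpow ht0.le (norm_nonneg x), mul_assoc] at this
    exact mul_left_cancel₀ (Real.rpow_pos_of_pos ht0 ν).ne' this
  have hEq3 : Set.EqOn F (polyEval P) (partialOrthant S ∩ {0}ᶜ) := by
    refine Set.EqOn.of_subset_closure hEq2
      (fun x hx => (hFc x hx.1 hx.2).mono Set.inter_subset_left)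
      (continuous_polyEval P).continuousOn ?_ ?_
    · exact fun x hx => ⟨fun i hi => (hx.1 i hi).le, hx.2⟩
    · intro x hx
      -- Moving along the sum of the basis vectors of `S` enters the interior at once, so each
      -- nonzero point of the cone is a limit of interior points.
      have hc : Continuous fun t : ℝ => x + t • ∑ i ∈ S, (stdVec i : EuclideanSpace ℝ ι) := by
        fun_prop
      have hl : Tendsto (fun t : ℝ => x + t • ∑ i ∈ S, (stdVec i : EuclideanSpace ℝ ι)) (𝓝[>] 0)
          (𝓝 x) := by
        have := (hc.tendsto 0).mono_left (nhdsWithin_le_nhds (s := Set.Ioi 0))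
        simpa using this
      refine mem_closure_of_tendsto hl ?_
      filter_upwards [self_mem_nhdsWithin, hl.eventually (isOpen_compl_singleton.mem_nhds hx.2)]
        with t ht hne
      refine ⟨fun i hi => ?_, hne⟩
      have h1 := hx.1 i hi
      have ht' : 0 < t := ht
      classical
      simp only [PiLp.add_apply, PiLp.smul_apply, smul_eq_mul, WithLp.ofLp_sum, Finset.sum_apply,
        stdVec_apply, Finset.sum_ite_eq, hi, if_true]
      linarith
  refine ⟨P, hP, fun ω => ?_⟩
  have hω0 : (ω : EuclideanSpace ℝ ι) ≠ 0 := by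
    intro h0; have := ω.2.1; rw [h0] at this; simp at this
  have := hEq3 (show (ω : EuclideanSpace ℝ ι) ∈ partialOrthant S ∩ {0}ᶜ from ⟨ω.2.2, hω0⟩)
  simpa [hF, ω.2.1, radialExt_of_mem] using this

end Spectrum

end SphericalSpectrum

namespace SphericalSpectrum

open InnerProductSpace Filter Topology MvPolynomial

/-! ### Harmonic polynomials give eigenfunctions; eigenspaces, degrees and multiplicities. -/

section Converse

variable {ι : Type*} [Fintype ι] {S : Finset ι} {b : BoundaryCondition}

/-- Restriction of polynomials to the spherical domain. -/
noncomputable def restrictPoly (S : Finset ι) :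
    MvPolynomial ι ℝ →ₗ[ℝ] (partialSimplex S → ℝ) where
  toFun p ω := polyEval p ω
  map_add' p q := by funext ω; simp [polyEval]
  map_smul' c p := by funext ω; simp [polyEval]

theorem radialExt_restrictPoly {k : ℕ} {P : MvPolynomial ι ℝ} (hP : P ∈ harmonicParity b S k)
    {x : EuclideanSpace ℝ ι} (hx : x ∈ partialOrthant S) (hx0 : x ≠ 0) :
    radialExt (restrictPoly S P) x = ‖x‖ ^ (-(k : ℝ)) * polyEval P x := by
  rw [radialExt, dif_pos ((normalize_mem_iff hx0).2 hx)]
  change polyEval P (‖x‖⁻¹ • x) = _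
  rw [polyEval_smul_of_degree (restrictSupport_mono ℝ (fun m hm => hm.2) hP.1),
    Real.rpow_neg (norm_nonneg x), Real.rpow_natCast, inv_pow]

/-- If the `i`-th constraint is absent or inactive at `x`, both `x + c eᵢ` and `x - c eᵢ` lie in the
cone for some `c > 0`, which bounds `v i` from both sides. -/
theorem eq_zero_of_isOuterNormal {x v : EuclideanSpace ℝ ι} (hx : x ∈ partialOrthant S)
    (hv : IsOuterNormal (partialOrthant S) x v) {i : ι} (hi : i ∈ S → 0 < x i) : v i = 0 := by
  classical
  obtain ⟨c, hc0, hc⟩ : ∃ c > 0, i ∈ S → c ≤ x i := by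
    by_cases h : i ∈ S
    · exact ⟨x i, hi h, fun _ => le_rfl⟩
    · exact ⟨1, one_pos, fun h' => absurd h' h⟩
  have hconv : Convex ℝ (partialOrthant S) := by
    intro y hy z hz a d ha hd _ j hj
    have := add_nonneg (mul_nonneg ha (hy j hj)) (mul_nonneg hd (hz j hj))
    simpa using this
  have key : ∀ t : ℝ, |t| = c → t * v i ≤ 0 := by
    intro t ht
    have hmem : x + t • stdVec i ∈ partialOrthant S := by
      intro j hj
      have h1 := hx j hj
      simp only [PiLp.add_apply, PiLp.smul_apply, stdVec_apply, smul_eq_mul]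
      split_ifs with hji
      · subst hji
        have := hc hj
        have := neg_abs_le t
        linarith
      · simpa using h1
    have h2 := hv (t • stdVec i) (mem_posTangentConeAt_of_segment_subset
      (hconv.segment_subset hx hmem))
    rwa [inner_smul_right, inner_stdVec] at h2
  have h1 := key c (abs_of_pos hc0)
  have h2 := key (-c) (by rw [abs_neg, abs_of_pos hc0])
  have : c * v i = 0 := by linarith
  exact (mul_eq_zero.1 this).resolve_left hc0.ne'

/-- Harmonic homogeneous polynomials of the right parity restrict to eigenfunctions. -/
theorem isEigenfunction_restrictPoly {k : ℕ} {P : MvPolynomial ι ℝ}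
    (hP : P ∈ harmonicParity b S k) :
    IsEigenfunction b (eigenvalueOfDegree ι k) (restrictPoly S P) := by
  have hPpar : P ∈ restrictSupport ℝ (parityExponents b S) :=
    restrictSupport_mono ℝ (fun m hm => hm.1) hP.1
  have hP0 : laplacianPoly P = 0 := hP.2
  set f : EuclideanSpace ℝ ι → ℝ := fun x => ‖x‖ ^ (-(k : ℝ)) * polyEval P x with hf
  have hfc : ∀ x, x ≠ 0 → ContDiffAt ℝ 2 f x := fun x hx =>
    (contDiffAt_norm_rpow _ hx).mul (contDiff_polyEval P).contDiffAt
  have hne : ∀ ω : partialSimplex S, (ω : EuclideanSpace ℝ ι) ≠ 0 := by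
    intro ω h0; have := ω.2.1; rw [h0] at this; simp at this
  have hev : ∀ ω : partialSimplex S,
      (ω : EuclideanSpace ℝ ι) ∈ interior (cone (partialSimplex S)) →
      radialExt (restrictPoly S P) =ᶠ[𝓝 (ω : EuclideanSpace ℝ ι)] f := by
    intro ω hω
    rw [cone_partialSimplex, mem_interior_iff_mem_nhds] at hω
    filter_upwards [hω, isOpen_compl_singleton.mem_nhds (hne ω)] with x hx hx0
    exact radialExt_restrictPoly hP hx hx0
  refine ⟨(continuous_polyEval P).comp continuous_subtype_val, fun ω hω => ?_, fun ω hω => ?_, ?_⟩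
  · exact (hfc ω (hne ω)).congr_of_eventuallyEq (hev ω hω)
  · have hd : fderiv ℝ (polyEval P) ω ω = (k : ℝ) * polyEval P ω :=
      fderiv_self_of_homogeneous (differentiable_polyEval P ω) fun t _ => by
        rw [Real.rpow_natCast]
        exact polyEval_smul_of_degree (restrictSupport_mono ℝ (fun m hm => hm.2) hP.1) t _
    -- For `r^(-k) P` the factor is `-k(-k+n-2) - 2k² = -k(k+n-2)`.
    rw [sphericalLaplacian, (laplacian_congr_nhds (hev ω hω)).eq_of_nhds,
      laplacian_norm_rpow_mul _ k (hne ω) (contDiff_polyEval P).contDiffAt hd,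
      laplacian_polyEval, hP0, ω.2.1, Real.one_rpow, eigenvalueOfDegree]
    change _ = _ * polyEval P ω
    simp [polyEval]
    ring
  · cases b with
    | dirichlet =>
      intro ω hω
      rw [cone_partialSimplex, mem_frontier_partialOrthant ω.2.2] at hω
      obtain ⟨i, hi, hi0⟩ := hω
      exact polyEval_eq_zero_of_dirichlet hPpar hi hi0
    | neumann =>
      refine ⟨fun ω => fderiv ℝ f ω, ?_, fun ω => ⟨?_, fun v hv => ?_⟩⟩
      · rw [continuous_iff_continuousAt]
        intro ω
        have h1 : ContDiffAt ℝ 1 (fderiv ℝ f) ω := (hfc ω (hne ω)).fderiv_right (by norm_num)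
        exact h1.continuousAt.comp continuous_subtype_val.continuousAt
      · rw [cone_partialSimplex]
        have h1 := ((hfc ω (hne ω)).differentiableAt (by norm_num)).hasFDerivAt.hasFDerivWithinAt
          (s := partialOrthant S)
        refine h1.congr_of_eventuallyEq ?_ (radialExt_restrictPoly hP ω.2.2 (hne ω))
        filter_upwards [self_mem_nhdsWithin,
          nhdsWithin_le_nhds (isOpen_compl_singleton.mem_nhds (hne ω))] with x hx hx0
        exact radialExt_restrictPoly hP hx hx0
      · rw [cone_partialSimplex] at hv
        change fderiv ℝ f ω v = 0
        rw [← sum_smul_stdVec v, map_sum]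
        refine Finset.sum_eq_zero fun i _ => ?_
        rw [map_smul, smul_eq_mul]
        -- Either the normal has no `i`-th component, or `ω i = 0` with `i ∈ S` and the `i`-th
        -- partial derivative of `f` vanishes by evenness.
        by_cases hi : i ∈ S → 0 < (ω : EuclideanSpace ℝ ι) i
        · rw [eq_zero_of_isOuterNormal ω.2.2 hv hi, zero_mul]
        · push Not at hi
          obtain ⟨hiS, hi0⟩ := hi
          have hωi : (ω : EuclideanSpace ℝ ι) i = 0 := le_antisymm hi0 (ω.2.2 i hiS)
          change v i * partialD i f ω = 0
          rw [hf, partialD_mul i ((contDiffAt_norm_rpow _ (hne ω)).differentiableAt (by norm_num))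
            (differentiable_polyEval P ω), partialD_norm_rpow _ (hne ω), hωi,
            partialD_polyEval_eq_zero_of_neumann hPpar hiS hωi]
          simp

theorem eigenspace_eq_map (hn : 2 ≤ Fintype.card ι) {ν : ℝ} (hν : 0 ≤ ν) :
    eigenspace b (partialSimplex S) (eigenvalueOfDegree ι ν) =
      (harmonicOfDegree b S ν).map (restrictPoly S) := by
  ext h
  constructor
  · intro hh
    obtain ⟨P, hP, hPe⟩ := IsEigenfunction.exists_harmonicOfDegree hn hν
      (show IsEigenfunction b _ h from hh)
    refine Submodule.mem_map.2 ⟨P, hP, ?_⟩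
    funext ω
    exact (hPe ω).symm
  · intro hh
    obtain ⟨P, hP', rfl⟩ := Submodule.mem_map.1 hh
    by_cases hk : ∃ k : ℕ, (k : ℝ) = ν
    · obtain ⟨k, rfl⟩ := hk
      rw [harmonicOfDegree_natCast] at hP'
      exact isEigenfunction_restrictPoly hP'
    · push Not at hk
      rw [harmonicOfDegree_eq_bot b S hk, Submodule.mem_bot] at hP'
      rw [hP', map_zero]
      exact Submodule.zero_mem _

/-- By homogeneity `P` vanishes at all points with positive coordinates, a set large enough to
determine a polynomial. -/
theorem restrictPoly_injOn (hn : 2 ≤ Fintype.card ι) {k : ℕ} {P : MvPolynomial ι ℝ}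
    (hP : P ∈ harmonicParity b S k) (h0 : restrictPoly S P = 0) : P = 0 := by
  refine eq_zero_of_polyEval_eq_zero hn fun x hx0 _ hx => ?_
  have hm := (normalize_mem_iff hx0).2 (show x ∈ partialOrthant S from fun i _ => (hx i).le)
  have h1 : polyEval P (‖x‖⁻¹ • x) = 0 := congrFun h0 ⟨_, hm⟩
  rw [polyEval_smul_of_degree (restrictSupport_mono ℝ (fun m hm => hm.2) hP.1)] at h1
  have : ‖x‖⁻¹ ^ k ≠ 0 := pow_ne_zero _ (inv_ne_zero (norm_ne_zero_iff.2 hx0))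
  exact (mul_eq_zero.1 h1).resolve_left this

theorem multiplicity_natCast (hn : 2 ≤ Fintype.card ι) (b : BoundaryCondition) (S : Finset ι)
    (k : ℕ) : multiplicity b (partialSimplex S) k = Module.finrank ℝ (harmonicParity b S k) := by
  rw [multiplicity, eigenspace_eq_map hn (Nat.cast_nonneg k), harmonicOfDegree_natCast]
  have hinj : Function.Injective ((restrictPoly S).domRestrict (harmonicParity b S k)) := by
    rw [← LinearMap.ker_eq_bot, LinearMap.ker_eq_bot']
    intro P hP
    exact Subtype.ext (restrictPoly_injOn hn P.2 hP)
  have := LinearMap.finrank_range_of_inj hinj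
  rwa [LinearMap.range_domRestrict] at this

theorem degrees_eq (hn : 2 ≤ Fintype.card ι) (b : BoundaryCondition) (S : Finset ι) :
    degrees b (partialSimplex S) =
      (fun k : ℕ => (k : ℝ)) '' {k | Module.finrank ℝ (harmonicParity b S k) ≠ 0} := by
  ext ν
  constructor
  · rintro ⟨hν, hne⟩
    rw [eigenspace_eq_map hn hν] at hne
    by_cases hk : ∃ k : ℕ, (k : ℝ) = ν
    · obtain ⟨k, rfl⟩ := hk
      refine ⟨k, fun h0 => hne ?_, rfl⟩
      rw [harmonicOfDegree_natCast, Submodule.finrank_eq_zero.1 h0, Submodule.map_bot]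
    · push Not at hk
      rw [harmonicOfDegree_eq_bot b S hk, Submodule.map_bot] at hne
      exact absurd rfl hne
  · rintro ⟨k, hk, rfl⟩
    refine ⟨Nat.cast_nonneg k, fun h0 => hk ?_⟩
    rw [← multiplicity_natCast hn, multiplicity, h0, finrank_bot]

/-- The spectral function of a partial simplex is the generating function of the dimensions of
the spaces of harmonic polynomials. -/
theorem isSpectralFunction_partialSimplex (hn : 2 ≤ Fintype.card ι) {M : ℝ → ℝ}
    (hM : ∀ z ∈ Set.Ioo (0 : ℝ) 1,
      HasSum (fun k : ℕ => (Module.finrank ℝ (harmonicParity b S k) : ℝ) * z ^ k) (M z)) :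
    IsSpectralFunction b (partialSimplex S) M := by
  have hn' : (2 : ℝ) ≤ Fintype.card ι := by exact_mod_cast hn
  refine ⟨fun lam hlam => ?_, fun lam => ?_, fun z hz => ?_⟩
  · by_contra! h
    exact hlam (eigenspace_eq_bot_of_neg hn h)
  · rcases lt_or_ge lam 0 with h | h
    · rw [eigenspace_eq_bot_of_neg hn h]
      infer_instance
    · obtain ⟨ν, hν, rfl⟩ : ∃ ν : ℝ, 0 ≤ ν ∧ eigenvalueOfDegree ι ν = lam := by
        set a : ℝ := ((Fintype.card ι : ℝ) - 2) / 2 with ha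
        have ha0 : 0 ≤ a := by rw [ha]; linarith
        -- The nonnegative root of `(ν + a)² = a² + lam`, which is `ν(ν+n-2) = lam` after completing
        -- the square.
        refine ⟨Real.sqrt (a ^ 2 + lam) - a, ?_, ?_⟩
        · rw [sub_nonneg]
          exact Real.le_sqrt_of_sq_le (by linarith)
        · have := Real.sq_sqrt (show 0 ≤ a ^ 2 + lam by positivity)
          rw [eigenvalueOfDegree, show (Fintype.card ι : ℝ) = 2 * a + 2 by rw [ha]; ring]
          linear_combination this
      rw [eigenspace_eq_map hn hν]
      infer_instance
  · set T : Set ℕ := {k | Module.finrank ℝ (harmonicParity b S k) ≠ 0} with hT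
    have h1 : HasSum ((fun k : ℕ => (Module.finrank ℝ (harmonicParity b S k) : ℝ) * z ^ k) ∘
        ((↑) : T → ℕ)) (M z) := by
      rw [hasSum_subtype_iff_of_support_subset]
      · exact hM z hz
      · intro k hk h0
        exact hk (by simp [h0])
    let e : T ≃ degrees b (partialSimplex S) :=
      (Equiv.Set.image (fun k : ℕ => (k : ℝ)) T Nat.cast_injective).trans
        (Equiv.setCongr (degrees_eq hn b S).symm)
    rw [← e.hasSum_iff]
    refine h1.congr_fun ?_
    intro k
    change (multiplicity b (partialSimplex S) ((k : ℕ) : ℝ) : ℝ) * z ^ (((k : ℕ) : ℝ)) = _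
    rw [multiplicity_natCast hn, Real.rpow_natCast]
    rfl

end Converse

end SphericalSpectrum

namespace SphericalSpectrum

open Filter Topology MvPolynomial

/-! ### Generating functions of monomials and of harmonic polynomials. -/

section Counting

theorem hasSum_of_eq {f g : ℕ → ℝ} {a c : ℝ} (h : HasSum f a) (hfg : ∀ k, g k = f k)
    (hac : a = c) : HasSum g c :=
  hac ▸ h.congr_fun hfg

theorem hasSum_coeff_mul {φ ψ : PowerSeries ℝ} {z s t : ℝ}
    (hφ : HasSum (fun k => PowerSeries.coeff k φ * z ^ k) s)
    (hψ : HasSum (fun k => PowerSeries.coeff k ψ * z ^ k) t) :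
    HasSum (fun k => PowerSeries.coeff k (φ * ψ) * z ^ k) (s * t) := by
  have hf := hφ.summable.norm
  have hg := hψ.summable.norm
  have e : ∀ k, PowerSeries.coeff k (φ * ψ) * z ^ k = ∑ ij ∈ Finset.HasAntidiagonal.antidiagonal k,
      (PowerSeries.coeff ij.1 φ * z ^ ij.1) * (PowerSeries.coeff ij.2 ψ * z ^ ij.2) := by
    intro k
    rw [PowerSeries.coeff_mul, Finset.sum_mul]
    refine Finset.sum_congr rfl fun ij hij => ?_
    rw [← Finset.HasAntidiagonal.mem_antidiagonal.1 hij, pow_add]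
    ring
  simp_rw [e]
  rw [← hφ.tsum_eq, ← hψ.tsum_eq, tsum_mul_tsum_eq_tsum_sum_antidiagonal_of_summable_norm hf hg]
  exact (summable_norm_sum_mul_antidiagonal_of_summable_norm hf hg).of_norm.hasSum

theorem hasSum_coeff_prod {ι : Type*} (T : Finset ι) {φ : ι → PowerSeries ℝ} {z : ℝ} {s : ι → ℝ}
    (h : ∀ i, HasSum (fun k => PowerSeries.coeff k (φ i) * z ^ k) (s i)) :
    HasSum (fun k => PowerSeries.coeff k (∏ i ∈ T, φ i) * z ^ k) (∏ i ∈ T, s i) := by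
  classical
  induction T using Finset.induction_on with
  | empty =>
    have := hasSum_single (f := fun k => PowerSeries.coeff k (1 : PowerSeries ℝ) * z ^ k) 0
      fun k hk => by simp [PowerSeries.coeff_one, hk]
    simpa using this
  | insert i T hi ih =>
    rw [Finset.prod_insert hi, Finset.prod_insert hi]
    exact hasSum_coeff_mul (h i) ih

variable {ι : Type*} [Fintype ι] [DecidableEq ι]

/-- The generating series of the admissible exponents of one variable. -/
noncomputable def exponentSeries (b : BoundaryCondition) (S : Finset ι) (i : ι) : PowerSeries ℝ :=
  PowerSeries.mk fun k => if i ∈ S → k % 2 = b.bit then 1 else 0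

theorem hasSum_exponentSeries (b : BoundaryCondition) (S : Finset ι) (i : ι) {z : ℝ}
    (hz : z ∈ Set.Ioo (0 : ℝ) 1) :
    HasSum (fun k => PowerSeries.coeff k (exponentSeries b S i) * z ^ k)
      (if i ∈ S then z ^ b.bit * (1 - z ^ 2)⁻¹ else (1 - z)⁻¹) := by
  simp only [exponentSeries, PowerSeries.coeff_mk]
  split_ifs with hi
  · have hz2 : z ^ 2 < 1 := by nlinarith [hz.1, hz.2]
    have h1 := (hasSum_geometric_of_lt_one (sq_nonneg z) hz2).mul_left (z ^ b.bit)
    have hinj : Function.Injective fun j : ℕ => 2 * j + b.bit := fun j k h => by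
      simp only at h; omega
    rw [← hinj.hasSum_iff]
    · refine h1.congr_fun fun j => ?_
      have hb := b.bit_lt
      simp only [Function.comp_apply]
      rw [if_pos fun _ => by omega, one_mul, pow_add, pow_mul]
      ring
    · intro k hk
      rw [if_neg, zero_mul]
      intro h
      refine hk ⟨k / 2, ?_⟩
      have := h hi
      simp only
      omega
  · simpa [hi] using hasSum_geometric_of_lt_one hz.1.le hz.2

/-- The parity condition is imposed variable by variable, so the admissible exponents have a product
as generating series. -/
theorem coeff_prod_exponentSeries (b : BoundaryCondition) (S : Finset ι) (k : ℕ) :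
    PowerSeries.coeff k (∏ i, exponentSeries b S i) = Nat.card (parityExponentsEq b S k) := by
  classical
  rw [PowerSeries.coeff_prod]
  have e : ∀ l : ι →₀ ℕ, ∏ i, PowerSeries.coeff (l i) (exponentSeries b S i) =
      if l ∈ parityExponents b S then (1 : ℝ) else 0 := by
    intro l
    simp only [exponentSeries, PowerSeries.coeff_mk]
    by_cases h : l ∈ parityExponents b S
    · rw [if_pos h]
      refine Finset.prod_eq_one fun i _ => ?_
      rw [if_pos (h i)]
    · rw [if_neg h]
      obtain ⟨i, hi, hne⟩ : ∃ i ∈ S, l i % 2 ≠ b.bit := by simpa [parityExponents] using h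
      refine Finset.prod_eq_zero (Finset.mem_univ i) ?_
      rw [if_neg fun h => hne (h hi)]
  simp_rw [e]
  rw [Finset.sum_boole]
  congr 1
  rw [← Nat.card_eq_finsetCard]
  refine Nat.card_congr (Equiv.subtypeEquivRight fun l => ?_)
  simp [parityExponentsEq, Finsupp.degree_eq_sum, and_comm]

/-- The generating function of the dimensions of the spaces of harmonic polynomials. -/
theorem hasSum_finrank_harmonicParity (hn : 2 ≤ Fintype.card ι) (b : BoundaryCondition)
    (S : Finset ι) {z : ℝ} (hz : z ∈ Set.Ioo (0 : ℝ) 1) :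
    HasSum (fun k : ℕ => (Module.finrank ℝ (harmonicParity b S k) : ℝ) * z ^ k)
      ((1 - z ^ 2) * ∏ i, if i ∈ S then z ^ b.bit * (1 - z ^ 2)⁻¹ else (1 - z)⁻¹) := by
  have hA := hasSum_coeff_prod Finset.univ (φ := exponentSeries b S)
    fun i => hasSum_exponentSeries b S i hz
  simp_rw [coeff_prod_exponentSeries] at hA
  set A := ∏ i, if i ∈ S then z ^ b.bit * (1 - z ^ 2)⁻¹ else (1 - z)⁻¹
  -- The recurrence starts at degree 2. In degrees 0 and 1 everything is harmonic, and these two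
  -- terms are compared by hand.
  rw [← hasSum_nat_add_iff' 2]
  have h1 := ((hasSum_nat_add_iff' 2).2 hA).sub (hA.mul_left (z ^ 2))
  refine hasSum_of_eq h1 (fun k => ?_) ?_
  · have h2 := finrank_harmonicParity_add hn b S k
    have h3 : (Module.finrank ℝ (harmonicParity b S (k + 2)) : ℝ) +
      Nat.card (parityExponentsEq b S k) = Nat.card (parityExponentsEq b S (k + 2)) := by
      exact_mod_cast h2
    rw [← h3]; ring
  · simp only [Finset.sum_range_succ, Finset.sum_range_zero,
      finrank_harmonicParity_of_lt b S (k := 0) (by norm_num),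
      finrank_harmonicParity_of_lt b S (k := 1) (by norm_num)]
    ring

theorem card_parityExponentsEq_empty (b : BoundaryCondition) (k : ℕ) :
    Nat.card (parityExponentsEq b (∅ : Finset ι) k) = (Fintype.card ι + k - 1).choose k := by
  rw [← Finset.card_univ, ← Finset.card_finsuppAntidiag_nat_eq_choose, ← Nat.card_eq_finsetCard]
  refine Nat.card_congr (Equiv.subtypeEquivRight fun l => ?_)
  simp [parityExponentsEq, parityExponents, Finsupp.degree_eq_sum]

theorem finrank_harmonicParity_empty (hn : 2 ≤ Fintype.card ι) (b : BoundaryCondition) (k : ℕ) :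
    Module.finrank ℝ (harmonicParity b (∅ : Finset ι) (k + 2)) +
      (Fintype.card ι + (k + 2) - 3).choose k = (Fintype.card ι + (k + 2) - 1).choose (k + 2) := by
  have h := finrank_harmonicParity_add hn b (∅ : Finset ι) k
  rwa [card_parityExponentsEq_empty, card_parityExponentsEq_empty,
    show Fintype.card ι + k - 1 = Fintype.card ι + (k + 2) - 3 by omega] at h

/-- For `k ≥ 2`, applying Pascal's rule twice exhibits the subtracted binomial as a summand and
leaves a positive one over, as `n ≥ 2`. -/
theorem finrank_harmonicParity_empty_ne_zero (hn : 2 ≤ Fintype.card ι) (b : BoundaryCondition)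
    (k : ℕ) : Module.finrank ℝ (harmonicParity b (∅ : Finset ι) k) ≠ 0 := by
  obtain ⟨m, hm⟩ := Nat.exists_eq_add_of_le' hn
  rcases lt_or_ge k 2 with hk | hk
  · rw [finrank_harmonicParity_of_lt b _ hk, card_parityExponentsEq_empty]
    exact (Nat.choose_pos (by omega)).ne'
  · obtain ⟨j, rfl⟩ := Nat.exists_eq_add_of_le' hk
    have h := finrank_harmonicParity_empty hn b j
    rw [hm] at h
    rw [show m + 2 + (j + 2) - 3 = m + j + 1 by omega,
      show m + 2 + (j + 2) - 1 = m + j + 1 + 1 + 1 by omega, Nat.choose_succ_succ' (m + j + 1 + 1),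
      Nat.choose_succ_succ' (m + j + 1) j] at h
    have : 0 < (m + j + 1 + 1).choose (j + 1 + 1) := Nat.choose_pos (by omega)
    omega

/-- Odd exponents are at least 1, so no admissible monomial has degree below `n`, while the product
of all coordinates has degree `n`. As there is none in degree `n - 2`, the recurrence gives a
nonzero dimension in degree `n`. -/
theorem isLeast_degrees_dirichlet_univ (hn : 2 ≤ Fintype.card ι) :
    IsLeast {k | Module.finrank ℝ (harmonicParity .dirichlet (Finset.univ : Finset ι) k) ≠ 0}
      (Fintype.card ι) := by
  have hdeg : ∀ m ∈ parityExponents .dirichlet (Finset.univ : Finset ι),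
      Fintype.card ι ≤ m.degree := by
    intro m hm
    rw [Finsupp.degree_eq_sum, ← Finset.card_univ, Finset.card_eq_sum_ones]
    refine Finset.sum_le_sum fun i hi => ?_
    have : m i % 2 = 1 := hm i hi
    omega
  constructor
  · obtain ⟨j, hj⟩ := Nat.exists_eq_add_of_le' hn
    have h := finrank_harmonicParity_add hn .dirichlet (Finset.univ : Finset ι) j
    have h0 : Nat.card (parityExponentsEq .dirichlet (Finset.univ : Finset ι) j) = 0 := by
      rw [Nat.card_eq_zero]
      left
      refine ⟨fun m => ?_⟩
      have h1 := hdeg m.1 m.2.1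
      have h2 : m.1.degree = j := m.2.2
      omega
    have h1 : Nat.card (parityExponentsEq .dirichlet (Finset.univ : Finset ι) (j + 2)) ≠ 0 := by
      have := (finite_parityExponentsEq .dirichlet (Finset.univ : Finset ι) (j + 2)).to_subtype
      have : Nonempty (parityExponentsEq .dirichlet (Finset.univ : Finset ι) (j + 2)) := by
        refine ⟨faceExponent Finset.univ, fun i _ => ?_, ?_⟩
        · simp [faceExponent, BoundaryCondition.bit]
        · rw [Finsupp.degree_eq_sum]
          simp [faceExponent, hj]
      exact Nat.card_pos.ne'
    rw [Set.mem_ofPred_eq, hj]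
    omega
  · intro k hk
    by_contra! hlt
    refine hk ?_
    have : harmonicParity .dirichlet (Finset.univ : Finset ι) k = ⊥ := by
      rw [eq_bot_iff]
      rintro p ⟨hp, -⟩
      have hp' := (mem_restrictSupport_iff ℝ).1 hp
      rw [Submodule.mem_bot, ← MvPolynomial.support_eq_empty, Finset.eq_empty_iff_forall_notMem]
      intro m hm
      have h1 := hdeg m (hp' hm).1
      have h2 : m.degree = k := (hp' hm).2
      omega
    rw [this, finrank_bot]

end Counting

/-! ### The three families of domains as partial simplices. -/

section Domains

variable {ι κ : Type*} [Fintype ι] [Fintype κ]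

theorem unitSphere_eq : unitSphere ι = partialSimplex (∅ : Finset ι) := by
  ext x; simp [unitSphere, partialSimplex]

theorem orthantSimplex_eq : orthantSimplex ι = partialSimplex (Finset.univ : Finset ι) := by
  ext x; simp [orthantSimplex, partialSimplex]

theorem join_eq : join (unitSphere ι) (orthantSimplex κ) =
    partialSimplex (Finset.univ.map Function.Embedding.inr : Finset (ι ⊕ κ)) := by
  ext x
  rw [unitSphere_eq, orthantSimplex_eq]
  simp only [join, cone_partialSimplex]
  simp [partialSimplex, partialOrthant]

theorem harmonicHomogeneous_eq (b : BoundaryCondition) (n k : ℕ) :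
    harmonicHomogeneous n k = harmonicParity b (∅ : Finset (Fin n)) k := by
  rw [harmonicHomogeneous, harmonicParity, homogeneousSubmodule_eq_finsupp_supported]
  congr 1
  change restrictSupport ℝ _ = restrictSupport ℝ _
  congr 1
  ext m
  simp [parityExponentsEq, parityExponents]

end Domains

end SphericalSpectrum

/-! ### Assembling the spectral functions. -/

open SphericalSpectrum in
theorem mainTheorem3 :
    -- the whole sphere
    (∀ n : ℕ, 2 ≤ n → ∀ b : BoundaryCondition,
      IsSpectralFunction b (unitSphere (Fin n))
        (fun z : ℝ => (1 - z ^ 2) * (1 - z) ^ (-(n : ℤ))) ∧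
      (∀ z ∈ Set.Ioo (0 : ℝ) 1,
        HasSum (fun j : ℕ =>
            (((n + (j + 2) - 1).choose (j + 2) : ℝ) - ((n + (j + 2) - 3).choose j : ℝ)) *
              z ^ (j + 2))
          ((1 - z ^ 2) * (1 - z) ^ (-(n : ℤ)) - (1 + n * z))) ∧
      degrees b (unitSphere (Fin n)) = Set.range (fun k : ℕ => (k : ℝ)) ∧
      (∀ k : ℕ, multiplicity b (unitSphere (Fin n)) k =
        Module.finrank ℝ (harmonicHomogeneous n k)) ∧
      multiplicity b (unitSphere (Fin n)) 0 = 1 ∧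
      multiplicity b (unitSphere (Fin n)) 1 = n ∧
      (∀ k : ℕ, 2 ≤ k →
        (multiplicity b (unitSphere (Fin n)) k : ℤ) =
          ((n + k - 1).choose k : ℤ) - ((n + k - 3).choose (k - 2) : ℤ))) ∧
    -- the orthant simplex
    (∀ n : ℕ, 2 ≤ n →
      IsSpectralFunction .dirichlet (orthantSimplex (Fin n))
        (fun z : ℝ => z ^ n * (1 - z ^ 2) ^ (1 - (n : ℤ))) ∧
      (∀ z ∈ Set.Ioo (0 : ℝ) 1,
        HasSum (fun j : ℕ =>
            ((n + (j + 1) - 3).choose j : ℝ) * z ^ (n + 2 * (j + 1) - 2))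
          (z ^ n * (1 - z ^ 2) ^ (1 - (n : ℤ)))) ∧
      IsLeast (degrees .dirichlet (orthantSimplex (Fin n))) (n : ℝ) ∧
      IsSpectralFunction .neumann (orthantSimplex (Fin n))
        (fun z : ℝ => (1 - z ^ 2) ^ (1 - (n : ℤ)))) ∧
    -- the join of a sphere and an orthant simplex
    (∀ p q : ℕ, 1 ≤ p → 1 ≤ q →
      IsSpectralFunction .dirichlet (join (unitSphere (Fin p)) (orthantSimplex (Fin q)))
        (fun z : ℝ => z ^ q * (1 - z) ^ (-(p : ℤ)) * (1 - z ^ 2) ^ (1 - (q : ℤ))) ∧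
      IsSpectralFunction .neumann (join (unitSphere (Fin p)) (orthantSimplex (Fin q)))
        (fun z : ℝ => (1 - z) ^ (-(p : ℤ)) * (1 - z ^ 2) ^ (1 - (q : ℤ)))) := by
  have hsq : ∀ z ∈ Set.Ioo (0 : ℝ) 1, 1 - z ^ 2 ≠ 0 := fun z hz => by
    have h1 := hz.1; have h2 := hz.2
    nlinarith
  have hzpow : ∀ z ∈ Set.Ioo (0 : ℝ) 1, ∀ n : ℕ,
      (1 - z ^ 2) ^ (1 - (n : ℤ)) = (1 - z ^ 2) * ((1 - z ^ 2)⁻¹) ^ n := fun z hz n => by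
    rw [zpow_sub₀ (hsq z hz), zpow_one, zpow_natCast, inv_pow, div_eq_mul_inv]
  refine ⟨fun n hn b => ?_, fun n hn => ?_, fun p q hp hq => ?_⟩
  · have hc : 2 ≤ Fintype.card (Fin n) := by simpa using hn
    have hsum : ∀ z ∈ Set.Ioo (0 : ℝ) 1, HasSum
        (fun k : ℕ => (Module.finrank ℝ (harmonicParity b (∅ : Finset (Fin n)) k) : ℝ) * z ^ k)
        ((1 - z ^ 2) * (1 - z) ^ (-(n : ℤ))) := fun z hz => by
      have := hasSum_finrank_harmonicParity hc b (∅ : Finset (Fin n)) hz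
      simpa using this
    have h0 : Module.finrank ℝ (harmonicParity b (∅ : Finset (Fin n)) 0) = 1 := by
      rw [finrank_harmonicParity_of_lt b _ (by norm_num), card_parityExponentsEq_empty]
      simp
    have h1 : Module.finrank ℝ (harmonicParity b (∅ : Finset (Fin n)) 1) = n := by
      rw [finrank_harmonicParity_of_lt b _ (by norm_num), card_parityExponentsEq_empty]
      simp
    have hk : ∀ j, Module.finrank ℝ (harmonicParity b (∅ : Finset (Fin n)) (j + 2)) +
        (n + (j + 2) - 3).choose j = (n + (j + 2) - 1).choose (j + 2) := fun j => by
      simpa using finrank_harmonicParity_empty hc b j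
    rw [unitSphere_eq]
    refine ⟨isSpectralFunction_partialSimplex hc hsum, fun z hz => ?_, ?_, fun k => ?_, ?_, ?_,
      fun k hk2 => ?_⟩
    · have h2 := (hasSum_nat_add_iff' 2).2 (hsum z hz)
      refine hasSum_of_eq h2 (fun j => ?_) ?_
      · rw [← hk j]; push_cast; ring
      · simp [Finset.sum_range_succ, h0, h1]
    · rw [degrees_eq hc]
      ext ν
      simp [finrank_harmonicParity_empty_ne_zero hc]
    · rw [multiplicity_natCast hc, harmonicHomogeneous_eq b]
    · have := multiplicity_natCast hc b ∅ 0
      rwa [Nat.cast_zero, h0] at this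
    · have := multiplicity_natCast hc b ∅ 1
      rwa [Nat.cast_one, h1] at this
    · obtain ⟨j, rfl⟩ := Nat.exists_eq_add_of_le' hk2
      rw [multiplicity_natCast hc, ← hk j]
      simp
  · have hc : 2 ≤ Fintype.card (Fin n) := by simpa using hn
    rw [orthantSimplex_eq]
    refine ⟨isSpectralFunction_partialSimplex hc fun z hz => ?_, fun z hz => ?_, ?_,
      isSpectralFunction_partialSimplex hc fun z hz => ?_⟩
    · refine hasSum_of_eq (hasSum_finrank_harmonicParity hc _ _ hz) (fun _ => rfl) ?_
      rw [hzpow z hz]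
      simp [BoundaryCondition.bit, mul_pow]
      ring
    · obtain ⟨m, rfl⟩ := Nat.exists_eq_add_of_le' hn
      have hz2 : ‖z ^ 2‖ < 1 := by
        rw [Real.norm_of_nonneg (sq_nonneg z)]
        nlinarith [hz.1, hz.2]
      -- Negative binomial series in `z²` with exponent `m + 1 = n - 1`.
      have := (hasSum_choose_mul_geometric_of_norm_lt_one m hz2).mul_left (z ^ (m + 2))
      refine hasSum_of_eq this (fun j => ?_) ?_
      · rw [show m + 2 + (j + 1) - 3 = j + m by omega,
          show m + 2 + 2 * (j + 1) - 2 = m + 2 + 2 * j by omega, pow_add z (m + 2), pow_mul,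
          ← Nat.choose_symm_add]
        ring
      · rw [hzpow z hz, pow_succ _ (m + 1), one_div, inv_pow]
        field_simp [hsq z hz]
        ring
    · rw [degrees_eq hc]
      have := isLeast_degrees_dirichlet_univ hc
      rw [Fintype.card_fin] at this
      exact ⟨⟨n, this.1, rfl⟩, by
        rintro _ ⟨k, hk, rfl⟩
        exact Nat.cast_le.2 (this.2 hk)⟩
    · refine hasSum_of_eq (hasSum_finrank_harmonicParity hc _ _ hz) (fun _ => rfl) ?_
      rw [hzpow z hz]
      simp [BoundaryCondition.bit]
  · have hc : 2 ≤ Fintype.card (Fin p ⊕ Fin q) := by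
      rw [Fintype.card_sum, Fintype.card_fin, Fintype.card_fin]; omega
    rw [join_eq]
    refine ⟨isSpectralFunction_partialSimplex hc fun z hz => ?_,
      isSpectralFunction_partialSimplex hc fun z hz => ?_⟩
    · refine hasSum_of_eq (hasSum_finrank_harmonicParity hc _ _ hz) (fun _ => rfl) ?_
      rw [hzpow z hz]
      simp [BoundaryCondition.bit, mul_pow]
      ring
    · refine hasSum_of_eq (hasSum_finrank_harmonicParity hc _ _ hz) (fun _ => rfl) ?_
      rw [hzpow z hz]
      simp [BoundaryCondition.bit]
      ring
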